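/- Let $k$ be a field and let $\alpha(t)=p(t)/q(t)$ be a rational function with coprime $p,q\in k[t]$ and $q(0)=1$. Put $m=\max\{\deg p+1,\deg q\}$ (with $\deg 0=-1$) and $u_\alpha(t)=t^{m}q(t^{-1})\in k[t]$. Let $K'$ be a splitting field of $u_\alpha$ over $k$ and let $K$ be the separable closure of $k$ in $K'$, so that $K/k$ is a finite Galois extension and $K'/K$ is purely inseparable. Let $G=\operatorname{Gal}(K|k)$, and let $\alpha^K$ denote $\alpha$ regarded as a rational function over $K$. For $n\ge 0$ let $P_n=K[x_1,\dots,x_n]/(u_\alpha(x_1),\dots,u_\alpha(x_n))$, on which the symmetric group $S_n$ acts by $\sigma(x_i)=x_{\sigma(i)}$, and let $P_n\rtimes K[S_n]$ be the crossed product, with multiplication $(a\otimes\sigma)(b\otimes\tau)=a\,\sigma(b)\otimes\sigma\tau$. Let $$\mathcal S_{\alpha^K}=\bigoplus_{n\ge 0}\operatorname{fproj}\text{-}(P_n\rtimes K[S_n])$$ be the direct sum of the categories of finitely generated projective right modules. The group $G$ acts on each ring $P_n\rtimes K[S_n]$ through the coefficients, and hence acts strictly on $\mathcal S_{\alpha^K}$: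 $T_g(M)$ is $M$ with the new right action $m*r=m\,g^{-1}(r)$, and $T_g$ does not change the underlying maps of morphisms. Let $(\mathcal S_{\alpha^K})^G$ be the category of $G$-equivariant objects, i.e. objects $X$ with isomorphisms $\alpha_g\colon T_g(X)\to X$ $(g\in G)$ such that $\alpha_1=\operatorname{id}$ and $\alpha_h\circ T_h(\alpha_g)=\alpha_{hg}$; morphisms $(X,(\alpha_g)_g)\to(Y,(\beta_g)_g)$ are the morphisms $\gamma\colon X\to Y$ with $\gamma\circ\alpha_g=\beta_g\circ T_g(\gamma)$ for all $g$. Let $\operatorname{K}_0$ denote the additive Grothendieck group (generated by the classes $[X]$ of objects, with $[X]+[Y]=[Z]$ whenever $Z\cong X\oplus Y$). The group $G$ acts on $\operatorname{K}_0(\mathcal S_{\alpha^K})$ by $g[X]=[T_g(X)]$. **Theorem.** One has $$\operatorname{K}_0\big((\mathcal S_{\alpha^K})^G\big)=\operatorname{K}_0(\mathcal S_{\alpha^K})^G ,$$ i.e. the homomorphism $\operatorname{K}_0((\mathcal S_{\alpha^K})^G)\to \operatorname{K}_0(\mathcal S_{\alpha^K})$ induced by the forgetful functor $(X,(\alpha_g)_g)\mapsto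 X$ is injective, and its image is the subgroup of $G$-invariants. In particular every orbit sum is realized by an equivariant object: let $V\in\mathcal S_{\alpha^K}$ be indecomposable, let $G_V$ be the stabilizer of $[V]$, and let $g_1,\dots,g_s$ be representatives of the cosets in $G/G_V$. Then there is a $G$-equivariant object $(F,(\alpha_g)_g)$ with $F\cong\bigoplus_{i=1}^s T_{g_i}(V)$, such that $\alpha_g\colon T_g(F)\to F$ maps the $i$-th summand to the $j$-th summand, where $gg_i\in g_jG_V$; in particular, $[F]$ is the sum of the elements of the $G$-orbit of $[V]$. -/

import Mathlib

open CategoryTheory CategoryTheory.Limits Polynomial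

universe u v w

namespace KSInterpolation

/-! ### Strict group actions on categories and equivariant objects -/

section Equivariant

/-- A strict (left) action of a group `G` on a preadditive category `C`: additive endofunctors
`T g` with `T 1 = id` and `T (g * h) = T g ∘ T h` (equalities of functors). -/
class StrictAction (G : Type*) [Group G] (C : Type u) [Category.{v} C] [Preadditive C] where
  T : G → C ⥤ C
  additive : ∀ g, (T g).Additive
  T_one : T 1 = 𝟭 C
  T_mul : ∀ g h, T (g * h) = T h ⋙ T g

attribute [instance] StrictAction.additive

variable (G : Type*) [Group G] (C : Type u) [Category.{v} C] [Preadditive C] [StrictAction G C]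

variable {C} in
theorem StrictAction.one_obj (X : C) : (StrictAction.T (1 : G)).obj X = X := by
  rw [StrictAction.T_one]; rfl

variable {G C} in
theorem StrictAction.mul_obj (g h : G) (X : C) :
    (StrictAction.T g).obj ((StrictAction.T h).obj X) = (StrictAction.T (g * h)).obj X := by
  rw [StrictAction.T_mul]; rfl

open StrictAction

/-- A `G`-equivariant object: an object `X` with isomorphisms `α g : T g X ≅ X` such that
`α 1 = id` and `α h ∘ T h (α g) = α (h * g)`.  The morphisms `eqToHom _` are the identities
`T 1 X = X` and `T h (T g X) = T (h * g) X` provided by strictness of the action. -/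
structure EquivariantObject where
  X : C
  α : ∀ g : G, (T g).obj X ≅ X
  α_one : (α 1).hom = eqToHom (one_obj G X)
  α_mul : ∀ h g : G,
    (T h).map (α g).hom ≫ (α h).hom = eqToHom (mul_obj h g X) ≫ (α (h * g)).hom

namespace EquivariantObject

variable {G C}

/-- A morphism of equivariant objects: a morphism `f` with `f ∘ α g = β g ∘ T g f`. -/
@[ext]
structure Hom (A B : EquivariantObject G C) where
  hom : A.X ⟶ B.X
  comm : ∀ g : G, (A.α g).hom ≫ hom = (T g).map hom ≫ (B.α g).hom

instance : Category.{v} (EquivariantObject G C) where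
  Hom A B := Hom A B
  id A := ⟨𝟙 A.X, fun g => by simp⟩
  comp f f' := ⟨f.hom ≫ f'.hom, fun g => by
    rw [← Category.assoc, f.comm, Category.assoc, f'.comm, Functor.map_comp, Category.assoc]⟩

@[ext]
theorem hom_ext {A B : EquivariantObject G C} {f f' : A ⟶ B} (h : f.hom = f'.hom) : f = f' :=
  Hom.ext h

@[simp] theorem id_hom (A : EquivariantObject G C) : Hom.hom (𝟙 A) = 𝟙 A.X := rfl

@[simp] theorem comp_hom {A B D : EquivariantObject G C} (f : A ⟶ B) (f' : B ⟶ D) :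
    (f ≫ f').hom = f.hom ≫ f'.hom := rfl

instance (A B : EquivariantObject G C) : Zero (A ⟶ B) :=
  ⟨⟨0, fun g => by simp⟩⟩
instance (A B : EquivariantObject G C) : Add (A ⟶ B) :=
  ⟨fun f f' => ⟨f.hom + f'.hom, fun g => by
    simp [Preadditive.add_comp, Preadditive.comp_add, f.comm, f'.comm, Functor.map_add]⟩⟩
instance (A B : EquivariantObject G C) : Neg (A ⟶ B) :=
  ⟨fun f => ⟨-f.hom, fun g => by simp [f.comm, Functor.map_neg]⟩⟩
instance (A B : EquivariantObject G C) : Sub (A ⟶ B) :=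
  ⟨fun f f' => ⟨f.hom - f'.hom, fun g => by simp [f.comm, f'.comm, Functor.map_sub]⟩⟩
instance (A B : EquivariantObject G C) : SMul ℕ (A ⟶ B) :=
  ⟨fun n f => ⟨n • f.hom, fun g => by simp [f.comm]⟩⟩
instance (A B : EquivariantObject G C) : SMul ℤ (A ⟶ B) :=
  ⟨fun n f => ⟨n • f.hom, fun g => by simp [f.comm]⟩⟩

instance (A B : EquivariantObject G C) : AddCommGroup (A ⟶ B) :=
  Function.Injective.addCommGroup (fun f : A ⟶ B => f.hom) (fun _ _ h => hom_ext h)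
    rfl (fun _ _ => rfl) (fun _ => rfl) (fun _ _ => rfl) (fun _ _ => rfl) (fun _ _ => rfl)

instance : Preadditive (EquivariantObject G C) where
  homGroup := inferInstance
  add_comp _ _ _ _ _ _ := hom_ext (Preadditive.add_comp _ _ _ _ _ _)
  comp_add _ _ _ _ _ _ := hom_ext (Preadditive.comp_add _ _ _ _ _ _)

variable (G C) in
/-- The forgetful functor from equivariant objects to underlying objects. -/
def forget : EquivariantObject G C ⥤ C where
  obj A := A.X
  map f := f.hom

instance : (forget G C).Additive where
  map_add := rfl

end EquivariantObject

end Equivariant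

/-! ### The additive Grothendieck group -/

section GrothendieckGroup

/-- The relations `[X] + [Y] = [Z]` whenever `Z ≅ X ⊕ Y`. -/
def K0Rel (C : Type u) [Category.{v} C] [Preadditive C] : Set (FreeAbelianGroup C) :=
  {r | ∃ (X Y Z : C) (b : BinaryBicone X Y), Nonempty b.IsBilimit ∧ Nonempty (Z ≅ b.pt) ∧
    r = FreeAbelianGroup.of X + FreeAbelianGroup.of Y - FreeAbelianGroup.of Z}

/-- The additive Grothendieck group: generators `[X]` for the objects `X`, subject to the
relations `[X] + [Y] = [Z]` whenever `Z ≅ X ⊕ Y`. -/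
def K0 (C : Type u) [Category.{v} C] [Preadditive C] : Type u :=
  FreeAbelianGroup C ⧸ AddSubgroup.closure (K0Rel C)

namespace K0

noncomputable instance (C : Type u) [Category.{v} C] [Preadditive C] : AddCommGroup (K0 C) :=
  inferInstanceAs (AddCommGroup (FreeAbelianGroup C ⧸ AddSubgroup.closure (K0Rel C)))

variable {C : Type*} [Category C] [Preadditive C] {D : Type*} [Category D] [Preadditive D]

/-- The class `[X]` of an object. -/
def cls (X : C) : K0 C :=
  QuotientAddGroup.mk' (AddSubgroup.closure (K0Rel C)) (FreeAbelianGroup.of X)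

/-- The homomorphism `[X] ↦ [F X]` induced by an additive functor `F`. -/
noncomputable def map (F : C ⥤ D) [F.Additive] : K0 C →+ K0 D :=
  QuotientAddGroup.map (AddSubgroup.closure (K0Rel C)) (AddSubgroup.closure (K0Rel D))
    (FreeAbelianGroup.map F.obj) (by
      rw [AddSubgroup.closure_le]
      rintro _ ⟨X, Y, Z, b, ⟨hb⟩, ⟨e⟩, rfl⟩
      have := preservesBinaryBiproducts_of_preservesBiproducts F
      refine AddSubgroup.subset_closure
        ⟨F.obj X, F.obj Y, F.obj Z, F.mapBinaryBicone b,
          ⟨isBinaryBilimitOfPreserves F hb⟩, ⟨F.mapIso e⟩, ?_⟩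
      simp)

@[simp] theorem map_cls (F : C ⥤ D) [F.Additive] (X : C) : map F (cls X) = cls (F.obj X) := rfl

theorem hom_ext {A : Type*} [AddCommGroup A] {f f' : K0 C →+ A}
    (h : ∀ X, f (cls X) = f' (cls X)) : f = f' :=
  QuotientAddGroup.addMonoidHom_ext _ (FreeAbelianGroup.lift_ext _ _ h)

variable (G : Type*) [Group G] [StrictAction G C]

/-- The action of `G` on `K₀(C)` induced by a strict action on `C`: `g • [X] = [T g X]`. -/
noncomputable instance : DistribMulAction G (K0 C) where
  smul g x := map (StrictAction.T g) x
  one_smul x := DFunLike.congr_fun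
    (hom_ext (f := map (StrictAction.T (1 : G))) (f' := AddMonoidHom.id (K0 C))
      fun X => congrArg cls (StrictAction.one_obj G X)) x
  mul_smul g h x := DFunLike.congr_fun
    (hom_ext (f := map (StrictAction.T (g * h)))
      (f' := (map (StrictAction.T g)).comp (map (StrictAction.T h)))
      fun X => congrArg cls (StrictAction.mul_obj g h X).symm) x
  smul_zero g := map_zero (map (StrictAction.T g))
  smul_add g := map_add (map (StrictAction.T g))

theorem smul_cls (g : G) (X : C) : g • cls X = cls ((StrictAction.T g).obj X) := rfl

end K0

end GrothendieckGroup

/-! ### Rational functions and the algebras `P_n ⋊ K[S_n]` -/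

/-- A rational function `α(t) = p(t)/q(t)` with `p, q` coprime and `q(0) = 1`; it determines the
sequence `α₀, α₁, …` of coefficients of its power series expansion, and conversely. -/
structure RationalSeries (F : Type u) [Field F] where
  p : F[X]
  q : F[X]
  coprime : IsCoprime p q
  q_zero : q.coeff 0 = 1

namespace RationalSeries

variable {F : Type u} [Field F]

/-- The sequence of coefficients `α_i`, where `∑ α_i t^i = p(t)/q(t)`. -/
noncomputable def seq (α : RationalSeries F) : PowerSeries F :=
  (α.p : PowerSeries F) * (α.q : PowerSeries F)⁻¹

/-- `k = max (deg p + 1) (deg q)`, with the convention `deg 0 = -1`. -/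
noncomputable def k (α : RationalSeries F) : ℕ :=
  open Classical in max (if α.p = 0 then 0 else α.p.natDegree + 1) α.q.natDegree

/-- `u_α(t) = t^k q(1/t)`. -/
noncomputable def u (α : RationalSeries F) : F[X] := α.q.reflect α.k

/-- `α` regarded as a rational function over a field extension. -/
noncomputable def baseChange (α : RationalSeries F) (E : Type v) [Field E] [Algebra F E] :
    RationalSeries E where
  p := α.p.map (algebraMap F E)
  q := α.q.map (algebraMap F E)
  coprime := α.coprime.map (Polynomial.mapRingHom (algebraMap F E))
  q_zero := by simp [α.q_zero]

theorem baseChange_u (α : RationalSeries F) (E : Type v) [Field E] [Algebra F E] :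
    (α.baseChange E).u = α.u.map (algebraMap F E) := by
  have hk : (α.baseChange E).k = α.k := by
    have hp : α.p.map (algebraMap F E) = 0 ↔ α.p = 0 := Polynomial.map_eq_zero _
    simp only [k, baseChange, Polynomial.natDegree_map]
    congr 1
    split_ifs <;> simp_all
  simp only [u, hk]
  simp [baseChange, Polynomial.reflect_map]

/-- The ideal `(u(x_1), …, u(x_n))` of `F[x_1, …, x_n]`. -/
noncomputable def ideal (α : RationalSeries F) (n : ℕ) : Ideal (MvPolynomial (Fin n) F) :=
  Ideal.span (Set.range fun i : Fin n => aeval (MvPolynomial.X i : MvPolynomial (Fin n) F) α.u)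

/-- `P_n = F[x_1, …, x_n]/(u_α(x_1), …, u_α(x_n))`. -/
def P (α : RationalSeries F) (n : ℕ) : Type u := MvPolynomial (Fin n) F ⧸ α.ideal n

noncomputable instance (α : RationalSeries F) (n : ℕ) : CommRing (α.P n) :=
  inferInstanceAs (CommRing (MvPolynomial (Fin n) F ⧸ α.ideal n))

/-- The quotient map `F[x_1, …, x_n] → P_n`. -/
noncomputable def P.mk (α : RationalSeries F) (n : ℕ) : MvPolynomial (Fin n) F →+* α.P n :=
  Ideal.Quotient.mk (α.ideal n)

theorem P.mk_surjective (α : RationalSeries F) (n : ℕ) : Function.Surjective (P.mk α n) :=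
  Ideal.Quotient.mk_surjective

end RationalSeries

/-- An action by ring endomorphisms that preserve an ideal descends to the quotient ring. -/
def quotientAction {M A : Type*} [Monoid M] [CommRing A] (I : Ideal A) (f : M →* (A →+* A))
    (hf : ∀ m, I ≤ I.comap (f m)) : M →* (A ⧸ I →+* A ⧸ I) where
  toFun m := Ideal.quotientMap I (f m) (hf m)
  map_one' := by
    apply Ideal.Quotient.ringHom_ext
    ext x
    simp
  map_mul' m m' := by
    apply Ideal.Quotient.ringHom_ext
    ext x
    simp

namespace RationalSeries

section PermAction

variable {F : Type u} [Field F] (α : RationalSeries F) (n : ℕ)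

/-- Permutation of the variables, `σ ⬝ x_i = x_{σ i}`. -/
noncomputable def permHom :
    Equiv.Perm (Fin n) →* (MvPolynomial (Fin n) F →+* MvPolynomial (Fin n) F) where
  toFun σ := (MvPolynomial.rename σ).toRingHom
  map_one' := by ext <;> simp
  map_mul' σ τ := by ext <;> simp

theorem ideal_le_permHom (σ : Equiv.Perm (Fin n)) :
    α.ideal n ≤ (α.ideal n).comap (permHom n σ) := by
  rw [ideal, Ideal.span_le]
  rintro _ ⟨i, rfl⟩
  refine Ideal.subset_span ⟨σ i, ?_⟩
  change _ = MvPolynomial.rename σ (aeval _ _)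
  rw [← Polynomial.aeval_algHom_apply, MvPolynomial.rename_X]

/-- The action of `S_n` on `P_n`, as a homomorphism to the ring endomorphisms. -/
noncomputable def permAction : Equiv.Perm (Fin n) →* (α.P n →+* α.P n) :=
  quotientAction (α.ideal n) (permHom n) (α.ideal_le_permHom n)

/-- The action of `S_n` on `P_n` by algebra automorphisms, `σ • x_i = x_{σ i}`. -/
noncomputable instance : MulSemiringAction (Equiv.Perm (Fin n)) (α.P n) :=
  MulSemiringAction.compHom (α.P n) (α.permAction n)

theorem perm_smul_mk (σ : Equiv.Perm (Fin n)) (f : MvPolynomial (Fin n) F) :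
    σ • P.mk α n f = P.mk α n (MvPolynomial.rename σ f) := rfl

/-- The crossed product `P_n ⋊ F[S_n]`: formal sums of `a ⊗ σ` with `a ∈ P_n`, `σ ∈ S_n` and
`(a ⊗ σ) (b ⊗ τ) = a σ(b) ⊗ σ τ`; here `a ⊗ σ` is `SkewMonoidAlgebra.single σ a`. -/
abbrev Crossed : Type u := SkewMonoidAlgebra (α.P n) (Equiv.Perm (Fin n))

end PermAction

/-! ### The Galois action on the crossed products over `K` -/

section GaloisAction

variable {F : Type u} [Field F] (α : RationalSeries F) (K : Type v) [Field K] [Algebra F K]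
  (n : ℕ)

/-- The action of the automorphisms of `K` over `F` on the coefficients of polynomials. -/
noncomputable def coeffHom :
    (K ≃ₐ[F] K) →* (MvPolynomial (Fin n) K →+* MvPolynomial (Fin n) K) where
  toFun g := MvPolynomial.map (g : K →+* K)
  map_one' := by ext <;> simp
  map_mul' g h := by ext <;> simp

theorem ideal_le_coeffHom (g : K ≃ₐ[F] K) :
    (α.baseChange K).ideal n ≤ ((α.baseChange K).ideal n).comap (coeffHom K n g) := by
  rw [ideal, Ideal.span_le]
  rintro _ ⟨i, rfl⟩
  refine Ideal.subset_span ⟨i, ?_⟩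
  change _ = MvPolynomial.map (g : K →+* K) (aeval _ _)
  rw [baseChange_u]
  simp [Polynomial.aeval_def, Polynomial.eval₂_map, Polynomial.hom_eval₂]
  congr 1
  ext x
  simp

/-- The action of `K ≃ₐ[F] K` on `P_n` over `K`, as a homomorphism to the ring endomorphisms. -/
noncomputable def galAction :
    (K ≃ₐ[F] K) →* ((α.baseChange K).P n →+* (α.baseChange K).P n) :=
  quotientAction ((α.baseChange K).ideal n) (coeffHom K n) (α.ideal_le_coeffHom K n)

/-- The action of the automorphisms of `K` over `F` on `P_n` over `K`, through coefficients. -/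
noncomputable instance : MulSemiringAction (K ≃ₐ[F] K) ((α.baseChange K).P n) :=
  MulSemiringAction.compHom ((α.baseChange K).P n) (α.galAction K n)

theorem gal_smul_mk (g : K ≃ₐ[F] K) (f : MvPolynomial (Fin n) K) :
    g • P.mk (α.baseChange K) n f = P.mk (α.baseChange K) n (MvPolynomial.map (g : K →+* K) f) :=
  rfl

theorem gal_smul_perm_smul (g : K ≃ₐ[F] K) (σ : Equiv.Perm (Fin n))
    (a : (α.baseChange K).P n) : g • σ • a = σ • g • a := by
  obtain ⟨f, rfl⟩ := P.mk_surjective _ _ a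
  rw [perm_smul_mk, gal_smul_mk, gal_smul_mk, perm_smul_mk, MvPolynomial.map_rename]

/-- The ring endomorphism `a ⊗ σ ↦ g(a) ⊗ σ` of `P_n ⋊ K[S_n]`. -/
noncomputable def crossedMap (g : K ≃ₐ[F] K) :
    (α.baseChange K).Crossed n →+* (α.baseChange K).Crossed n :=
  SkewMonoidAlgebra.liftNCRingHom
    (SkewMonoidAlgebra.singleOneRingHom.comp
      (MulSemiringAction.toRingHom (K ≃ₐ[F] K) ((α.baseChange K).P n) g))
    (SkewMonoidAlgebra.of ((α.baseChange K).P n) (Equiv.Perm (Fin n)))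
    (by
      intro a σ
      simp [SkewMonoidAlgebra.singleOneRingHom, SkewMonoidAlgebra.of,
        SkewMonoidAlgebra.single_mul_single, gal_smul_perm_smul])

theorem crossedMap_single (g : K ≃ₐ[F] K) (σ : Equiv.Perm (Fin n)) (a : (α.baseChange K).P n) :
    α.crossedMap K n g (SkewMonoidAlgebra.single σ a) = SkewMonoidAlgebra.single σ (g • a) := by
  simp [crossedMap, SkewMonoidAlgebra.liftNCRingHom, SkewMonoidAlgebra.singleOneRingHom,
        SkewMonoidAlgebra.single_mul_single]

/-- The action of the automorphisms of `K` over `F` on `P_n ⋊ K[S_n]` by ring automorphisms. -/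
noncomputable def crossedHom :
    (K ≃ₐ[F] K) →* ((α.baseChange K).Crossed n →+* (α.baseChange K).Crossed n) where
  toFun := α.crossedMap K n
  map_one' := by
    ext1 x
    induction x using SkewMonoidAlgebra.induction_on' with
    | single σ a => simp [crossedMap_single]
    | add x y hx hy => rw [map_add, map_add, hx, hy]
  map_mul' g h := by
    ext1 x
    induction x using SkewMonoidAlgebra.induction_on' with
    | single σ a => simp [crossedMap_single, mul_smul]
    | add x y hx hy => rw [map_add, map_add, hx, hy]

end GaloisAction

end RationalSeries

/-! ### Direct sums of categories of finitely generated projective right modules -/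

section SumProj

instance {I : Type*} (C : I → Type u) [∀ i, Category.{v} (C i)] [∀ i, Preadditive (C i)] :
    Preadditive (∀ i, C i) where
  homGroup X Y := inferInstanceAs (AddCommGroup (∀ i, X i ⟶ Y i))
  add_comp _ _ _ _ _ _ := funext fun _ => Preadditive.add_comp _ _ _ _ _ _
  comp_add _ _ _ _ _ _ := funext fun _ => Preadditive.comp_add _ _ _ _ _ _

variable (R : ℕ → Type w) [∀ n, Ring (R n)]

/-- Families `(M_n)` of finitely generated projective right `R_n`-modules (i.e. modules over the
opposite ring), all but finitely many of which are zero. -/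
def isFinProj : ObjectProperty (∀ n, ModuleCat.{w} (R n)ᵐᵒᵖ) := fun M =>
  (∀ n, Module.Finite (R n)ᵐᵒᵖ (M n) ∧ Module.Projective (R n)ᵐᵒᵖ (M n)) ∧
    {n | ¬ IsZero (M n)}.Finite

/-- The direct sum category `⨁_n fproj-R_n`. -/
abbrev SumProj : Type (w + 1) := (isFinProj R).FullSubcategory

/-- The binary biproduct of two objects, formed degreewise. -/
noncomputable def SumProj.bicone (X Y : SumProj R) : BinaryBicone X Y where
  pt := ⟨fun n => X.obj n ⊞ Y.obj n, by
    refine ⟨fun n => ?_, (X.property.2.union Y.property.2).subset fun n hn => ?_⟩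
    · obtain ⟨_, _⟩ := X.property.1 n
      obtain ⟨_, _⟩ := Y.property.1 n
      let e := (ModuleCat.biprodIsoProd (X.obj n) (Y.obj n)).toLinearEquiv
      exact ⟨Module.Finite.equiv e.symm, Module.Projective.of_equiv e.symm⟩
    · by_contra h
      simp only [Set.mem_union, Set.mem_ofPred_eq, not_or, not_not] at h
      exact hn ((biprod_isZero_iff _ _).2 h)⟩
  fst := ObjectProperty.homMk fun _ => biprod.fst
  snd := ObjectProperty.homMk fun _ => biprod.snd
  inl := ObjectProperty.homMk fun _ => biprod.inl
  inr := ObjectProperty.homMk fun _ => biprod.inr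
  inl_fst := by ext1; funext n; exact biprod.inl_fst (X := X.obj n) (Y := Y.obj n)
  inl_snd := by ext1; funext n; exact biprod.inl_snd (X := X.obj n) (Y := Y.obj n)
  inr_fst := by ext1; funext n; exact biprod.inr_fst (X := X.obj n) (Y := Y.obj n)
  inr_snd := by ext1; funext n; exact biprod.inr_snd (X := X.obj n) (Y := Y.obj n)

noncomputable instance : HasBinaryBiproducts (SumProj R) where
  has_binary_biproduct X Y := HasBinaryBiproduct.mk
    ⟨SumProj.bicone R X Y, isBinaryBilimitOfTotal _ (by
      ext1; funext n; exact biprod.total (X := X.obj n) (Y := Y.obj n))⟩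

variable {R}

/-- Restriction of scalars along a family of ring automorphisms `f n` of the `R n`: the new right
action of `r` on `M_n` is the old action of `f n r`. -/
noncomputable def SumProj.restrict (f : ∀ n, R n →+* R n) (hf : ∀ n, Function.Bijective (f n)) :
    SumProj R ⥤ SumProj R where
  obj X := ⟨fun n => (ModuleCat.restrictScalars (f n).op).obj (X.obj n), by
    refine ⟨fun n => ?_, X.property.2.subset fun n hn h => hn ?_⟩
    · obtain ⟨_, _⟩ := X.property.1 n
      have hb : Function.Bijective (f n).op :=
        MulOpposite.op_bijective.comp ((hf n).comp MulOpposite.unop_bijective)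
      let e : (R n)ᵐᵒᵖ ≃+* (R n)ᵐᵒᵖ := RingEquiv.ofBijective (f n).op hb
      let := RingHomInvPair.of_ringEquiv e
      let := RingHomInvPair.symm (e : (R n)ᵐᵒᵖ →+* (R n)ᵐᵒᵖ) (e.symm : (R n)ᵐᵒᵖ →+* (R n)ᵐᵒᵖ)
      let l : ((ModuleCat.restrictScalars (f n).op).obj (X.obj n))
          ≃ₛₗ[(e : (R n)ᵐᵒᵖ →+* (R n)ᵐᵒᵖ)] X.obj n :=
        { toFun := fun x => x
          invFun := fun x => x
          map_add' := fun _ _ => rfl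
          map_smul' := fun _ _ => rfl
          left_inv := fun _ => rfl
          right_inv := fun _ => rfl }
      exact ⟨Module.Finite.of_surjective l.symm.toLinearMap l.symm.surjective,
        Module.Projective.of_equiv l.symm⟩
    · exact (ModuleCat.restrictScalars (f n).op).map_isZero h⟩
  map φ := ObjectProperty.homMk fun n => (ModuleCat.restrictScalars (f n).op).map (φ.hom n)

instance (f : ∀ n, R n →+* R n) (hf : ∀ n, Function.Bijective (f n)) :
    (SumProj.restrict f hf).Additive where
  map_add := rfl

theorem SumProj.restrict_id (hf) :
    SumProj.restrict (fun n => RingHom.id (R n)) hf = 𝟭 (SumProj R) := rfl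

theorem SumProj.restrict_comp (f f' : ∀ n, R n →+* R n) (hf hf' h) :
    SumProj.restrict (fun n => (f n).comp (f' n)) h =
      SumProj.restrict f hf ⋙ SumProj.restrict f' hf' := rfl

theorem SumProj.restrict_congr {f f' : ∀ n, R n →+* R n} (e : f = f') (hf hf') :
    SumProj.restrict f hf = SumProj.restrict f' hf' := by
  subst e; rfl

theorem bijective_of_action {G A : Type*} [Group G] [Semiring A] (ρ : G →* (A →+* A)) (g : G) :
    Function.Bijective (ρ g) :=
  Function.bijective_iff_has_inverse.2 ⟨ρ g⁻¹,
    fun x => by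
      have h : ρ g⁻¹ * ρ g = 1 := by rw [← map_mul, inv_mul_cancel, map_one]
      exact DFunLike.congr_fun h x,
    fun x => by
      have h : ρ g * ρ g⁻¹ = 1 := by rw [← map_mul, mul_inv_cancel, map_one]
      exact DFunLike.congr_fun h x⟩

/-- The strict action on `⨁_n fproj-R_n` induced by actions of `G` on the rings `R_n`: `T g M` is
`M` with the right action `m * r = m g⁻¹(r)`, and `T g` does not change the underlying maps of
morphisms. -/
@[reducible]
noncomputable def SumProj.strictAction {G : Type*} [Group G] (ρ : ∀ n, G →* (R n →+* R n)) :
    StrictAction G (SumProj R) where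
  T g := SumProj.restrict (fun n => ρ n g⁻¹) fun n => bijective_of_action (ρ n) g⁻¹
  additive _ := inferInstance
  T_one :=
    SumProj.restrict_congr (f' := fun n => RingHom.id (R n))
      (by funext n; rw [inv_one, map_one]; rfl) _ fun _ => Function.bijective_id
  T_mul g h :=
    SumProj.restrict_congr (f' := fun n => (ρ n h⁻¹).comp (ρ n g⁻¹))
      (by funext n; rw [mul_inv_rev, map_mul]; rfl) _
      fun n => (bijective_of_action (ρ n) h⁻¹).comp (bijective_of_action (ρ n) g⁻¹)

end SumProj

/-- The category `𝒮_α = ⨁_{n ≥ 0} fproj-(P_n ⋊ F[S_n])`. -/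
def SCat {F : Type u} [Field F] (α : RationalSeries F) : Type (u + 1) :=
  SumProj fun n => α.Crossed n

namespace SCat

variable {F : Type u} [Field F] (α : RationalSeries F)

noncomputable instance : Category.{u} (SCat α) :=
  inferInstanceAs (Category.{u} (SumProj fun n => α.Crossed n))

noncomputable instance : Preadditive (SCat α) :=
  inferInstanceAs (Preadditive (SumProj fun n => α.Crossed n))

instance : HasBinaryBiproducts (SCat α) :=
  inferInstanceAs (HasBinaryBiproducts (SumProj fun n => α.Crossed n))

/-- The strict action of the automorphism group of `K` over `F` on `𝒮_{α^K}`. -/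
noncomputable instance (K : Type v) [Field K] [Algebra F K] :
    StrictAction (K ≃ₐ[F] K) (SCat (α.baseChange K)) :=
  SumProj.strictAction fun n => α.crossedHom K n

end SCat

end KSInterpolation

open KSInterpolation

namespace KSInterpolation

/-! ### Drazin inverses -/

/-! Write `R_n = P_n ⋊ K[S_n]`, `𝒮 = ⨁ fproj-R_n`, and `F` for the prime field of `K`.

Krull–Schmidt. Each `R_n` is finite-dimensional over `K`, so endomorphisms in `𝒮` have Fitting
decompositions, recorded here as Drazin inverses. A Drazin inverse is unique, so functors preserve
it and the Drazin inverse of an equivariant endomorphism is again equivariant. Hence both `𝒮` and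
`𝒮^G` are Krull–Schmidt categories, and their `K₀` are free on the classes of objects with local
endomorphism ring (`localBasis`).

Injectivity. The scalars `K` are central in `R_n`. A basis of `K/k` and its trace-dual basis give an
isomorphism `Ind (Forg A) ≅ A^[K:k]`, where `Ind` is induction from the trivial group
(`toInd_fromInd`, `fromInd_toInd`). So `K₀(Ind) ∘ K₀(Forg)` is multiplication by `[K:k]` on a
torsion-free group, and `K₀(Forg)` is injective.

Image. `G` permutes the basis of `K₀(𝒮)`, so the invariants are spanned by orbit sums
(`mem_of_fixed_of_orbit_sum_mem`). An orbit sum is realized by inducing `V` from its stabilizer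
`G_V`, as soon as the isomorphisms `T_g V ≅ V` can be chosen to form an honest semilinear action of
`G_V`. A priori there is an obstruction; it vanishes because the indecomposables have models defined
over `F`.

Indeed let `I` be the `G`-set of roots in `K` of `u_α` with coefficients raised to a large power
`p^e`. Modulo nilpotents `P_n` is a product of copies of `K` indexed by `i : Fin n → I`, with
orthogonal idempotents `e_i`. The stabilizer of `i` in `S_n` is a Young subgroup `∏ S_{m_j}`, and
modulo nilpotents the corner of `R_n` at `e_i` is its group algebra. The field `F` splits every
`F[S_m]` (`isSplitIdem_rat_perm`, `isSplitIdem_zmod`), so `e_i · ⊗ f_j` with `f_j ∈ F[S_{m_j}]`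
primitive is a primitive idempotent of `R_n`, and every indecomposable is `y R_n` for such a `y`. An
element `g` only permutes the blocks. With one `f` fixed for each two-sided ideal generated by a
primitive idempotent, `T_g V ≅ V` forces `m` and `f` to be `g`-invariant, and the permutation `t_g`
of blocks satisfies `t_g g(y) = y t_g` and `t_{gh} = t_g t_h` on the nose. So `x ↦ t_g g(x)` is the
required action on `y R_n`.

Splitting of `F[S_m]` rests on `σ` being conjugate to `σ^s` for `s` prime to its order, which puts
all traces in `F`. It remains to see that endomorphism rings of simple modules are commutative: in
characteristic `p` by Wedderburn's theorem, over `ℚ` by induction along `S_m ⊂ S_{m+1}`, using that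
the centralizer of `ℚ[S_m]` in `ℚ[S_{m+1}]` is commutative. -/

/-- `d` is the Drazin inverse of `a`. -/
structure IsDrazin {M : Type*} [Monoid M] (a d : M) : Prop where
  comm : a * d = d * a
  idem : d * a * d = d
  exists_pow : ∃ N : ℕ, a ^ (N + 1) * d = a ^ N

namespace IsDrazin

variable {M : Type*} [Monoid M] {a d d' : M}

theorem isIdempotentElem (h : IsDrazin a d) : IsIdempotentElem (a * d) := by
  rw [IsIdempotentElem, mul_assoc, ← mul_assoc d, h.idem]

theorem pow_mul_pow (h : IsDrazin a d) (k : ℕ) : d ^ (k + 1) * a ^ k = d := by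
  induction k with
  | zero => simp
  | succ k ih =>
    calc d ^ (k + 1 + 1) * a ^ (k + 1) = d * (d ^ (k + 1) * a ^ k) * a := by
          rw [pow_succ' d (k + 1), pow_succ a k]; simp only [mul_assoc]
      _ = d * (d * a) := by rw [ih, mul_assoc]
      _ = d := by rw [← h.comm, ← mul_assoc, h.idem]

theorem pow_mul_pow' (h : IsDrazin a d) (k : ℕ) : a ^ k * d ^ (k + 1) = d := by
  have hc : Commute a d := h.comm
  rw [(hc.pow_pow k (k + 1)).eq, h.pow_mul_pow]

theorem mul_left_eq (h : IsDrazin a d) (h' : IsDrazin a d') : a * d * (a * d') = a * d := by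
  obtain ⟨N, hN⟩ := h'.exists_pow
  have key : a ^ N * (a * d') = a ^ N := by rw [← mul_assoc, ← pow_succ, hN]
  conv_lhs => rw [← h.pow_mul_pow N]
  conv_rhs => rw [← h.pow_mul_pow N, ← key]
  simp only [mul_assoc]

theorem mul_right_eq (h : IsDrazin a d) (h' : IsDrazin a d') : a * d * (a * d') = a * d' := by
  obtain ⟨N, hN⟩ := h.exists_pow
  have hc : Commute a d := h.comm
  have key : a * d * a ^ N = a ^ N := by
    rw [mul_assoc, ← (hc.pow_left N).eq, ← mul_assoc, ← pow_succ', hN]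
  calc a * d * (a * d') = a * d * (d' * a) := by rw [h'.comm]
    _ = (a * d * a ^ N) * d' ^ (N + 1) * a := by
      rw [mul_assoc (a * d), h'.pow_mul_pow' N, ← mul_assoc]
    _ = a * d' := by rw [key, h'.pow_mul_pow' N, h'.comm]

/-- Both `a * d` and `a * d'` are the projection onto the part where `a` is invertible, so they
agree, and that projection determines the inverse. This uniqueness is what lets Drazin inverses pass
to equivariant objects. -/
theorem unique (h : IsDrazin a d) (h' : IsDrazin a d') : d = d' := by
  have e : a * d = a * d' := (h.mul_left_eq h').symm.trans (h.mul_right_eq h')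
  calc d = d * (a * d) := by rw [← mul_assoc, h.idem]
    _ = d' * (a * d) := by
      rw [← mul_assoc, ← h.comm]
      conv_lhs => rw [e, h'.comm, mul_assoc]
    _ = d' := by rw [e, ← mul_assoc, h'.idem]

theorem map {M' F : Type*} [Monoid M'] [FunLike F M M'] [MonoidHomClass F M M'] (f : F)
    (h : IsDrazin a d) : IsDrazin (f a) (f d) where
  comm := by rw [← map_mul, h.comm, map_mul]
  idem := by rw [← map_mul, ← map_mul, h.idem]
  exists_pow := by
    obtain ⟨N, hN⟩ := h.exists_pow
    exact ⟨N, by rw [← map_pow, ← map_mul, hN, map_pow]⟩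

end IsDrazin

/-- A ring in which every element has a Drazin inverse and in which all idempotents are trivial
is local. -/
theorem isLocalRing_of_isDrazin {R : Type*} [Ring R] [Nontrivial R]
    (hR : ∀ a : R, ∃ d, IsDrazin a d) (h : ∀ e : R, IsIdempotentElem e → e = 0 ∨ e = 1) :
    IsLocalRing R := by
  refine ⟨fun {a b} hab => ?_⟩
  obtain ⟨d, hd⟩ := hR a
  rcases h _ hd.isIdempotentElem with h0 | h1
  · right
    -- The spectral idempotent `a * d` is `0` exactly when `a` is nilpotent, and then `b = 1 - a` is
    -- a unit; if it is `1`, then `d` inverts `a`.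
    obtain ⟨N, hN⟩ := hd.exists_pow
    have : IsNilpotent a := ⟨N, by rw [← hN, pow_succ, mul_assoc, h0, mul_zero]⟩
    rw [eq_sub_of_add_eq' hab]
    exact this.isUnit_one_sub
  · left
    exact ⟨⟨a, d, h1, hd.comm ▸ h1⟩, rfl⟩

/-! ### Sum decompositions in preadditive categories -/

section Sum

variable {C : Type u} [Category.{v} C] [Preadditive C]

theorem K0.cls_add {X Y : C} (b : BinaryBicone X Y)
    (h : b.fst ≫ b.inl + b.snd ≫ b.inr = 𝟙 b.pt) : cls X + cls Y = cls b.pt := by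
  rw [← sub_eq_zero]
  exact (QuotientAddGroup.eq_zero_iff _).2 (AddSubgroup.subset_closure
    ⟨X, Y, b.pt, b, ⟨isBinaryBilimitOfTotal b h⟩, ⟨Iso.refl _⟩, rfl⟩)

theorem IsZero.comp_left_zero {X Y Z : C} (h : IsZero Y) (f : X ⟶ Y) (g : Y ⟶ Z) : f ≫ g = 0 := by
  rw [h.eq_of_tgt f 0, Limits.zero_comp]

/-- Two complementary retracts exhibit an object as a sum. -/
def BinaryBicone.ofRetracts {X Y Z : C} (i : X ⟶ Z) (p : Z ⟶ X) (j : Y ⟶ Z) (q : Z ⟶ Y)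
    (hip : i ≫ p = 𝟙 X) (hjq : j ≫ q = 𝟙 Y) (h : p ≫ i + q ≫ j = 𝟙 Z) : BinaryBicone X Y where
  pt := Z
  fst := p
  snd := q
  inl := i
  inr := j
  inl_fst := hip
  inr_snd := hjq
  inl_snd := by
    have h1 : i ≫ (p ≫ i + q ≫ j) = i := by rw [h, Category.comp_id]
    rw [Preadditive.comp_add, ← Category.assoc, hip, Category.id_comp, add_eq_left] at h1
    have h2 : (i ≫ q ≫ j) ≫ q = 0 := by rw [h1, Limits.zero_comp]
    simpa [hjq] using h2
  inr_fst := by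
    have h1 : j ≫ (p ≫ i + q ≫ j) = j := by rw [h, Category.comp_id]
    rw [Preadditive.comp_add, ← Category.assoc j q, hjq, Category.id_comp, add_eq_right] at h1
    have h2 : (j ≫ p ≫ i) ≫ p = 0 := by rw [h1, Limits.zero_comp]
    simpa [hip] using h2

theorem K0.cls_add_of_retracts {X Y Z : C} (i : X ⟶ Z) (p : Z ⟶ X) (j : Y ⟶ Z) (q : Z ⟶ Y)
    (hip : i ≫ p = 𝟙 X) (hjq : j ≫ q = 𝟙 Y) (h : p ≫ i + q ≫ j = 𝟙 Z) :
    cls X + cls Y = cls Z :=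
  K0.cls_add (BinaryBicone.ofRetracts i p j q hip hjq h) h

theorem K0.cls_eq_zero {X : C} (h : IsZero X) : cls X = 0 := by
  have := K0.cls_add_of_retracts (0 : X ⟶ X) 0 (0 : X ⟶ X) 0 (h.eq_of_src _ _) (h.eq_of_src _ _)
    (h.eq_of_src _ _)
  simpa using this


variable (C) in
theorem exists_isZero_of_isIdempotentComplete [IsIdempotentComplete C] (X : C) :
    ∃ W : C, IsZero W := by
  obtain ⟨W, i, e, h, h'⟩ := IsIdempotentComplete.idempotents_split X (0 : X ⟶ X) (by simp)
  refine ⟨W, (IsZero.iff_id_eq_zero W).2 ?_⟩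
  have : (i ≫ e) ≫ i ≫ e = 0 := by
    rw [Category.assoc, ← Category.assoc e, h', Limits.zero_comp, Limits.comp_zero]
  simpa [h] using this

/-- The defining relations see isomorphisms only through sums, so `Y` is written as `X ⊕ 0`; the
zero object is obtained by splitting the idempotent `0`. -/
theorem K0.cls_eq_of_iso [IsIdempotentComplete C] {X Y : C} (e : X ≅ Y) : cls X = cls Y := by
  obtain ⟨W, hW⟩ := exists_isZero_of_isIdempotentComplete C X
  have := K0.cls_add_of_retracts e.hom e.inv (0 : W ⟶ Y) 0 (by simp) (hW.eq_of_src _ _) (by simp)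
  rwa [K0.cls_eq_zero hW, add_zero] at this

/-- If the summands of `Z` are indexed by `J`, then `[Z]` is the sum of their classes. -/
theorem K0.cls_eq_sum [IsIdempotentComplete C] {J : Type*} (F : J → C) (s : Finset J) (Z : C)
    (ι : ∀ j, F j ⟶ Z) (π : ∀ j, Z ⟶ F j) (h1 : ∀ j ∈ s, ι j ≫ π j = 𝟙 (F j))
    (h0 : ∀ i ∈ s, ∀ j ∈ s, i ≠ j → ι i ≫ π j = 0) (ht : ∑ j ∈ s, π j ≫ ι j = 𝟙 Z) :
    cls Z = ∑ j ∈ s, cls (F j) := by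
  classical
  induction s using Finset.induction_on generalizing Z with
  | empty =>
    rw [Finset.sum_empty] at ht ⊢
    exact cls_eq_zero ((IsZero.iff_id_eq_zero Z).2 ht.symm)
  | insert a s ha ih =>
    have haa := h1 a (Finset.mem_insert_self a s)
    -- Splitting the complementary idempotent produces the sum of the remaining summands as an
    -- object, so no finite biproducts have to be assumed.
    have hid : (𝟙 Z - π a ≫ ι a) ≫ (𝟙 Z - π a ≫ ι a) = 𝟙 Z - π a ≫ ι a := by
      have : (π a ≫ ι a) ≫ π a ≫ ι a = π a ≫ ι a := by
        rw [Category.assoc, ← Category.assoc (ι a), haa, Category.id_comp]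
      simp [Preadditive.sub_comp, Preadditive.comp_sub, reassoc_of% haa]
    obtain ⟨Y, i, p, hip, hpi⟩ := IsIdempotentComplete.idempotents_split Z _ hid
    rw [Finset.sum_insert ha] at ht ⊢
    have hta : π a ≫ ι a + p ≫ i = 𝟙 Z := by rw [hpi]; abel
    rw [← K0.cls_add_of_retracts (ι a) (π a) i p haa hip hta]
    congr 1
    have hne : ∀ j ∈ s, a ≠ j := fun j hj h => ha (h ▸ hj)
    have hpi' : p ≫ i = ∑ j ∈ s, π j ≫ ι j := by rw [hpi, ← ht]; abel
    have hm : ∀ j ∈ s, j ∈ insert a s := fun j hj => Finset.mem_insert_of_mem hj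
    have hpj : ∀ j ∈ s, p ≫ i ≫ π j = π j := fun j hj => by
      rw [← Category.assoc, hpi, Preadditive.sub_comp, Category.assoc,
        h0 a (Finset.mem_insert_self a s) j (hm j hj) (hne j hj)]
      simp
    refine ih Y (fun j => ι j ≫ p) (fun j => i ≫ π j) (fun j hj => ?_) (fun j hj k hk hjk => ?_) ?_
    · rw [Category.assoc, hpj j hj, h1 j (hm j hj)]
    · rw [Category.assoc, hpj k hk, h0 j (hm j hj) k (hm k hk) hjk]
    · have : ∑ j ∈ s, (i ≫ π j) ≫ ι j ≫ p = i ≫ (∑ j ∈ s, π j ≫ ι j) ≫ p := by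
        simp [Preadditive.sum_comp, Preadditive.comp_sum]
      rw [this, ← hpi', Category.assoc, hip, Category.comp_id, hip]

end Sum

/-! ### Objects with local endomorphism rings -/

section Local

variable {C : Type u} [Category.{v} C] [Preadditive C]

theorem eq_zero_or_one_of_isLocalRing {R : Type*} [Ring R] [IsLocalRing R] {e : R}
    (he : IsIdempotentElem e) : e = 0 ∨ e = 1 := by
  rcases IsLocalRing.isUnit_or_isUnit_of_add_one (add_sub_cancel e 1) with h | h
  · right
    exact h.mul_left_cancel (by rw [he, mul_one])
  · left
    exact h.mul_left_cancel (by rw [sub_mul, he]; simp)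

/-- The composition makes `V` a retract of `W`. The corresponding idempotent of the local ring `End
W` is nonzero because `V` is, hence it is `1`. This replaces the exchange argument of the
Krull–Schmidt theorem. -/
theorem isIso_of_isIso_comp {V W : C} [IsLocalRing (End W)] (hV : ¬ IsZero V) (g : V ⟶ W)
    (f : W ⟶ V) (h : IsIso (g ≫ f)) : IsIso g ∧ IsIso f := by
  have h1 : inv (g ≫ f) ≫ g ≫ f = 𝟙 V := by simp
  have h2 : g ≫ f ≫ inv (g ≫ f) = 𝟙 V := by rw [← Category.assoc]; simp
  generalize inv (g ≫ f) = u at h1 h2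
  have he : IsIdempotentElem (M := End W) (f ≫ u ≫ g) := by
    change (f ≫ u ≫ g) ≫ f ≫ u ≫ g = f ≫ u ≫ g
    simp only [Category.assoc]
    rw [reassoc_of% h1]
  have hf : f ≫ u ≫ g = 𝟙 W := by
    rcases eq_zero_or_one_of_isLocalRing he with h0 | h0
    · exfalso
      apply hV
      rw [IsZero.iff_id_eq_zero]
      have h3 : (g ≫ (f ≫ u ≫ g)) ≫ f ≫ u = 𝟙 V := by
        simp only [Category.assoc]
        rw [reassoc_of% h2, h2]
      rw [← h3, show f ≫ u ≫ g = 0 from h0, Limits.comp_zero, Limits.zero_comp]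
    · exact h0
  have : IsIso f := ⟨u ≫ g, hf, by rw [Category.assoc, h1]⟩
  exact ⟨⟨f ≫ u, h2, by rw [Category.assoc]; exact hf⟩, this⟩

theorem not_isZero_of_isLocalRing (V : C) [IsLocalRing (End V)] : ¬ IsZero V := fun h =>
  one_ne_zero (α := End V) (h.eq_of_src _ _)

/-- Precomposition, as a linear map over the endomorphisms of the target. -/
def precompHom (V : C) {X Y : C} (i : X ⟶ Y) : (Y ⟶ V) →ₗ[End V] (X ⟶ V) where
  toFun f := i ≫ f
  map_add' _ _ := Preadditive.comp_add _ _ _ _ _ _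
  map_smul' r f := (Category.assoc i f r).symm

/-- The maps `X ⟶ V` that are not split epimorphisms, for `V` with local endomorphism ring. -/
def radHom (V X : C) [IsLocalRing (End V)] : Submodule (End V) (X ⟶ V) where
  carrier := {f | ∀ g : V ⟶ X, ¬ IsIso (g ≫ f)}
  zero_mem' g h := by
    rw [Limits.comp_zero] at h
    rw [← isUnit_iff_isIso] at h
    exact not_isUnit_zero h
  add_mem' {f f'} hf hf' g h := by
    rw [Preadditive.comp_add, ← isUnit_iff_isIso] at h
    rcases IsLocalRing.isUnit_or_isUnit_of_isUnit_add (R := End V) h with h | h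
    · exact hf g ((isUnit_iff_isIso _).1 h)
    · exact hf' g ((isUnit_iff_isIso _).1 h)
  smul_mem' r f hf g h :=
    hf g (isIso_of_isIso_comp (not_isZero_of_isLocalRing V) (g ≫ f) r
      (by rw [Category.assoc]; exact h)).1

theorem mem_radHom {V X : C} [IsLocalRing (End V)] {f : X ⟶ V} :
    f ∈ radHom V X ↔ ∀ g : V ⟶ X, ¬ IsIso (g ≫ f) := Iff.rfl

/-- The multiplicity of `V` in `X`, as an extended natural number. -/
noncomputable def emult (V X : C) [IsLocalRing (End V)] : ℕ∞ :=
  Module.length (End V) ((X ⟶ V) ⧸ radHom V X)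

variable (V : C) [IsLocalRing (End V)]

/-- The radical of a sum is the sum of the radicals: if `g ≫ f` is invertible and splits into the
contributions of `X` and `Y`, locality of `End V` makes one of the two contributions invertible. -/
theorem emult_add {X Y : C} (b : BinaryBicone X Y)
    (h : b.fst ≫ b.inl + b.snd ≫ b.inr = 𝟙 b.pt) : emult V b.pt = emult V X + emult V Y := by
  let φ : (b.pt ⟶ V) →ₗ[End V] ((X ⟶ V) ⧸ radHom V X) × ((Y ⟶ V) ⧸ radHom V Y) :=
    LinearMap.prod
      ((radHom V X).mkQ.comp (precompHom V b.inl)) ((radHom V Y).mkQ.comp (precompHom V b.inr))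
  have hφ : Function.Surjective φ := by
    rintro ⟨x, y⟩
    obtain ⟨f, rfl⟩ := Submodule.mkQ_surjective _ x
    obtain ⟨g, rfl⟩ := Submodule.mkQ_surjective _ y
    refine ⟨b.fst ≫ f + b.snd ≫ g, Prod.ext ?_ ?_⟩
    · change (radHom V X).mkQ (b.inl ≫ (b.fst ≫ f + b.snd ≫ g)) = _
      simp
    · change (radHom V Y).mkQ (b.inr ≫ (b.fst ≫ f + b.snd ≫ g)) = _
      simp
  have hker : LinearMap.ker φ = radHom V b.pt := by
    ext f
    have : f ∈ LinearMap.ker φ ↔ b.inl ≫ f ∈ radHom V X ∧ b.inr ≫ f ∈ radHom V Y := by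
      rw [LinearMap.mem_ker, Prod.ext_iff]
      exact and_congr (Submodule.Quotient.mk_eq_zero _) (Submodule.Quotient.mk_eq_zero _)
    rw [this]
    constructor
    · rintro ⟨h1, h2⟩ g hg
      have e : g ≫ f = (g ≫ b.fst) ≫ b.inl ≫ f + (g ≫ b.snd) ≫ b.inr ≫ f := by
        calc g ≫ f = g ≫ (b.fst ≫ b.inl + b.snd ≫ b.inr) ≫ f := by rw [h, Category.id_comp]
          _ = _ := by simp
      rw [e, ← isUnit_iff_isIso] at hg
      rcases IsLocalRing.isUnit_or_isUnit_of_isUnit_add (R := End V) hg with hg | hg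
      · exact h1 _ ((isUnit_iff_isIso _).1 hg)
      · exact h2 _ ((isUnit_iff_isIso _).1 hg)
    · intro hf
      exact ⟨fun g hg => hf (g ≫ b.inl) (by rwa [Category.assoc]),
        fun g hg => hf (g ≫ b.inr) (by rwa [Category.assoc])⟩
  rw [emult, emult, emult, ← Module.length_prod, ← hker]
  exact (φ.quotKerEquivOfSurjective hφ).length_eq

theorem emult_eq_of_iso {X Y : C} (e : X ≅ Y) : emult V X = emult V Y := by
  let φ : (X ⟶ V) ≃ₗ[End V] (Y ⟶ V) :=
    { precompHom V e.inv with
      invFun := fun f => e.hom ≫ f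
      left_inv := fun f => by simp [precompHom]
      right_inv := fun f => by simp [precompHom] }
  refine (Submodule.Quotient.equiv _ _ φ ?_).length_eq
  ext f
  rw [Submodule.mem_map]
  constructor
  · rintro ⟨f', hf', rfl⟩ g hg
    exact hf' (g ≫ e.inv) (by rwa [Category.assoc])
  · intro hf
    exact ⟨e.hom ≫ f, fun g hg => hf (g ≫ e.hom) (by rwa [Category.assoc]), by simp [φ, precompHom]⟩

/-- Every map `V ⟶ V` outside the radical is an isomorphism, so it generates all of `V ⟶ V` and the
quotient is simple. -/
theorem emult_self : emult V V = 1 := by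
  have hs : IsSimpleModule (End V) ((V ⟶ V) ⧸ radHom V V) := by
    rw [isSimpleModule_iff_isCoatom]
    refine ⟨fun h => ?_, fun N hN => ?_⟩
    · have : (𝟙 V : V ⟶ V) ∈ radHom V V := h ▸ Submodule.mem_top
      exact this (𝟙 V) (by rw [Category.comp_id]; infer_instance)
    · obtain ⟨f, hf, hf'⟩ := SetLike.exists_of_lt hN
      rw [mem_radHom] at hf'
      push Not at hf'
      obtain ⟨g, hg⟩ := hf'
      have := (isIso_of_isIso_comp (not_isZero_of_isLocalRing V) g f hg).2
      rw [eq_top_iff]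
      intro x _
      have hx : x = (show End V from inv f ≫ x) • f := by
        change x = f ≫ inv f ≫ x
        simp
      rw [hx]
      exact N.smul_mem _ hf
  exact Module.length_eq_one_iff.2 hs

theorem emult_eq_zero {W : C} [IsLocalRing (End W)] (h : ¬ Nonempty (W ≅ V)) :
    emult V W = 0 := by
  have : radHom V W = ⊤ := by
    rw [eq_top_iff]
    intro f _ g hg
    have := (isIso_of_isIso_comp (not_isZero_of_isLocalRing V) g f hg).2
    exact h ⟨asIso f⟩
  rw [emult, this]
  exact Module.length_eq_zero

end Local

/-! ### Krull–Schmidt categories -/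

section KrullSchmidt

/-- A preadditive category with split idempotents, Drazin inverses of endomorphisms and an additive
size function; in such a category the Krull–Schmidt theorem holds. -/
class IsKrullSchmidt (C : Type u) [Category.{v} C] [Preadditive C] : Prop
    extends IsIdempotentComplete C where
  exists_isDrazin : ∀ (X : C) (f : End X), ∃ d, IsDrazin f d
  exists_size : ∃ d : C → ℕ, (∀ (X Y : C) (b : BinaryBicone X Y),
    b.fst ≫ b.inl + b.snd ≫ b.inr = 𝟙 b.pt → d b.pt = d X + d Y) ∧ ∀ X, d X = 0 → IsZero X

variable {C : Type u} [Category.{v} C] [Preadditive C]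

theorem exists_summands [IsIdempotentComplete C] {X : C} (e : End X) (he : IsIdempotentElem e) :
    ∃ (Y Z : C) (b : BinaryBicone Y Z), b.pt = X ∧
      b.fst ≫ b.inl + b.snd ≫ b.inr = 𝟙 b.pt ∧ (IsZero Y → e = 0) ∧ (IsZero Z → e = 1) := by
  obtain ⟨Y, i, p, hip, hpi⟩ := IsIdempotentComplete.idempotents_split X e he
  obtain ⟨Z, j, q, hjq, hqj⟩ := IsIdempotentComplete.idempotents_split X (1 - e) he.one_sub
  have h : p ≫ i + q ≫ j = 𝟙 X := by rw [hpi, hqj]; exact add_sub_cancel e 1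
  refine ⟨Y, Z, BinaryBicone.ofRetracts i p j q hip hjq h, rfl, h, fun hY => ?_, fun hZ => ?_⟩
  · rw [← hpi]
    exact IsZero.comp_left_zero hY _ _
  · refine (sub_eq_zero.1 ?_).symm
    rw [← hqj]
    exact IsZero.comp_left_zero hZ _ _

variable [IsKrullSchmidt C]

/-- Without nontrivial idempotents, the Fitting decomposition of an endomorphism is trivial: it is
either nilpotent or invertible. -/
theorem isLocalRing_end {X : C} (hX : ¬ IsZero X)
    (h : ∀ e : End X, IsIdempotentElem e → e = 0 ∨ e = 1) : IsLocalRing (End X) := by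
  have : Nontrivial (End X) := ⟨0, 1, fun h0 => hX ((IsZero.iff_id_eq_zero X).2 h0.symm)⟩
  exact isLocalRing_of_isDrazin (IsKrullSchmidt.exists_isDrazin X) h

/-- Induction over decompositions into objects with local endomorphism rings. -/
theorem IsKrullSchmidt.induction {P : C → Prop} (h0 : ∀ X, IsZero X → P X)
    (h1 : ∀ X, IsLocalRing (End X) → P X)
    (hadd : ∀ (X Y : C) (b : BinaryBicone X Y), b.fst ≫ b.inl + b.snd ≫ b.inr = 𝟙 b.pt →
      P X → P Y → P b.pt) (X : C) : P X := by
  obtain ⟨d, hd, hd0⟩ := IsKrullSchmidt.exists_size (C := C)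
  induction hn : d X using Nat.strong_induction_on generalizing X with
  | _ n ih =>
    by_cases hX : IsZero X
    · exact h0 X hX
    by_cases hl : IsLocalRing (End X)
    · exact h1 X hl
    have : ¬ ∀ e : End X, IsIdempotentElem e → e = 0 ∨ e = 1 := fun h => hl (isLocalRing_end hX h)
    push Not at this
    obtain ⟨e, he, he0, he1⟩ := this
    obtain ⟨Y, Z, b, rfl, hb, hY, hZ⟩ := exists_summands e he
    have hs := hd Y Z b hb
    have hY0 : d Y ≠ 0 := fun h => he0 (hY (hd0 Y h))
    have hZ0 : d Z ≠ 0 := fun h => he1 (hZ (hd0 Z h))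
    exact hadd Y Z b hb (ih _ (by omega) Y rfl) (ih _ (by omega) Z rfl)

theorem emult_ne_top (V X : C) [IsLocalRing (End V)] : emult V X ≠ ⊤ := by
  induction X using IsKrullSchmidt.induction with
  | h0 X hX =>
    have : Subsingleton (X ⟶ V) := ⟨fun _ _ => hX.eq_of_src _ _⟩
    rw [emult, Module.length_eq_zero]
    exact ENat.zero_ne_top
  | h1 X hX =>
    by_cases h : Nonempty (X ≅ V)
    · rw [emult_eq_of_iso V h.some, emult_self]
      exact ENat.one_ne_top
    · rw [emult_eq_zero V h]
      exact ENat.zero_ne_top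
  | hadd X Y b hb hX hY =>
    rw [emult_add V b hb]
    exact WithTop.add_ne_top.2 ⟨hX, hY⟩

/-- The multiplicity of `V`, as a homomorphism from the Grothendieck group. -/
noncomputable def mult (V : C) [IsLocalRing (End V)] : K0 C →+ ℤ :=
  QuotientAddGroup.lift _ (FreeAbelianGroup.lift fun X => ((emult V X).toNat : ℤ)) (by
    rw [AddSubgroup.closure_le]
    rintro _ ⟨X, Y, Z, b, ⟨hb⟩, ⟨e⟩, rfl⟩
    have h := emult_add V b (IsBilimit.binary_total hb)
    rw [← emult_eq_of_iso V e] at h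
    simp [h, ENat.toNat_add (emult_ne_top V X) (emult_ne_top V Y)])

theorem mult_cls (V X : C) [IsLocalRing (End V)] :
    mult V (K0.cls X) = ((emult V X).toNat : ℤ) :=
  FreeAbelianGroup.lift_apply_of _ _

theorem mult_cls_self (V : C) [IsLocalRing (End V)] : mult V (K0.cls V) = 1 := by
  rw [mult_cls, emult_self]; rfl

theorem mult_cls_of_ne (V W : C) [IsLocalRing (End V)] [IsLocalRing (End W)]
    (h : K0.cls V ≠ K0.cls W) : mult V (K0.cls W) = 0 := by
  rw [mult_cls, emult_eq_zero]
  · rfl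
  · rintro ⟨e⟩
    exact h (K0.cls_eq_of_iso e.symm)

theorem nonempty_iso_of_cls_eq {V W : C} [IsLocalRing (End V)] [IsLocalRing (End W)]
    (h : K0.cls V = K0.cls W) : Nonempty (V ≅ W) := by
  by_contra hn
  have h1 := mult_cls_self V
  rw [h, mult_cls, emult_eq_zero V fun ⟨e⟩ => hn ⟨e.symm⟩] at h1
  exact zero_ne_one h1

variable (C) in
/-- The classes of the objects with local endomorphism ring. -/
def localClasses : Set (K0 C) := {x | ∃ V : C, IsLocalRing (End V) ∧ x = K0.cls V}

omit [IsKrullSchmidt C] in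
theorem K0.induction_on {P : K0 C → Prop} (x : K0 C) (h0 : P 0)
    (hc : ∀ X : C, P (cls X)) (hn : ∀ x, P x → P (-x)) (ha : ∀ x y, P x → P y → P (x + y)) :
    P x := by
  obtain ⟨y, rfl⟩ := QuotientAddGroup.mk'_surjective _ x
  induction y using FreeAbelianGroup.induction_on with
  | zero => exact h0
  | of X => exact hc X
  | neg X h => exact hn _ h
  | add x y hx hy => exact ha _ _ hx hy

theorem span_localClasses : Submodule.span ℤ (localClasses C) = ⊤ := by
  rw [eq_top_iff]
  intro x _
  induction x using K0.induction_on with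
  | h0 => exact Submodule.zero_mem _
  | hn x hx => exact Submodule.neg_mem _ (hx trivial)
  | ha x y hx hy => exact Submodule.add_mem _ (hx trivial) (hy trivial)
  | hc X =>
    induction X using IsKrullSchmidt.induction with
    | h0 X hX => rw [K0.cls_eq_zero hX]; exact Submodule.zero_mem _
    | h1 X hX => exact Submodule.subset_span ⟨X, hX, rfl⟩
    | hadd X Y b hb hX hY =>
      rw [← K0.cls_add b hb]
      exact Submodule.add_mem _ (hX trivial) (hY trivial)

/-- The multiplicity homomorphisms are dual to these classes: `mult V` takes the value `1` at `[V]`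
and `0` at every other class of this kind. -/
theorem linearIndependent_localClasses :
    LinearIndependent ℤ (fun c : localClasses C => (c : K0 C)) := by
  rw [linearIndependent_iff']
  intro s n hn c hc
  obtain ⟨V, hV, hcV⟩ := c.2
  have := congrArg (mult V) hn
  rw [map_sum, map_zero, Finset.sum_eq_single c] at this
  · rwa [map_zsmul, hcV, mult_cls_self, smul_eq_mul, mul_one] at this
  · intro d _ hd
    obtain ⟨W, hW, hdW⟩ := d.2
    rw [map_zsmul, hdW, mult_cls_of_ne, smul_zero]
    rw [← hcV, ← hdW]
    exact fun h => hd (Subtype.ext h.symm)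
  · exact fun h => absurd hc h

variable (C) in
/-- The classes of objects with local endomorphism ring form a basis of `K₀`. -/
noncomputable def localBasis : Module.Basis (localClasses C) ℤ (K0 C) :=
  Module.Basis.mk linearIndependent_localClasses (by
    rw [Subtype.range_coe, span_localClasses])

theorem localBasis_apply (c : localClasses C) : localBasis C c = c := by
  simp [localBasis]

/-- Applied to the equivariant category, this allows division by the degree `[K:k]` in the proof of
injectivity. -/
theorem K0.eq_zero_of_nsmul_eq_zero {n : ℕ} (hn : n ≠ 0) {x : K0 C} (h : n • x = 0) : x = 0 := by
  have : Module.Free ℤ (K0 C) := Module.Free.of_basis (localBasis C)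
  rw [← natCast_zsmul] at h
  exact (smul_eq_zero.1 h).resolve_left (by exact_mod_cast hn)

end KrullSchmidt

/-! ### Invariants of a permutation module -/

section Invariants

/-- `G` permutes the basis `S`, so the coefficients of an invariant element are constant on orbits.
Subtracting the right multiple of one orbit sum shrinks the support, and the induction is on its
size. -/
theorem mem_of_fixed_of_orbit_sum_mem {M G : Type*} [AddCommGroup M] [Group G] [Finite G]
    [DistribMulAction G M] {S : Set M} (b : Module.Basis S ℤ M) (hb : ∀ c, b c = c)
    (hS : ∀ (g : G), ∀ c ∈ S, g • c ∈ S) (N : AddSubgroup M)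
    (hN : ∀ c ∈ S, ∑ᶠ x ∈ MulAction.orbit G c, x ∈ N) (x : M) (hx : ∀ g : G, g • x = x) :
    x ∈ N := by
  -- The coordinates are equivariant: the coefficient of `g • y` at `g • c` is that of `y` at `c`.
  classical
  have hrepr : ∀ (g : G) (y : M) (c : S), b.repr (g • y) ⟨g • c.1, hS g c c.2⟩ = b.repr y c := by
    intro g y c
    induction b.mem_span y using Submodule.span_induction with
    | zero => simp
    | mem y hy =>
      obtain ⟨i, rfl⟩ := hy
      have : g • b i = b ⟨g • i.1, hS g i i.2⟩ := by rw [hb, hb]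
      rw [this, b.repr_self, b.repr_self, Finsupp.single_apply, Finsupp.single_apply]
      simp [Subtype.ext_iff]
    | add y z _ _ hy hz => simp [smul_add, hy, hz]
    | smul n y _ hy => 
      rw [smul_comm, map_zsmul b.repr, map_zsmul b.repr, Finsupp.smul_apply, Finsupp.smul_apply, hy]
  induction hn : (b.repr x).support.card using Nat.strong_induction_on generalizing x with
  | _ n ih =>
    by_cases h0 : x = 0
    · rw [h0]; exact N.zero_mem
    have : (b.repr x).support.Nonempty := by
      rw [Finsupp.support_nonempty_iff]
      simpa using h0
    obtain ⟨c, hc⟩ := this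
    have hfin : (MulAction.orbit G (c : M)).Finite := Set.finite_range _
    set y := ∑ᶠ z ∈ MulAction.orbit G (c : M), z with hy
    have hy' : y = ∑ z ∈ hfin.toFinset, z := by rw [hy, finsum_mem_eq_finite_toFinset_sum _ hfin]
    have hyr : ∀ d : S, b.repr y d = if (d : M) ∈ MulAction.orbit G (c : M) then 1 else 0 := by
      intro d
      rw [hy', map_sum, Finsupp.finsetSum_apply]
      have : ∀ z ∈ hfin.toFinset, b.repr z d = if z = d then 1 else 0 := by
        intro z hz
        obtain ⟨g, rfl⟩ := (hfin.mem_toFinset).1 hz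
        have : g • (c : M) = b ⟨g • c.1, hS g c c.2⟩ := by rw [hb]
        change b.repr (g • (c : M)) d = if g • (c : M) = d then 1 else 0
        rw [this, b.repr_self, Finsupp.single_apply, hb]
        exact if_congr Subtype.ext_iff rfl rfl
      rw [Finset.sum_congr rfl this, Finset.sum_ite_eq']
      simp
    have hgy : ∀ g : G, g • y = y := by
      intro g
      rw [hy', Finset.smul_sum]
      refine Finset.sum_bij (fun z _ => g • z) (fun z hz => ?_) (fun _ _ _ _ h => ?_)
        (fun z hz => ?_) (fun _ _ => rfl)
      · rw [Set.Finite.mem_toFinset] at hz ⊢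
        obtain ⟨h, rfl⟩ := hz
        exact ⟨g * h, mul_smul g h _⟩
      · exact smul_left_cancel g h
      · rw [Set.Finite.mem_toFinset] at hz
        obtain ⟨h, rfl⟩ := hz
        exact ⟨g⁻¹ • h • (c : M), by
          rw [Set.Finite.mem_toFinset]; exact ⟨g⁻¹ * h, mul_smul g⁻¹ h _⟩, smul_inv_smul g _⟩
    have hconst : ∀ d : S, (d : M) ∈ MulAction.orbit G (c : M) → b.repr x d = b.repr x c := by
      rintro d ⟨g, hg⟩
      have := hrepr g x c
      rw [hx g] at this
      rw [← this]
      congr 1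
      exact Subtype.ext hg.symm
    have hmem : x - b.repr x c • y ∈ N := by
      refine ih _ ?_ _ (fun g => ?_) rfl
      · rw [← hn]
        apply Finset.card_lt_card
        rw [Finset.ssubset_iff_of_subset]
        · refine ⟨c, hc, ?_⟩
          rw [Finsupp.notMem_support_iff, map_sub, map_smul, Finsupp.sub_apply, Finsupp.smul_apply,
            hyr, if_pos (MulAction.mem_orbit_self _)]
          simp
        · intro d hd
          rw [Finsupp.mem_support_iff] at hd ⊢
          intro h
          apply hd
          rw [map_sub, map_smul, Finsupp.sub_apply, Finsupp.smul_apply, hyr]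
          split_ifs with hdo
          · rw [hconst d hdo]; simp
          · simp [h]
      · rw [smul_sub, smul_comm, hx, hgy]
    have := N.add_mem hmem (N.zsmul_mem (hN c c.2) (b.repr x c))
    rwa [← hy, sub_add_cancel] at this

end Invariants

end KSInterpolation

namespace KSInterpolation

theorem IsDrazin.of_map {M M' F : Type*} [Monoid M] [Monoid M'] [FunLike F M M']
    [MonoidHomClass F M M'] (f : F) (hf : Function.Injective f) {a d : M}
    (h : IsDrazin (f a) (f d)) : IsDrazin a d where
  comm := hf (by rw [map_mul, map_mul, h.comm])
  idem := hf (by rw [map_mul, map_mul, h.idem])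
  exists_pow := by
    obtain ⟨N, hN⟩ := h.exists_pow
    exact ⟨N, hf (by rw [map_mul, map_pow, map_pow, hN])⟩

/-! ### Equivariant objects form a Krull–Schmidt category -/

namespace EquivariantObject

variable {G : Type*} [Group G] {C : Type u} [Category.{v} C] [Preadditive C] [StrictAction G C]

open StrictAction

theorem T_one_map_comp_eqToHom {X Y : C} (f : X ⟶ Y) :
    (T (1 : G)).map f ≫ eqToHom (one_obj G Y) = eqToHom (one_obj G X) ≫ f := by
  rw [Functor.congr_hom (T_one (G := G)) f]
  simp

theorem T_mul_map_comp_eqToHom (h g : G) {X Y : C} (f : X ⟶ Y) :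
    (T h).map ((T g).map f) ≫ eqToHom (mul_obj h g Y) =
      eqToHom (mul_obj h g X) ≫ (T (h * g)).map f := by
  rw [Functor.congr_hom (T_mul h g) f]
  simp

theorem Hom.comm_assoc {A B : EquivariantObject G C} (f : Hom A B) (g : G) {Z : C}
    (h : B.X ⟶ Z) :
    (A.α g).hom ≫ f.hom ≫ h = (T g).map f.hom ≫ (B.α g).hom ≫ h := by
  rw [← Category.assoc, f.comm, Category.assoc]

/-- A retract cut out by an equivariant idempotent is an equivariant object. -/
def ofRetract (A : EquivariantObject G C) (p : A ⟶ A) {Y : C} (i : Y ⟶ A.X) (e : A.X ⟶ Y)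
    (hie : i ≫ e = 𝟙 Y) (hei : e ≫ i = p.hom) : EquivariantObject G C where
  X := Y
  α g :=
    { hom := (T g).map i ≫ (A.α g).hom ≫ e
      inv := i ≫ (A.α g).inv ≫ (T g).map e
      hom_inv_id := by
        have h : p.hom ≫ (A.α g).inv = (A.α g).inv ≫ (T g).map p.hom := by
          rw [Iso.comp_inv_eq, Category.assoc, ← p.comm g, Iso.inv_hom_id_assoc]
        simp only [Category.assoc]
        rw [reassoc_of% hei, reassoc_of% h, Iso.hom_inv_id_assoc, ← hei, ← Functor.map_comp,
          ← Functor.map_comp, Category.assoc, hie, Category.comp_id, hie, CategoryTheory.Functor.map_id]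
      inv_hom_id := by
        simp only [Category.assoc]
        rw [← Functor.map_comp_assoc, hei, ← p.comm_assoc g, Iso.inv_hom_id_assoc, ← hei,
          Category.assoc, hie, Category.comp_id, hie] }
  α_one := by
    change (T (1 : G)).map i ≫ (A.α 1).hom ≫ e = _
    rw [A.α_one, ← Category.assoc, T_one_map_comp_eqToHom, Category.assoc, hie, Category.comp_id]
  α_mul h g := by
    change (T h).map ((T g).map i ≫ (A.α g).hom ≫ e) ≫ (T h).map i ≫ (A.α h).hom ≫ e =
      _ ≫ (T (h * g)).map i ≫ (A.α (h * g)).hom ≫ e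
    rw [← Category.assoc (eqToHom _), ← T_mul_map_comp_eqToHom, Category.assoc,
      ← Category.assoc (eqToHom _), ← A.α_mul, Functor.map_comp, Functor.map_comp]
    simp only [Category.assoc]
    rw [← Functor.map_comp_assoc (T h) e, hei, ← p.comm_assoc h, ← hei, Category.assoc, hie,
      Category.comp_id]

/-- The splitting is taken in `C`, and the retract inherits its equivariant structure by compressing
that of `A`. -/
instance [IsIdempotentComplete C] : IsIdempotentComplete (EquivariantObject G C) where
  idempotents_split A p hp := by
    obtain ⟨Y, i, e, hie, hei⟩ := IsIdempotentComplete.idempotents_split A.X p.hom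
      (congrArg Hom.hom hp)
    refine ⟨A.ofRetract p i e hie hei, ⟨i, fun g => ?_⟩, ⟨e, fun g => ?_⟩, hom_ext hie,
      hom_ext hei⟩
    · change ((T g).map i ≫ (A.α g).hom ≫ e) ≫ i = _
      rw [Category.assoc, Category.assoc, hei, p.comm g, ← hei, ← Functor.map_comp_assoc,
        reassoc_of% hie]
      rfl
    · change _ = (T g).map e ≫ (T g).map i ≫ (A.α g).hom ≫ e
      rw [← Functor.map_comp_assoc, hei, ← p.comm_assoc g, ← hei, Category.assoc, hie,
        Category.comp_id]
      rfl

theorem isZero_of_isZero {A : EquivariantObject G C} (h : IsZero A.X) : IsZero A := by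
  rw [IsZero.iff_id_eq_zero]
  exact hom_ext (h.eq_of_src _ _)

/-- Conjugating the Drazin inverse `d` of an equivariant `f` by the structure isomorphism gives a
Drazin inverse of the same `f`, hence `d` itself by uniqueness; so `d` is a morphism of equivariant
objects. The size function is that of the underlying object. -/
instance [IsKrullSchmidt C] : IsKrullSchmidt (EquivariantObject G C) where
  exists_isDrazin A f := by
    obtain ⟨d, hd⟩ := IsKrullSchmidt.exists_isDrazin A.X f.hom
    have hcomm : ∀ g : G, (A.α g).hom ≫ d = (T g).map d ≫ (A.α g).hom := by
      intro g
      have h1 := (hd.map (Functor.mapEnd A.X (T g))).map (A.α g).conj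
      have h2 : (A.α g).conj (Functor.mapEnd A.X (T g) f.hom) = f.hom := by
        change (A.α g).inv ≫ (T g).map f.hom ≫ (A.α g).hom = f.hom
        rw [← f.comm g, Iso.inv_hom_id_assoc]
      rw [h2] at h1
      have h3 : d = (A.α g).inv ≫ (T g).map d ≫ (A.α g).hom := hd.unique h1
      conv_lhs => rw [h3, Iso.hom_inv_id_assoc]
    refine ⟨⟨d, hcomm⟩, IsDrazin.of_map (Functor.mapEnd A (forget G C)) ?_ hd⟩
    exact fun _ _ h => hom_ext h
  exists_size := by
    obtain ⟨d, hd, hd0⟩ := IsKrullSchmidt.exists_size (C := C)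
    refine ⟨fun A => d A.X, fun X Y b hb => ?_, fun A h => isZero_of_isZero (hd0 _ h)⟩
    exact hd _ _ ((forget G C).mapBinaryBicone b) (congrArg Hom.hom hb)

end EquivariantObject

end KSInterpolation

namespace KSInterpolation

/-! ### Fitting decompositions of module endomorphisms -/

/-- Fitting's lemma: `M` is the direct sum of the kernel and the range of `f ^ N` for large `N`. The
Drazin inverse is the inverse of `f` on the range and `0` on the kernel. -/
theorem exists_isDrazin_moduleEnd {A M : Type*} [Ring A] [AddCommGroup M] [Module A M]
    [IsArtinian A M] [IsNoetherian A M] (f : Module.End A M) : ∃ d, IsDrazin f d := by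
  -- `N ≥ 1` is needed below so that `f x = 0` puts `x` in the kernel of `f ^ N`.
  obtain ⟨N, hN⟩ := (f.eventually_isCompl_ker_pow_range_pow.and
    (Filter.eventually_ge_atTop 1)).exists
  obtain ⟨hc, hN1⟩ := hN
  set K := LinearMap.ker (f ^ N)
  set I := LinearMap.range (f ^ N)
  have hfI : ∀ x ∈ I, f x ∈ I := by
    rintro _ ⟨y, rfl⟩
    exact ⟨f y, by rw [← Module.End.mul_apply, ← pow_succ, pow_succ', Module.End.mul_apply]⟩
  have hfK : ∀ x ∈ K, f x ∈ K := by
    intro x hx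
    rw [LinearMap.mem_ker] at hx ⊢
    rw [← Module.End.mul_apply, ← pow_succ, pow_succ', Module.End.mul_apply, hx, map_zero]
  let g : I →ₗ[A] I := f.restrict hfI
  have hginj : Function.Injective g := by
    rw [← LinearMap.ker_eq_bot, LinearMap.ker_eq_bot']
    rintro ⟨x, hx⟩ h0
    have h0' : f x = 0 := congrArg Subtype.val h0
    have hxK : x ∈ K := by
      rw [LinearMap.mem_ker]
      rw [← Nat.sub_add_cancel hN1, pow_succ, Module.End.mul_apply, h0', map_zero]
    have : x ∈ (⊥ : Submodule A M) := by rw [← hc.inf_eq_bot]; exact ⟨hxK, hx⟩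
    exact Subtype.ext (by simpa using this)
  let e : I ≃ₗ[A] I := LinearEquiv.ofBijective g
    (IsArtinian.bijective_of_injective_endomorphism g hginj)
  let pr : M →ₗ[A] I := I.projectionOnto K hc.symm
  let d : Module.End A M := I.subtype ∘ₗ e.symm.toLinearMap ∘ₗ pr
  have hdI : ∀ x : I, d (f x) = x := by
    intro x
    have : pr (f x) = e x := Submodule.projectionOnto_apply_left hc.symm (e x)
    change ((e.symm (pr (f x)) : I) : M) = x
    rw [this, e.symm_apply_apply]
  have hfdI : ∀ x : I, f (d x) = x := by
    intro x
    have : pr x = x := Submodule.projectionOnto_apply_left hc.symm x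
    change f (e.symm (pr x) : I) = x
    rw [this]
    exact congrArg Subtype.val (e.apply_symm_apply x)
  have hdK : ∀ x ∈ K, d x = 0 := by
    intro x hx
    have : pr x = 0 := (Submodule.projectionOnto_apply_eq_zero_iff hc.symm).2 hx
    change ((e.symm (pr x) : I) : M) = 0
    rw [this, map_zero]; rfl
  have hext : ∀ a b : Module.End A M, (∀ x : I, a x = b x) → (∀ x ∈ K, a x = b x) → a = b := by
    intro a b h1 h2
    ext x
    obtain ⟨y, hy, z, hz, rfl⟩ := Submodule.mem_sup.1
      (hc.symm.sup_eq_top ▸ Submodule.mem_top : x ∈ I ⊔ K)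
    rw [map_add, map_add, h1 ⟨y, hy⟩, h2 z hz]
  refine ⟨d, hext _ _ (fun x => ?_) fun x hx => ?_, hext _ _ (fun x => ?_) fun x hx => ?_, N,
    hext _ _ (fun x => ?_) fun x hx => ?_⟩
  · rw [Module.End.mul_apply, Module.End.mul_apply, hdI, hfdI]
  · rw [Module.End.mul_apply, Module.End.mul_apply, hdK x hx, hdK _ (hfK x hx), map_zero]
  · rw [Module.End.mul_apply, Module.End.mul_apply, hfdI]
  · rw [Module.End.mul_apply, hdK x hx, map_zero]
  · rw [pow_succ, mul_assoc, Module.End.mul_apply, Module.End.mul_apply, hfdI]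
  · rw [Module.End.mul_apply, hdK x hx, map_zero]
    exact (LinearMap.mem_ker.1 hx).symm

/-! ### The categories `⨁ fproj-R_n` over artinian rings are Krull–Schmidt -/

namespace SumProj

variable {R : ℕ → Type w} [∀ n, Ring (R n)] {X Y Z : SumProj R}

/-- The components of a morphism. -/
def app (φ : X ⟶ Y) (n : ℕ) : X.obj n →ₗ[(R n)ᵐᵒᵖ] Y.obj n := (φ.hom n).hom

/-- The morphism with given components. -/
def mkHom (f : ∀ n, X.obj n →ₗ[(R n)ᵐᵒᵖ] Y.obj n) : X ⟶ Y :=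
  ObjectProperty.homMk fun n => ModuleCat.ofHom (f n)

theorem app_ext {φ ψ : X ⟶ Y} (h : ∀ n x, app φ n x = app ψ n x) : φ = ψ := by
  apply ObjectProperty.hom_ext
  funext n
  exact ModuleCat.hom_ext (LinearMap.ext (h n))

@[simp] theorem app_comp (φ : X ⟶ Y) (ψ : Y ⟶ Z) (n : ℕ) (x : X.obj n) :
    app (φ ≫ ψ) n x = app ψ n (app φ n x) := rfl

@[simp] theorem app_id (n : ℕ) (x : X.obj n) : app (𝟙 X) n x = x := rfl

@[simp] theorem app_zero (n : ℕ) (x : X.obj n) : app (0 : X ⟶ Y) n x = 0 := rfl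

variable (X Y) in
/-- Taking components, as an additive map. -/
def appHom (n : ℕ) : (X ⟶ Y) →+ (X.obj n →ₗ[(R n)ᵐᵒᵖ] Y.obj n) where
  toFun φ := app φ n
  map_zero' := rfl
  map_add' _ _ := rfl

@[simp] theorem app_sum {J : Type*} (s : Finset J) (φ : J → (X ⟶ Y)) (n : ℕ) (x : X.obj n) :
    app (∑ j ∈ s, φ j) n x = ∑ j ∈ s, app (φ j) n x := by
  have := map_sum (appHom X Y n) φ s
  change app _ n = ∑ j ∈ s, app (φ j) n at this
  rw [this, LinearMap.sum_apply]

variable (X) in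
/-- Taking components, as a monoid homomorphism. -/
def appEnd (n : ℕ) : End X →* Module.End (R n)ᵐᵒᵖ (X.obj n) where
  toFun φ := app φ n
  map_one' := rfl
  map_mul' _ _ := rfl

instance finite_obj (n : ℕ) : Module.Finite (R n)ᵐᵒᵖ (X.obj n) := (X.property.1 n).1

instance projective_obj (n : ℕ) : Module.Projective (R n)ᵐᵒᵖ (X.obj n) := (X.property.1 n).2

theorem finite_support (X : SumProj R) : {n | ¬ Subsingleton (X.obj n)}.Finite := by
  refine X.property.2.subset fun n hn h => hn ?_
  exact ModuleCat.isZero_iff_subsingleton.1 h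

theorem isZero_iff : IsZero X ↔ ∀ n, Subsingleton (X.obj n) := by
  rw [IsZero.iff_id_eq_zero]
  constructor
  · intro h n
    refine ⟨fun x y => ?_⟩
    have hx : ∀ x : X.obj n, x = 0 := fun x => by
      rw [← app_id (X := X) n x, h, app_zero]
    rw [hx x, hx y]
  · intro h
    exact app_ext fun n x => (h n).elim _ _

/-- The object with given components. -/
def mk (M : ℕ → Type w) [∀ n, AddCommGroup (M n)] [∀ n, Module (R n)ᵐᵒᵖ (M n)]
    [∀ n, Module.Finite (R n)ᵐᵒᵖ (M n)] [∀ n, Module.Projective (R n)ᵐᵒᵖ (M n)]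
    (h : {n | ¬ Subsingleton (M n)}.Finite) : SumProj R :=
  ⟨fun n => ModuleCat.of (R n)ᵐᵒᵖ (M n), fun _ => ⟨inferInstance, inferInstance⟩,
    h.subset fun _ hn hs => hn (ModuleCat.isZero_iff_subsingleton.2 hs)⟩

instance : IsIdempotentComplete (SumProj R) where
  idempotents_split X p hp := by
    have hpp : ∀ n x, app p n (app p n x) = app p n x := fun n x => by rw [← app_comp, hp]
    have hproj : ∀ n, Module.Projective (R n)ᵐᵒᵖ (LinearMap.range (app p n)) := fun n =>
      Module.Projective.of_split (LinearMap.range (app p n)).subtype (app p n).rangeRestrict (by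
        ext ⟨_, y, rfl⟩
        exact hpp n y)
    let Y : SumProj R := mk (fun n => LinearMap.range (app p n))
      (X.finite_support.subset fun n hn hs => hn ⟨fun a b => Subtype.ext (hs.elim _ _)⟩)
    refine ⟨Y, mkHom fun n => (LinearMap.range (app p n)).subtype,
      mkHom fun n => (app p n).rangeRestrict, ?_, rfl⟩
    refine app_ext fun n x => ?_
    obtain ⟨_, y, rfl⟩ := x
    exact Subtype.ext (hpp n y)

variable [∀ n, IsArtinianRing (R n)ᵐᵒᵖ]

/-- Drazin inverses are formed degree by degree. A single exponent works in all degrees because only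
finitely many components are nonzero. -/
theorem exists_isDrazin (f : End X) : ∃ d, IsDrazin f d := by
  choose d hd using fun n => exists_isDrazin_moduleEnd (appEnd X n f)
  choose N hN using fun n => (hd n).exists_pow
  let D : End X := mkHom d
  have hD : ∀ n, appEnd X n D = d n := fun n => rfl
  have hext : ∀ a b : End X, (∀ n, appEnd X n a = appEnd X n b) → a = b := fun a b h =>
    app_ext fun n x => congrArg (fun l : Module.End (R n)ᵐᵒᵖ (X.obj n) => l x) (h n)
  refine ⟨D, hext _ _ fun n => ?_, hext _ _ fun n => ?_, X.finite_support.toFinset.sup N,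
    hext _ _ fun n => ?_⟩
  · rw [map_mul, map_mul, hD, (hd n).comm]
  · rw [map_mul, map_mul, hD, (hd n).idem]
  · by_cases h : Subsingleton (X.obj n)
    · exact Subsingleton.elim _ _
    · have hle : N n ≤ X.finite_support.toFinset.sup N :=
        Finset.le_sup (f := N) ((Set.Finite.mem_toFinset _).2 h)
      obtain ⟨k, hk⟩ := Nat.exists_eq_add_of_le hle
      rw [map_mul, map_pow, map_pow, hD, hk, show N n + k + 1 = k + (N n + 1) by ring, pow_add,
        mul_assoc, hN, ← pow_add, add_comm]

omit [∀ n, IsArtinianRing (R n)ᵐᵒᵖ] in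
theorem length_add (b : BinaryBicone X Y) (h : b.fst ≫ b.inl + b.snd ≫ b.inr = 𝟙 b.pt) (n : ℕ) :
    Module.length (R n)ᵐᵒᵖ (b.pt.obj n) =
      Module.length (R n)ᵐᵒᵖ (X.obj n) + Module.length (R n)ᵐᵒᵖ (Y.obj n) := by
  rw [← Module.length_prod]
  have h1 : ∀ x, app b.inl n (app b.fst n x) + app b.inr n (app b.snd n x) = x := fun x => by
    have := congrArg (fun φ => app φ n x) h
    exact this
  have h2 : ∀ x, app b.fst n (app b.inl n x) = x := fun x => by rw [← app_comp]; simp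
  have h3 : ∀ x, app b.snd n (app b.inr n x) = x := fun x => by rw [← app_comp]; simp
  have h4 : ∀ x, app b.fst n (app b.inr n x) = 0 := fun x => by rw [← app_comp]; simp
  have h5 : ∀ x, app b.snd n (app b.inl n x) = 0 := fun x => by rw [← app_comp]; simp
  let e : b.pt.obj n ≃ₗ[(R n)ᵐᵒᵖ] X.obj n × Y.obj n :=
    { (app b.fst n).prod (app b.snd n) with
      invFun := fun x => app b.inl n x.1 + app b.inr n x.2
      left_inv := h1
      right_inv := fun x => Prod.ext (by simp [h2, h4]) (by simp [h3, h5]) }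
  exact e.length_eq

instance : IsKrullSchmidt (SumProj R) where
  exists_isDrazin _ := exists_isDrazin
  exists_size := by
    have hfin : ∀ X : SumProj R,
        (Function.support fun n => (Module.length (R n)ᵐᵒᵖ (X.obj n)).toNat).Finite := fun X =>
      X.finite_support.subset fun n hn hs => hn (by
        change ENat.toNat _ = 0
        rw [Module.length_eq_zero_iff.2 hs]; rfl)
    have htop : ∀ (X : SumProj R) (n : ℕ), Module.length (R n)ᵐᵒᵖ (X.obj n) ≠ ⊤ := fun X n =>
      Module.length_ne_top
    refine ⟨fun X => ∑ᶠ n, (Module.length (R n)ᵐᵒᵖ (X.obj n)).toNat, fun X Y b h => ?_,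
      fun X hX => ?_⟩
    · rw [← finsum_add_distrib (hfin X) (hfin Y)]
      refine finsum_congr fun n => ?_
      rw [length_add b h, ENat.toNat_add (htop _ _) (htop _ _)]
    · rw [isZero_iff]
      intro n
      have := Nat.le_zero.1 ((single_le_finsum n (hfin X) fun _ => Nat.zero_le _).trans hX.le)
      rw [ENat.toNat_eq_zero] at this
      exact Module.length_eq_zero_iff.1 (this.resolve_right (htop X n))

end SumProj

end KSInterpolation

/-! ### Twists, semilinear actions and induced objects -/

namespace KSInterpolation

open MulOpposite (op unop)

/-- Actions of a group on a sequence of rings. -/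
class RingActions (G : Type*) [Group G] (R : ℕ → Type w) [∀ n, Ring (R n)] where
  ρ : ∀ n, G →* (R n →+* R n)

theorem projective_pi {A Q : Type*} [Fintype Q] [Ring A] (M : Q → Type*)
    [∀ q, AddCommGroup (M q)] [∀ q, Module A (M q)] [∀ q, Module.Projective A (M q)] :
    Module.Projective A (∀ q, M q) := by
  classical
  exact Module.Projective.of_equiv' DFinsupp.linearEquivFunOnFintype

/-- A ring as a free module over its opposite. -/
def opRegularEquiv (A : Type*) [Ring A] : A ≃ₗ[Aᵐᵒᵖ] Aᵐᵒᵖ :=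
  { MulOpposite.opAddEquiv with
    map_smul' := fun _ _ => rfl }

namespace SumProj

variable {R : ℕ → Type w} [∀ n, Ring (R n)] {X Y Z : SumProj R}
variable {G : Type w} [Group G] [RingActions G R]

open KSInterpolation.RingActions (ρ)
open KSInterpolation.StrictAction (T)

variable (G R) in
noncomputable instance ringActionsStrictAction : StrictAction G (SumProj R) :=
  strictAction ρ

theorem ρ_ρ (n : ℕ) (g h : G) (r : R n) : ρ n g (ρ n h r) = ρ n (g * h) r := by
  rw [map_mul]; rfl

theorem ρ_one (n : ℕ) (r : R n) : ρ n (1 : G) r = r := by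
  rw [map_one]; rfl

theorem smul_smul_op {A M : Type*} [Ring A] [AddCommGroup M] [Module Aᵐᵒᵖ M] (a b : A) (x : M) :
    op a • op b • x = op (b * a) • x := by
  rw [← mul_smul]; rfl

/-- The identity map from an object to its twist. -/
noncomputable def toT (g : G) {n : ℕ} (x : X.obj n) : ((T g).obj X).obj n := x

/-- The identity map `X → T g X` is `g`-semilinear. Consequently morphisms out of `T g X` are the
same as `g`-semilinear maps out of `X`; `semi` and `sapp` translate between the two. -/
theorem toT_smul (g : G) (n : ℕ) (r : R n) (x : X.obj n) :
    toT g (op r • x) = op (ρ n g r) • toT g x := by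
  change op r • x = op (ρ n g⁻¹ (ρ n g r)) • x
  rw [ρ_ρ, inv_mul_cancel, ρ_one]

theorem app_map (g : G) (φ : X ⟶ Y) (n : ℕ) (x : X.obj n) :
    app ((T g).map φ) n (toT g x) = toT g (app φ n x) := rfl

/-- A family of semilinear maps as a morphism out of a twist. -/
noncomputable def semi (g : G) (f : ∀ n, X.obj n →+ Y.obj n)
    (hf : ∀ n (r : R n) x, f n (op r • x) = op (ρ n g r) • f n x) : (T g).obj X ⟶ Y :=
  mkHom fun n =>
    { toFun := fun x => f n x
      map_add' := fun x y => map_add (f n) x y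
      map_smul' := fun s x => by
        refine (hf n (ρ n g⁻¹ (unop s)) x).trans ?_
        rw [ρ_ρ, mul_inv_cancel, ρ_one]; rfl }

theorem app_semi (g : G) (f : ∀ n, X.obj n →+ Y.obj n)
    (hf : ∀ n (r : R n) x, f n (op r • x) = op (ρ n g r) • f n x) (n : ℕ) (x : X.obj n) :
    app (semi g f hf) n (toT g x) = f n x := rfl

/-- The components of a morphism out of a twist. -/
noncomputable def sapp {g : G} (φ : (T g).obj X ⟶ Y) (n : ℕ) : X.obj n →+ Y.obj n :=
  { toFun := fun x => app φ n (toT g x)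
    map_zero' := map_zero (app φ n)
    map_add' := map_add (app φ n) }

theorem ext_toT {g : G} {φ ψ : (T g).obj X ⟶ Y} (h : ∀ n x, sapp φ n x = sapp ψ n x) :
    φ = ψ :=
  app_ext h

theorem ext_toT_toT {g h : G} {φ ψ : (T g).obj ((T h).obj X) ⟶ Y}
    (e : ∀ n (x : X.obj n), sapp φ n (toT h x) = sapp ψ n (toT h x)) : φ = ψ :=
  app_ext e

theorem sapp_apply {g : G} (φ : (T g).obj X ⟶ Y) (n : ℕ) (x : X.obj n) :
    sapp φ n x = app φ n (toT g x) := rfl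

theorem sapp_smul {g : G} (φ : (T g).obj X ⟶ Y) (n : ℕ) (r : R n) (x : X.obj n) :
    sapp φ n (op r • x) = op (ρ n g r) • sapp φ n x := by
  change app φ n (toT g (op r • x)) = _
  rw [toT_smul, map_smul]; rfl

/-- The strictness isomorphisms are identities on elements. Heterogeneous equality handles the
equality of objects; for `T 1 X = X` and `T g (T h X) = T (g * h) X` the carriers coincide by
definition, so it becomes an ordinary equality. -/
theorem app_eqToHom_heq {X Y : SumProj R} (h : X = Y) (n : ℕ) (x : X.obj n) :
    HEq (app (eqToHom h) n x) x := by
  subst h; rfl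

theorem app_eqToHom_one (n : ℕ) (x : X.obj n) :
    app (eqToHom (StrictAction.one_obj G X)) n (toT 1 x) = x :=
  eq_of_heq (app_eqToHom_heq (StrictAction.one_obj G X) n (toT 1 x))

theorem app_eqToHom_mul (g h : G) (n : ℕ) (x : X.obj n) :
    app (eqToHom (StrictAction.mul_obj g h X)) n (toT g (toT h x)) = toT (g * h) x :=
  eq_of_heq (app_eqToHom_heq (StrictAction.mul_obj g h X) n (toT g (toT h x)))

/-- Semilinear actions of a subgroup on an object. -/
structure SemiAction (H : Subgroup G) (V : SumProj R) where
  a : H → ∀ n, V.obj n →+ V.obj n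
  a_smul : ∀ (h : H) n (r : R n) x, a h n (op r • x) = op (ρ n (h : G) r) • a h n x
  a_one : ∀ n x, a 1 n x = x
  a_mul : ∀ h h' n x, a (h * h') n x = a h n (a h' n x)

theorem SemiAction.congr {H : Subgroup G} {V : SumProj R} (a : SemiAction H V) {h h' : H}
    (e : h = h') (n : ℕ) {x x' : V.obj n} (e' : x = x') : a.a h n x = a.a h' n x' := by
  rw [e, e']

/-- A semilinear action as an equivariant structure. -/
noncomputable def ofAction (a : G → ∀ n, X.obj n →+ X.obj n)
    (hsmul : ∀ g n (r : R n) x, a g n (op r • x) = op (ρ n g r) • a g n x)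
    (hone : ∀ n x, a 1 n x = x) (hmul : ∀ g h n x, a (g * h) n x = a g n (a h n x)) :
    EquivariantObject G (SumProj R) where
  X := X
  α g :=
    { hom := semi g (a g) (hsmul g)
      inv := mkHom fun n =>
        { toFun := fun x => a g⁻¹ n x
          map_add' := fun x y => map_add (a g⁻¹ n) x y
          map_smul' := fun s x => hsmul g⁻¹ n (unop s) x }
      hom_inv_id := ext_toT fun n x => by
        change a g⁻¹ n (a g n x) = x
        rw [← hmul, inv_mul_cancel, hone]
      inv_hom_id := app_ext fun n x => by
        change a g n (a g⁻¹ n x) = x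
        rw [← hmul, mul_inv_cancel, hone] }
  α_one := ext_toT fun n x => by
    rw [sapp_apply, sapp_apply, app_semi, hone, app_eqToHom_one]
  α_mul h g := ext_toT_toT fun n x => by
    rw [sapp_apply, sapp_apply, app_comp, app_comp, app_eqToHom_mul, app_map, app_semi, app_semi, app_semi, hmul]

/-- The semilinear action underlying an equivariant structure. -/
noncomputable def act (A : EquivariantObject G (SumProj R)) (g : G) (n : ℕ) : A.X.obj n →+ A.X.obj n :=
  sapp (A.α g).hom n

variable (A : EquivariantObject G (SumProj R))

theorem act_smul (g : G) (n : ℕ) (r : R n) (x : A.X.obj n) :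
    act A g n (op r • x) = op (ρ n g r) • act A g n x := sapp_smul _ _ _ _

theorem act_one (n : ℕ) (x : A.X.obj n) : act A 1 n x = x := by
  change app (A.α 1).hom n (toT 1 x) = x
  rw [A.α_one, app_eqToHom_one]

theorem act_mul (g h : G) (n : ℕ) (x : A.X.obj n) :
    act A (g * h) n x = act A g n (act A h n x) := by
  have h1 : app ((T g).map (A.α h).hom ≫ (A.α g).hom) n (toT g (toT h x)) =
      app (eqToHom (StrictAction.mul_obj g h A.X) ≫ (A.α (g * h)).hom) n (toT g (toT h x)) := by
    rw [A.α_mul g h]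
  rw [app_comp, app_comp, app_eqToHom_mul, app_map] at h1
  exact h1.symm

/-! ### Induction -/

section Induction

variable {H : Subgroup G} {V : SumProj R} (a : SemiAction H V)
  {Q : Type w} [Fintype Q] [MulAction G Q] (s : Q → G)

/-- The components of an induced object. -/
def IndModule (V : SumProj R) {Q : Type w} (_ : Q → G) (n : ℕ) : Type w := Q → V.obj n

instance (n : ℕ) : AddCommGroup (IndModule V s n) := inferInstanceAs (AddCommGroup (Q → V.obj n))

noncomputable instance (n : ℕ) : Module (R n)ᵐᵒᵖ (IndModule V s n) :=
  inferInstanceAs (Module (R n)ᵐᵒᵖ (∀ q, ((T (s q)).obj V).obj n))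

instance (n : ℕ) : Module.Finite (R n)ᵐᵒᵖ (IndModule V s n) :=
  inferInstanceAs (Module.Finite (R n)ᵐᵒᵖ (∀ q, ((T (s q)).obj V).obj n))

instance (n : ℕ) : Module.Projective (R n)ᵐᵒᵖ (IndModule V s n) :=
  projective_pi fun q => ((T (s q)).obj V).obj n

variable (V) in
/-- The object underlying an induced object. -/
noncomputable def indObj : SumProj R :=
  mk (IndModule V s) (V.finite_support.subset fun _ hn hs => hn
    ⟨fun f f' => funext fun q => hs.elim (f q) (f' q)⟩)

variable (hs : ∀ (g : G) (q : Q), (s q)⁻¹ * g * s (g⁻¹ • q) ∈ H)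

/-- The induced equivariant object. -/
noncomputable def ind : EquivariantObject G (SumProj R) :=
  ofAction (X := indObj V s)
    (fun g n =>
      -- The `q`-component comes from the `g⁻¹ • q`-component; since `g * s (g⁻¹ • q)` and `s q`
      -- differ by an element of `H`, the given action of that element corrects the twist.
      { toFun := fun f q => a.a ⟨_, hs g q⟩ n (f (g⁻¹ • q))
        map_zero' := funext fun q => map_zero (a.a ⟨_, hs g q⟩ n)
        map_add' := fun f f' => funext fun q =>
          map_add (a.a ⟨_, hs g q⟩ n) (f (g⁻¹ • q)) (f' (g⁻¹ • q)) })
    (fun g n r f => funext fun q => by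
      change a.a ⟨_, hs g q⟩ n (op (ρ n (s (g⁻¹ • q))⁻¹ r) • f (g⁻¹ • q)) =
        op (ρ n (s q)⁻¹ (ρ n g r)) • a.a ⟨_, hs g q⟩ n (f (g⁻¹ • q))
      rw [a.a_smul, ρ_ρ, ρ_ρ, mul_inv_cancel_right])
    (fun n f => funext fun q => by
      change a.a ⟨_, hs 1 q⟩ n (f ((1 : G)⁻¹ • q)) = f q
      have h1 : (1 : G)⁻¹ • q = q := by simp
      have h2 : (⟨_, hs 1 q⟩ : H) = 1 := Subtype.ext (by simp)
      rw [h2, h1, a.a_one])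
    (fun g h n f => funext fun q => by
      change a.a ⟨_, hs (g * h) q⟩ n (f ((g * h)⁻¹ • q)) =
        a.a ⟨_, hs g q⟩ n (a.a ⟨_, hs h (g⁻¹ • q)⟩ n (f (h⁻¹ • g⁻¹ • q)))
      rw [← a.a_mul]
      have hq : (g * h)⁻¹ • q = h⁻¹ • g⁻¹ • q := by rw [mul_inv_rev, mul_smul]
      refine a.congr (Subtype.ext ?_) n (congrArg (show Q → V.obj n from f) hq)
      simp [mul_assoc, mul_smul])

open Classical in
variable (V) in
/-- The decomposition of an induced object. -/
noncomputable def indBicone : Bicone fun q : Q => (T (s q)).obj V where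
  pt := indObj V s
  π q := mkHom fun n => LinearMap.proj (φ := fun q => ((T (s q)).obj V).obj n) q
  ι q := mkHom fun n => LinearMap.single (R n)ᵐᵒᵖ (fun q => ((T (s q)).obj V).obj n) q
  ι_π q q' := by
    split_ifs with h
    · subst h
      refine app_ext fun n x => ?_
      exact Pi.single_eq_same (M := fun q => ((T (s q)).obj V).obj n) q x
    · refine app_ext fun n x => ?_
      exact Pi.single_eq_of_ne (M := fun q => ((T (s q)).obj V).obj n) (Ne.symm h) x

omit [MulAction G Q] in
theorem indBicone_ι_apply_ne {q q' : Q} (h : q' ≠ q) (n : ℕ) (x : V.obj n) :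
    (show IndModule V s n from app ((indBicone V s).ι q) n (toT (s q) x)) q' = 0 := by
  classical
  exact Pi.single_eq_of_ne (M := fun q => ((T (s q)).obj V).obj n) h x

omit [MulAction G Q] in
theorem indBicone_total : ∑ q, (indBicone V s).π q ≫ (indBicone V s).ι q = 𝟙 _ := by
  classical
  refine app_ext fun n f => ?_
  rw [app_sum]
  refine Eq.trans (b := ∑ q : Q, (Pi.single q ((show IndModule V s n from f) q) :
    ∀ q, ((T (s q)).obj V).obj n)) ?_ ?_
  · refine Finset.sum_congr rfl fun q _ => ?_
    change LinearMap.single (R n)ᵐᵒᵖ (fun q => ((T (s q)).obj V).obj n) q _ = _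
    rw [LinearMap.coe_single]
    congr!
  exact Finset.univ_sum_single (M := fun q => ((T (s q)).obj V).obj n) f

end Induction

end SumProj

end KSInterpolation

/-! ### Orbit sums by induction from the stabilizer, and injectivity by induction from the trivial
group -/

namespace KSInterpolation

open MulOpposite (op unop)

namespace SumProj

variable {R : ℕ → Type w} [∀ n, Ring (R n)] {X Y Z : SumProj R}
variable {G : Type w} [Group G] [RingActions G R]

open KSInterpolation.RingActions (ρ)
open KSInterpolation.StrictAction (T)

section Orbit

theorem cls_ind {H : Subgroup G} {V : SumProj R} (a : SemiAction H V)
    {Q : Type w} [Fintype Q] [MulAction G Q] (s : Q → G)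
    (hs : ∀ (g : G) (q : Q), (s q)⁻¹ * g * s (g⁻¹ • q) ∈ H) :
    K0.cls (ind a s hs).X = ∑ q, s q • K0.cls V := by
  classical
  refine K0.cls_eq_sum (fun q => (T (s q)).obj V) Finset.univ _ (indBicone V s).ι
    (indBicone V s).π (fun q _ => ?_) (fun q _ q' _ h => ?_) (indBicone_total s)
  · exact bicone_ι_π_self _ q
  · exact bicone_ι_π_ne _ h

theorem out_mem (H : Subgroup G) (g : G) (q : G ⧸ H) : q.out⁻¹ * g * (g⁻¹ • q).out ∈ H := by
  rw [mul_assoc, ← QuotientGroup.eq, QuotientGroup.out_eq']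
  have : ((g * (g⁻¹ • q).out : G) : G ⧸ H) = g • ((g⁻¹ • q).out : G ⧸ H) := rfl
  rw [this, QuotientGroup.out_eq', smul_inv_smul]

theorem sum_out_smul_eq_finsum {M : Type*} [AddCommGroup M] [DistribMulAction G M] (c : M)
    [Fintype (G ⧸ MulAction.stabilizer G c)] :
    ∑ q : G ⧸ MulAction.stabilizer G c, q.out • c = ∑ᶠ x ∈ MulAction.orbit G c, x := by
  let e := MulAction.orbitEquivQuotientStabilizer G c
  rw [← finsum_set_coe_eq_finsum_mem, ← finsum_eq_sum_of_fintype, ← finsum_comp_equiv e.symm]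
  refine finsum_congr fun q => ?_
  conv_rhs => rw [← QuotientGroup.out_eq' q]
  rfl

variable [Finite G]

/-- An object with a semilinear action of the stabilizer of its class gives an equivariant object
whose class is the sum over the orbit. -/
theorem exists_equivariant_of_semiAction (V : SumProj R)
    (a : SemiAction (MulAction.stabilizer G (K0.cls V)) V) :
    ∃ F : EquivariantObject G (SumProj R),
      (K0.cls F.X = ∑ᶠ x ∈ MulAction.orbit G (K0.cls V), x) ∧
      ∃ b : Bicone fun q : G ⧸ MulAction.stabilizer G (K0.cls V) => (T q.out).obj V,
        Nonempty b.IsBilimit ∧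
        ∃ e : b.pt ≅ F.X, ∀ (g : G) (q q'), q' ≠ g • q →
          (T g).map (b.ι q ≫ e.hom) ≫ (F.α g).hom ≫ e.inv ≫ b.π q' = 0 := by
  classical
  have := Fintype.ofFinite (G ⧸ MulAction.stabilizer G (K0.cls V))
  let s : G ⧸ MulAction.stabilizer G (K0.cls V) → G := Quotient.out
  have hs : ∀ g q, (s q)⁻¹ * g * s (g⁻¹ • q) ∈ MulAction.stabilizer G (K0.cls V) := out_mem _
  refine ⟨ind a s hs, (cls_ind a s hs).trans (sum_out_smul_eq_finsum _), indBicone V s,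
    ⟨isBilimitOfTotal _ (indBicone_total s)⟩, Iso.refl _, fun g q q' h => ?_⟩
  refine ext_toT fun n x => ?_
  have hz : ∀ y : V.obj n, y = 0 → a.a ⟨_, hs g q'⟩ n y = 0 := fun y hy => by rw [hy, map_zero]
  have hne : g⁻¹ • q' ≠ q := by
    rintro rfl
    exact h (smul_inv_smul g q').symm
  -- The `q'`-component of the action of `g` reads its argument at `g⁻¹ • q'`, where the inclusion
  -- of the summand `q` vanishes.
  exact hz _ (indBicone_ι_apply_ne s hne n x)

end Orbit

section Injective

variable [Fintype G]

/-- The trivial action of the trivial subgroup. -/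
noncomputable def botAction (X : SumProj R) : SemiAction (⊥ : Subgroup G) X where
  a _ n := AddMonoidHom.id (X.obj n)
  a_smul := by
    rintro ⟨h, hh⟩ n r x
    rw [Subgroup.mem_bot] at hh
    subst hh
    rw [ρ_one]; rfl
  a_one _ _ := rfl
  a_mul _ _ _ _ := rfl

omit [Fintype G] in
theorem id_mem_bot (g q : G) : (id q)⁻¹ * g * id (g⁻¹ • q) ∈ (⊥ : Subgroup G) := by
  simp

/-- Induction from the trivial group. -/
noncomputable def indFunctor : SumProj R ⥤ EquivariantObject G (SumProj R) where
  obj X := ind (botAction X) (id : G → G) id_mem_bot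
  map {X Y} φ :=
    { hom := mkHom (X := indObj X (id : G → G)) (Y := indObj Y (id : G → G)) fun n =>
        { toFun := fun (f : G → X.obj n) (q : G) => app φ n (f q)
          map_add' := fun _ _ => funext fun _ => map_add (app φ n) _ _
          map_smul' := fun _ _ => funext fun _ => map_smul (app φ n) _ _ }
      comm := fun _ => ext_toT fun _ _ => rfl }
  map_id _ := rfl
  map_comp _ _ := rfl

instance : (indFunctor (R := R) (G := G)).Additive where
  map_add := rfl

variable (A : EquivariantObject G (SumProj R))

/-- The map from an equivariant object to the induced object given by a central element. -/
noncomputable def toInd (b : ∀ n, R n) (hb : ∀ n r, b n * r = r * b n) :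
    A ⟶ indFunctor.obj A.X where
  hom := mkHom (Y := indObj A.X (id : G → G)) fun n =>
    { toFun := fun x (q : G) => op (b n) • act A q⁻¹ n x
      map_add' := fun x y => funext fun q => by
        change op (b n) • act A q⁻¹ n (x + y) = op (b n) • act A q⁻¹ n x + op (b n) • act A q⁻¹ n y
        rw [map_add, smul_add]
      map_smul' := fun r x => funext fun q => by
        change op (b n) • act A q⁻¹ n (op (unop r) • x) =
          op (ρ n q⁻¹ (unop r)) • op (b n) • act A q⁻¹ n x
        rw [act_smul, smul_smul_op, smul_smul_op, hb] }
  comm g := ext_toT fun n x => funext fun q => by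
    change op (b n) • act A q⁻¹ n (act A g n x) = op (b n) • act A (g⁻¹ * q)⁻¹ n x
    rw [← act_mul, mul_inv_rev, inv_inv]

/-- The map from the induced object to an equivariant object given by a central element. -/
noncomputable def fromInd (c : ∀ n, R n) (hc : ∀ n r, c n * r = r * c n) :
    indFunctor.obj A.X ⟶ A where
  hom := mkHom (X := indObj A.X (id : G → G)) fun n =>
    { toFun := fun (f : G → A.X.obj n) => ∑ q, act A q n (op (c n) • f q)
      map_add' := fun (f f' : G → A.X.obj n) => by
        change ∑ q, act A q n (op (c n) • (f q + f' q)) = _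
        rw [← Finset.sum_add_distrib]
        exact Finset.sum_congr rfl fun q _ => by rw [smul_add, map_add]
      map_smul' := fun r (f : G → A.X.obj n) => by
        change ∑ q, act A q n (op (c n) • op (ρ n q⁻¹ (unop r)) • f q) = _
        rw [Finset.smul_sum]
        refine Finset.sum_congr rfl fun q _ => ?_
        rw [smul_smul_op, ← hc, ← smul_smul_op, act_smul, ρ_ρ, mul_inv_cancel, ρ_one]
        rfl }
  comm g := ext_toT fun n (f : G → A.X.obj n) => by
    change ∑ q, act A q n (op (c n) • f (g⁻¹ * q)) = act A g n (∑ q, act A q n (op (c n) • f q))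
    rw [map_sum]
    refine (Fintype.sum_equiv (Equiv.mulLeft g) _ _ fun q => ?_).symm
    rw [Equiv.coe_mulLeft, inv_mul_cancel_left, act_mul]

variable {J : Type*} [Fintype J] [DecidableEq J] [DecidableEq G] (b c : J → ∀ n, R n)
  (hb : ∀ j n r, b j n * r = r * b j n) (hc : ∀ j n r, c j n * r = r * c j n)

-- The composite sends `x` to `∑ q (q⁻¹ x · b_i c_j) = x · ∑ q (b_i c_j)`, so `h1` says that the
-- maps `A → Ind A → A` are dual to each other.
omit [Fintype J] [DecidableEq G] in
theorem toInd_fromInd (h1 : ∀ i j n, ∑ g : G, ρ n g (b i n * c j n) = if i = j then 1 else 0)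
    (i j : J) : toInd A (b i) (hb i) ≫ fromInd A (c j) (hc j) = if i = j then 𝟙 A else 0 := by
  have key : ∀ n (x : A.X.obj n), app (toInd A (b i) (hb i) ≫ fromInd A (c j) (hc j)).hom n x =
      op (if i = j then (1 : R n) else 0) • x := by
    intro n x
    change ∑ q, act A q n (op (c j n) • op (b i n) • act A q⁻¹ n x) = _
    rw [← h1, Finset.op_sum, Finset.sum_smul]
    refine Finset.sum_congr rfl fun q _ => ?_
    rw [smul_smul_op, act_smul, ← act_mul, mul_inv_cancel, act_one]
  refine EquivariantObject.hom_ext (app_ext fun n x => (key n x).trans ?_)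
  split_ifs
  · exact one_smul _ _
  · exact zero_smul _ _

-- Here the relation needed is the other one, `∑ j, c_j g(b_j) = δ_{g,1}`: in the `h`-component of
-- the composite it isolates the term `q = h`. With `toInd_fromInd` it exhibits `Ind (Forg A)` as a
-- sum of copies of `A` indexed by `J`.
omit [DecidableEq J] in
theorem fromInd_toInd (h2 : ∀ (g : G) n, ∑ j, c j n * ρ n g (b j n) = if g = 1 then 1 else 0) :
    ∑ j, fromInd A (c j) (hc j) ≫ toInd A (b j) (hb j) = 𝟙 _ := by
  have key : ∀ (s : Finset J), (∑ j ∈ s, fromInd A (c j) (hc j) ≫ toInd A (b j) (hb j)).hom =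
      ∑ j ∈ s, (fromInd A (c j) (hc j) ≫ toInd A (b j) (hb j)).hom := fun s =>
    map_sum ((EquivariantObject.forget G (SumProj R)).mapAddHom) _ s
  refine EquivariantObject.hom_ext (app_ext fun n f => ?_)
  rw [key, app_sum]
  refine @funext G (fun _ => A.X.obj n) _ _ fun h => (Finset.sum_apply h _ _).trans ?_
  change ∑ j, op (b j n) • act A h⁻¹ n (∑ q, act A q n (op (c j n) • (show G → A.X.obj n from f) q))
    = (show G → A.X.obj n from f) h
  generalize (show G → A.X.obj n from f) = f
  have key : ∀ j q, op (b j n) • act A h⁻¹ n (act A q n (op (c j n) • f q)) =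
      act A (h⁻¹ * q) n (op (c j n * ρ n (q⁻¹ * h) (b j n)) • f q) := by
    intro j q
    rw [← act_mul, act_smul, act_smul, smul_smul_op, map_mul (ρ n (h⁻¹ * q)), ρ_ρ]
    simp
  simp only [map_sum, Finset.smul_sum, key]
  rw [Finset.sum_comm]
  have key' : ∀ q, ∑ j, act A (h⁻¹ * q) n (op (c j n * ρ n (q⁻¹ * h) (b j n)) • f q) =
      if q = h then f h else 0 := by
    intro q
    rw [← map_sum, ← Finset.sum_smul, ← Finset.op_sum, h2]
    by_cases hq : q = h
    · rw [hq, inv_mul_cancel, if_pos rfl, if_pos rfl, act_one]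
      exact one_smul _ _
    · rw [if_neg hq, if_neg fun e => hq (inv_mul_eq_one.1 e)]
      exact (congrArg _ (zero_smul _ _)).trans (map_zero _)
  rw [Finset.sum_congr rfl fun q _ => key' q, Finset.sum_ite_eq', if_pos (Finset.mem_univ h)]

theorem card_nsmul_cls [∀ n, IsArtinianRing (R n)ᵐᵒᵖ]
    (h1 : ∀ i j n, ∑ g : G, ρ n g (b i n * c j n) = if i = j then 1 else 0)
    (h2 : ∀ (g : G) n, ∑ j, c j n * ρ n g (b j n) = if g = 1 then 1 else 0)
    (hb : ∀ j n r, b j n * r = r * b j n) (hc : ∀ j n r, c j n * r = r * c j n) :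
    K0.map indFunctor (K0.cls A.X) = Fintype.card J • K0.cls A := by
  rw [K0.map_cls, K0.cls_eq_sum (fun _ : J => A) Finset.univ (indFunctor.obj A.X)
    (fun j => toInd A (b j) (hb j)) (fun j => fromInd A (c j) (hc j))]
  · simp
  · intro j _
    rw [toInd_fromInd A b c hb hc h1, if_pos rfl]
  · intro i _ j _ hij
    rw [toInd_fromInd A b c hb hc h1, if_neg hij]
  · exact fromInd_toInd A b c hb hc h2

/-- Induction after the forgetful functor acts on `K₀` of the equivariant category as multiplication
by the size of `J`, and this group is torsion-free. -/
theorem injective_map_forget [∀ n, IsArtinianRing (R n)ᵐᵒᵖ] [Nonempty J]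
    (h1 : ∀ i j n, ∑ g : G, ρ n g (b i n * c j n) = if i = j then 1 else 0)
    (h2 : ∀ (g : G) n, ∑ j, c j n * ρ n g (b j n) = if g = 1 then 1 else 0)
    (hb : ∀ j n r, b j n * r = r * b j n) (hc : ∀ j n r, c j n * r = r * c j n) :
    Function.Injective (K0.map (EquivariantObject.forget G (SumProj R))) := by
  have key : ∀ x : K0 (EquivariantObject G (SumProj R)),
      K0.map indFunctor (K0.map (EquivariantObject.forget G (SumProj R)) x) =
        Fintype.card J • x := by
    intro x
    induction x using K0.induction_on with
    | h0 => simp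
    | hc A => exact card_nsmul_cls A b c h1 h2 hb hc
    | hn x hx => rw [map_neg, map_neg, hx, smul_neg]
    | ha x y hx hy => rw [map_add, map_add, hx, hy, smul_add]
  rw [injective_iff_map_eq_zero]
  intro x hx
  refine K0.eq_zero_of_nsmul_eq_zero (Fintype.card_ne_zero (α := J)) ?_
  rw [← key, hx, map_zero]

end Injective

end SumProj

end KSInterpolation

/-! ### Modules `y R` generated by idempotents -/

namespace KSInterpolation

open MulOpposite (op unop)

namespace SumProj

variable {R : ℕ → Type w} [∀ n, Ring (R n)] {X Y V W : SumProj R}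

section Corner

/-- The right ideal `y R` of an idempotent `y`. -/
def corner {A : Type*} [Ring A] (y : A) : Submodule Aᵐᵒᵖ A where
  carrier := {x | y * x = x}
  add_mem' := fun {a b} (ha : _ = _) (hb : _ = _) => by
    change y * (a + b) = a + b
    rw [mul_add, ha, hb]
  zero_mem' := mul_zero y
  smul_mem' := fun r x (hx : _ = _) => by
    change y * (x * unop r) = x * unop r
    rw [← mul_assoc, hx]

/-- Multiplication by an idempotent as a projection. -/
def toCorner {A : Type*} [Ring A] {y : A} (hy : IsIdempotentElem y) : A →ₗ[Aᵐᵒᵖ] corner y where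
  toFun x := ⟨y * x, by change y * (y * x) = y * x; rw [← mul_assoc, hy]⟩
  map_add' a b := Subtype.ext (mul_add y a b)
  map_smul' r x := Subtype.ext (mul_assoc y x (unop r)).symm

variable (y : ∀ n, R n) (hy : IsIdempotentElem y) (hf : {n | y n ≠ 0}.Finite)

/-- The object with components `y n * R n`. -/
def cornerObj : SumProj R :=
  have h1 : ∀ n, Module.Projective (R n)ᵐᵒᵖ (R n) := fun n =>
    Module.Projective.of_equiv (opRegularEquiv (R n)).symm
  have h2 : ∀ n, Module.Finite (R n)ᵐᵒᵖ (R n) := fun n =>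
    Module.Finite.equiv (opRegularEquiv (R n)).symm
  have h3 : ∀ n, toCorner (congrFun hy n) ∘ₗ (corner (y n)).subtype = LinearMap.id := fun n =>
    LinearMap.ext fun x => Subtype.ext x.2
  have h4 : ∀ n, Module.Projective (R n)ᵐᵒᵖ (corner (y n)) := fun n =>
    Module.Projective.of_split _ _ (h3 n)
  have h5 : ∀ n, Module.Finite (R n)ᵐᵒᵖ (corner (y n)) := fun n =>
    Module.Finite.of_surjective (toCorner (congrFun hy n)) fun x =>
      ⟨x, LinearMap.congr_fun (h3 n) x⟩
  mk (fun n => corner (y n)) (hf.subset fun n hn h0 => hn ⟨fun a b => Subtype.ext (by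
    have h6 : ∀ x ∈ corner (y n), x = 0 := fun x (hx : _ = _) => by rw [← hx, h0, zero_mul]
    rw [h6 a a.2, h6 b b.2])⟩)

/-- The underlying ring element of an element of a corner object. -/
def val {n : ℕ} : (cornerObj y hy hf).obj n →+ R n :=
  (corner (y n)).subtype.toAddMonoidHom

/-- An element of a corner object. -/
def elt {n : ℕ} (x : R n) (hx : y n * x = x) : (cornerObj y hy hf).obj n :=
  (⟨x, hx⟩ : corner (y n))

variable {y hy hf}

theorem val_elt {n : ℕ} (x : R n) (hx : y n * x = x) : val y hy hf (elt y hy hf x hx) = x := rfl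

theorem val_injective {n : ℕ} {a b : (cornerObj y hy hf).obj n}
    (h : val y hy hf a = val y hy hf b) : a = b :=
  Subtype.ext h

theorem mul_val {n : ℕ} (a : (cornerObj y hy hf).obj n) : y n * val y hy hf a = val y hy hf a :=
  a.2

theorem val_smul {n : ℕ} (r : R n) (a : (cornerObj y hy hf).obj n) :
    val y hy hf (op r • a) = val y hy hf a * r := rfl

variable (y hy hf) in
/-- The generator of a corner object. -/
def gen (n : ℕ) : (cornerObj y hy hf).obj n := elt y hy hf (y n) (congrFun hy n)

theorem op_smul_gen {n : ℕ} (a : (cornerObj y hy hf).obj n) :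
    op (val y hy hf a) • gen y hy hf n = a :=
  val_injective (mul_val a)

theorem app_eq_smul_gen (φ : cornerObj y hy hf ⟶ X) (n : ℕ) (a : (cornerObj y hy hf).obj n) :
    app φ n a = op (val y hy hf a) • app φ n (gen y hy hf n) := by
  rw [← map_smul, op_smul_gen]

/-- A corner object of a primitive idempotent has a local endomorphism ring. -/
theorem isLocalRing_end_cornerObj [∀ n, IsArtinianRing (R n)ᵐᵒᵖ] (hy0 : y ≠ 0)
    (h : ∀ z : ∀ n, R n, IsIdempotentElem z → y * z = z → z * y = z → z = 0 ∨ z = y) :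
    IsLocalRing (End (cornerObj y hy hf)) := by
  refine isLocalRing_end (fun h0 => hy0 ?_) fun e he => ?_
  · rw [isZero_iff] at h0
    funext n
    have := congrArg (val y hy hf) ((h0 n).elim (gen y hy hf n) 0)
    exact this
  -- An endomorphism of `y R` is left multiplication by the image `z ∈ y R y` of the generator, so
  -- idempotent endomorphisms correspond to idempotents below `y`.
  · let z : ∀ n, R n := fun n => val y hy hf (app e n (gen y hy hf n))
    have hez : ∀ n a, val y hy hf (app e n a) = z n * val y hy hf a := fun n a => by
      rw [app_eq_smul_gen, val_smul]
    have hee : ∀ n a, app e n (app e n a) = app e n a := fun n a => by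
      conv_rhs => rw [← he]
      rfl
    have hz : IsIdempotentElem z := funext fun n => by
      change z n * z n = z n
      conv_rhs => rw [show z n = val y hy hf (app e n (gen y hy hf n)) from rfl, ← hee]
      rw [hez]
    rcases h z hz (funext fun n => mul_val _) (funext fun n => (hez n (gen y hy hf n)).symm)
      with h0 | h1
    · left
      refine app_ext fun n a => val_injective ?_
      rw [hez, h0]
      exact zero_mul _
    · right
      refine app_ext fun n a => val_injective ?_
      rw [hez, h1, mul_val]; rfl

/-- The maps `x ↦ w c f(x)`. -/
def dyad {A M N : Type*} [Ring A] [AddCommGroup M] [Module Aᵐᵒᵖ M] [AddCommGroup N]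
    [Module Aᵐᵒᵖ N] (f : M →ₗ[Aᵐᵒᵖ] A) (w : N) : A →+ (M →ₗ[Aᵐᵒᵖ] N) where
  toFun c :=
    { toFun := fun x => op (c * f x) • w
      map_add' := fun x x' => by rw [map_add, mul_add, MulOpposite.op_add, add_smul]
      map_smul' := fun r x => by
        rw [map_smul, RingHom.id_apply, smul_smul]
        congr 1
        change op (c * (f x * unop r)) = _
        rw [← mul_assoc]; rfl }
  map_zero' := LinearMap.ext fun x => by
    change op (0 * f x) • w = 0
    rw [zero_mul, MulOpposite.op_zero, zero_smul]
  map_add' a b := LinearMap.ext fun x => by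
    change op ((a + b) * f x) • w = op (a * f x) • w + op (b * f x) • w
    rw [add_mul, MulOpposite.op_add, add_smul]

theorem dyad_apply {A M N : Type*} [Ring A] [AddCommGroup M] [Module Aᵐᵒᵖ M] [AddCommGroup N]
    [Module Aᵐᵒᵖ N] (f : M →ₗ[Aᵐᵒᵖ] A) (w : N) (c : A) (x : M) :
    dyad f w c x = op (c * f x) • w := rfl

/-- Dual basis lemma for finitely generated projective right modules, with the coefficient `c = 1`
of `dyad` kept visible so that it can later be expanded as a sum of products `a * y * b`. -/
theorem exists_sum_dyad_eq_id (A M : Type*) [Ring A] [AddCommGroup M] [Module Aᵐᵒᵖ M]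
    [Module.Finite Aᵐᵒᵖ M] [Module.Projective Aᵐᵒᵖ M] :
    ∃ (k : ℕ) (f : Fin k → (M →ₗ[Aᵐᵒᵖ] A)) (w : Fin k → M),
      ∑ i, dyad (f i) (w i) 1 = LinearMap.id := by
  obtain ⟨k, f, g, -, -, hfg⟩ := Module.Finite.exists_comp_eq_id_of_projective Aᵐᵒᵖ M
  refine ⟨k, fun i => (opRegularEquiv A).symm.toLinearMap ∘ₗ LinearMap.proj i ∘ₗ g,
    fun i => f (Pi.single i 1), LinearMap.ext fun x => ?_⟩
  rw [LinearMap.sum_apply, ← hfg, LinearMap.comp_apply]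
  conv_rhs => rw [LinearMap.pi_apply_eq_sum_univ f (g x)]
  refine Finset.sum_congr rfl fun i _ => ?_
  rw [dyad_apply, one_mul]
  change g x i • f (Pi.single i 1) = _
  congr 2
  funext j
  simp [Pi.single_apply, eq_comm]

open Classical in
/-- The morphism with a single nonzero component. -/
noncomputable def singleHom (n : ℕ) : (V.obj n →ₗ[(R n)ᵐᵒᵖ] W.obj n) →+ (V ⟶ W) where
  toFun f := mkHom (Pi.single n f)
  map_zero' := by rw [Pi.single_zero]; rfl
  map_add' f g := by rw [Pi.single_add]; rfl

theorem app_singleHom_same (n : ℕ) (f : V.obj n →ₗ[(R n)ᵐᵒᵖ] W.obj n) :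
    app (singleHom n f) n = f :=
  Pi.single_eq_same (M := fun n => V.obj n →ₗ[(R n)ᵐᵒᵖ] W.obj n) n f

theorem app_singleHom_ne {m n : ℕ} (h : m ≠ n) (f : V.obj n →ₗ[(R n)ᵐᵒᵖ] W.obj n) :
    app (singleHom n f) m = 0 :=
  Pi.single_eq_of_ne (M := fun n => V.obj n →ₗ[(R n)ᵐᵒᵖ] W.obj n) h f

theorem singleHom_comp {n : ℕ} (f : V.obj n →ₗ[(R n)ᵐᵒᵖ] W.obj n)
    (g : W.obj n →ₗ[(R n)ᵐᵒᵖ] X.obj n) :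
    singleHom n f ≫ singleHom n g = singleHom (V := V) (W := X) n (g ∘ₗ f) := by
  refine app_ext fun m x => ?_
  rw [app_comp]
  by_cases h : m = n
  · subst h
    rw [app_singleHom_same, app_singleHom_same, app_singleHom_same]; rfl
  · rw [app_singleHom_ne h, app_singleHom_ne h, app_singleHom_ne h]; rfl

theorem sum_singleHom_id (V : SumProj R) :
    ∑ n ∈ V.finite_support.toFinset, singleHom n LinearMap.id = 𝟙 V := by
  refine app_ext fun m x => ?_
  rw [app_sum]
  by_cases hm : m ∈ V.finite_support.toFinset
  · rw [Finset.sum_eq_single m]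
    · rw [app_singleHom_same]; rfl
    · intro n _ hn
      rw [app_singleHom_ne hn.symm]; rfl
    · exact fun h => absurd hm h
  · rw [Set.Finite.mem_toFinset, Set.mem_ofPred_eq, not_not] at hm
    exact Subsingleton.elim _ _

/-- Every indecomposable object is a corner object for a full system of idempotents. -/
theorem exists_iso_cornerObj {L : Type*} (y : L → ∀ n, R n) (hy : ∀ l, IsIdempotentElem (y l))
    (hf : ∀ l, {n | y l n ≠ 0}.Finite)
    (hloc : ∀ l, IsLocalRing (End (cornerObj (y l) (hy l) (hf l))))
    (hspan : ∀ n, (1 : R n) ∈ AddSubgroup.closure {x | ∃ l a b, x = a * y l n * b})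
    (V : SumProj R) [IsLocalRing (End V)] :
    ∃ l, Nonempty (V ≅ cornerObj (y l) (hy l) (hf l)) := by
  by_contra hno
  have hfac : ∀ (l) (g : V ⟶ cornerObj (y l) (hy l) (hf l)) (f : cornerObj (y l) (hy l) (hf l) ⟶ V),
      (g ≫ f : End V) ∈ nonunits (End V) := by
    intro l g f hu
    have := hloc l
    have : IsIso (g ≫ f) := (isUnit_iff_isIso _).1 hu
    have := (isIso_of_isIso_comp (not_isZero_of_isLocalRing V) g f this).1
    exact hno ⟨l, ⟨asIso g⟩⟩
  -- The identity of `V` is a sum of dyads with coefficient `1`, and `1` is a sum of terms `a * y l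
  -- n * b`, each of which factors the dyad through a corner object. If no factor were isomorphic to
  -- `V`, all summands would be nonunits of the local ring `End V`, and so would `𝟙 V`.
  let N : AddSubgroup (End V) :=
    { carrier := nonunits (End V)
      add_mem' := IsLocalRing.nonunits_add
      zero_mem' := not_isUnit_zero
      neg_mem' := fun {x} hx h => hx (by simpa using h.neg) }
  have hmem : ∀ (n : ℕ) (w : V.obj n) (f : V.obj n →ₗ[(R n)ᵐᵒᵖ] R n),
      (singleHom n (dyad f w 1) : End V) ∈ N := by
    intro n w f
    have h1 : (1 : R n) ∈ N.comap ((singleHom (V := V) (W := V) n).comp (dyad f w)) := by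
      refine (AddSubgroup.closure_le _).2 ?_ (hspan n)
      rintro _ ⟨l, a, b, rfl⟩
      let g : V.obj n →ₗ[(R n)ᵐᵒᵖ] (cornerObj (y l) (hy l) (hf l)).obj n :=
        toCorner (congrFun (hy l) n) ∘ₗ LinearMap.mulLeft (R n)ᵐᵒᵖ b ∘ₗ f
      let k : (cornerObj (y l) (hy l) (hf l)).obj n →ₗ[(R n)ᵐᵒᵖ] V.obj n :=
        dyad (corner (y l n)).subtype w a
      have hgk : dyad f w (a * y l n * b) = k ∘ₗ g := LinearMap.ext fun x => by
        change op (a * y l n * b * f x) • w = op (a * (y l n * (b * f x))) • w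
        simp only [mul_assoc]
      change singleHom n (dyad f w (a * y l n * b)) ∈ N
      rw [hgk, ← singleHom_comp]
      exact hfac l _ _
    exact h1
  have h1 : 𝟙 V ∈ N := by
    rw [← sum_singleHom_id]
    refine N.sum_mem fun n _ => ?_
    obtain ⟨k, f, w, h⟩ := exists_sum_dyad_eq_id (R n) (V.obj n)
    rw [← h, map_sum]
    exact N.sum_mem fun i _ => hmem n (w i) (f i)
  exact h1 isUnit_one

end Corner

section CornerAction

variable {G : Type w} [Group G] [RingActions G R]

open KSInterpolation.RingActions (ρ)
open KSInterpolation.StrictAction (T)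

/-- If a twist of one corner object is isomorphic to another, their idempotents generate related
ideals. -/
theorem exists_eq_of_iso_cornerObj {y y' : ∀ n, R n} {hy : IsIdempotentElem y} {hf}
    {hy' : IsIdempotentElem y'} {hf'} (g : G)
    (e : (T g).obj (cornerObj y hy hf) ≅ cornerObj y' hy' hf') (n : ℕ) :
    ∃ a b, y' n = a * ρ n g (y n) * b := by
  let b : (cornerObj y hy hf).obj n := app e.inv n (gen y' hy' hf' n)
  have hb : sapp e.hom n b = gen y' hy' hf' n := by
    have : app (e.inv ≫ e.hom) n (gen y' hy' hf' n) = gen y' hy' hf' n := by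
      rw [e.inv_hom_id, app_id]
    exact this
  -- The generator `y'` is the image of some `b = y b`; semilinearity of `e` writes it as `e(y)
  -- g(b)`, and `e(y) = e(y) g(y)`.
  refine ⟨val y' hy' hf' (sapp e.hom n (gen y hy hf n)), ρ n g (val y hy hf b), ?_⟩
  have hsm : ∀ r, val y' hy' hf' (sapp e.hom n (op r • gen y hy hf n)) =
      val y' hy' hf' (sapp e.hom n (gen y hy hf n)) * ρ n g r := fun r => by
    rw [sapp_smul, val_smul]
  have h1 := hsm (val y hy hf b)
  rw [op_smul_gen, hb] at h1
  have h2 := hsm (y n)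
  rw [show op (y n) • gen y hy hf n = gen y hy hf n from op_smul_gen (gen y hy hf n)] at h2
  rw [← h2, ← h1]
  rfl

/-- Semilinear actions on corner objects. -/
noncomputable def cornerAction {y : ∀ n, R n} {hy : IsIdempotentElem y} {hf} {H : Subgroup G}
    (v : H → ∀ n, R n) (hv : ∀ h n, v h n * ρ n (h : G) (y n) = y n * v h n)
    (h1 : ∀ n, v 1 n = 1) (hmul : ∀ h h' n, v (h * h') n = v h n * ρ n (h : G) (v h' n)) :
    SemiAction H (cornerObj y hy hf) where
  a h n :=
    -- The relation `v_h h(y) = y v_h` keeps the map inside `y R`; the cocycle identity makes it an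
    -- action.
    { toFun := fun x => elt y hy hf (v h n * ρ n (h : G) (val y hy hf x)) (by
        rw [← mul_assoc, ← hv, mul_assoc, ← map_mul, mul_val])
      map_zero' := val_injective (by rw [val_elt, map_zero, map_zero, mul_zero])
      map_add' := fun x x' => val_injective (by
        rw [val_elt, map_add, map_add, map_add, mul_add]; rfl) }
  a_smul h n r x := val_injective (by
    change v h n * ρ n (h : G) (val y hy hf (op r • x)) =
      v h n * ρ n (h : G) (val y hy hf x) * ρ n (h : G) r
    rw [val_smul, map_mul, mul_assoc])
  a_one n x := val_injective (by
    change v 1 n * ρ n ((1 : H) : G) (val y hy hf x) = _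
    rw [h1, one_mul, OneMemClass.coe_one, ρ_one])
  a_mul h h' n x := val_injective (by
    change v (h * h') n * ρ n ((h * h' : H) : G) (val y hy hf x) =
      v h n * ρ n (h : G) (v h' n * ρ n (h' : G) (val y hy hf x))
    rw [hmul, map_mul (ρ n (h : G)), ρ_ρ, mul_assoc]; rfl)

/-- Transport of a semilinear action along an isomorphism. -/
noncomputable def SemiAction.ofIso {H : Subgroup G} (e : V ≅ W) (a : SemiAction H W) :
    SemiAction H V :=
  have h1 : ∀ n x, app e.inv n (app e.hom n x) = x := fun n x => by
    rw [← app_comp, e.hom_inv_id, app_id]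
  have h2 : ∀ n x, app e.hom n (app e.inv n x) = x := fun n x => by
    rw [← app_comp, e.inv_hom_id, app_id]
  { a := fun h n => (app e.inv n).toAddMonoidHom.comp
      ((a.a h n).comp (app e.hom n).toAddMonoidHom)
    a_smul := fun h n r x => by
      change app e.inv n (a.a h n (app e.hom n _)) = _ • app e.inv n (a.a h n (app e.hom n _))
      rw [map_smul, a.a_smul, map_smul]
    a_one := fun n x => by
      change app e.inv n (a.a 1 n (app e.hom n _)) = _
      rw [a.a_one, h1]
    a_mul := fun h h' n x => by
      change app e.inv n (a.a (h * h') n (app e.hom n _)) =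
        app e.inv n (a.a h n (app e.hom n (app e.inv n (a.a h' n (app e.hom n _)))))
      rw [a.a_mul, h2] }

theorem isLocalRing_end_twist (g : G) (V : SumProj R) [IsLocalRing (End V)] :
    IsLocalRing (End ((T g).obj V)) := by
  let F : End V →+* End ((T g).obj V) :=
    { toFun := fun φ => (T g).map φ
      map_one' := (T g).map_id V
      map_mul' := fun φ ψ => (T g).map_comp ψ φ
      map_zero' := (T g).map_zero V V
      map_add' := fun φ ψ => (T g).map_add }
  have hinj : Function.Injective F := fun φ ψ h => app_ext fun n x =>
    congrArg (fun χ : End ((T g).obj V) => app χ n (toT g x)) h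
  have hsurj : Function.Surjective F := fun φ =>
    ⟨mkHom fun n =>
      { toFun := fun x => app φ n (toT g x)
        map_add' := fun x x' => map_add (app φ n) (toT g x) (toT g x')
        map_smul' := fun r x => by
          have := map_smul (app φ n) (op (ρ n g (unop r))) (toT g x)
          rw [← toT_smul] at this
          refine this.trans ?_
          change op (ρ n g⁻¹ (ρ n g (unop r))) • (show V.obj n from app φ n (toT g x)) = _
          rw [ρ_ρ, inv_mul_cancel, ρ_one]; rfl }, rfl⟩
  have : Nontrivial (End ((T g).obj V)) := hinj.nontrivial
  refine ⟨fun {a b} hab => ?_⟩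
  obtain ⟨a, rfl⟩ := hsurj a
  obtain ⟨b, rfl⟩ := hsurj b
  have hab' : F (a + b) = F 1 := (F.map_add a b).trans (hab.trans F.map_one.symm)
  exact (IsLocalRing.isUnit_or_isUnit_of_add_one (hinj hab')).imp
    (fun h => h.map F) fun h => h.map F

/-- The twists by elements of the stabilizer of the class. -/
theorem nonempty_iso_of_mem_stabilizer [∀ n, IsArtinianRing (R n)ᵐᵒᵖ] (V : SumProj R)
    [IsLocalRing (End V)] (g : G) (hg : g ∈ MulAction.stabilizer G (K0.cls V)) :
    Nonempty ((T g).obj V ≅ V) := by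
  have := isLocalRing_end_twist g V
  exact nonempty_iso_of_cls_eq ((K0.smul_cls G g V).symm.trans hg)

end CornerAction

end SumProj

end KSInterpolation

/-! ### The image of the forgetful map, given a suitable family of idempotents -/

namespace KSInterpolation

open MulOpposite (op unop)

theorem isLocalRing_end_of_indecomposable {C : Type u} [Category.{v} C] [Preadditive C]
    [HasBinaryBiproducts C] [IsKrullSchmidt C] {V : C} (hV : Indecomposable V) :
    IsLocalRing (End V) := by
  refine isLocalRing_end hV.1 fun e he => ?_
  obtain ⟨Y, Z, b, hb, ht, hY, hZ⟩ := exists_summands e he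
  subst hb
  exact (hV.2 Y Z (biprod.uniqueUpToIso Y Z (isBinaryBilimitOfTotal b ht))).imp hY hZ

namespace SumProj

variable {R : ℕ → Type w} [∀ n, Ring (R n)] [∀ n, IsArtinianRing (R n)ᵐᵒᵖ]
variable {G : Type w} [Group G] [Finite G] [RingActions G R]

open KSInterpolation.RingActions (ρ)
open KSInterpolation.StrictAction (T)

section

variable {L : Type*} (y : L → ∀ n, R n) (hy : ∀ l, IsIdempotentElem (y l))
  (hf : ∀ l, {n | y l n ≠ 0}.Finite)
  (hloc : ∀ l, IsLocalRing (End (cornerObj (y l) (hy l) (hf l))))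
  (hspan : ∀ n, (1 : R n) ∈ AddSubgroup.closure {x | ∃ l a b, x = a * y l n * b})
  (hact : ∀ l (H : Subgroup G),
    (∀ g ∈ H, ∀ n, ∃ a b, y l n = a * ρ n g (y l n) * b) →
    ∃ v : H → ∀ n, R n, (∀ h n, v h n * ρ n (h : G) (y l n) = y l n * v h n) ∧
      (∀ n, v 1 n = 1) ∧ ∀ h h' n, v (h * h') n = v h n * ρ n (h : G) (v h' n))

include hloc hspan hact

-- Elements of the stabilizer fix `V ≅ y R` only up to isomorphism, so they only relate the ideals
-- of `y` and `g(y)`. The hypothesis `hact` turns this relation into a strict cocycle, so no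
-- obstruction class arises.
omit [Finite G] in
theorem nonempty_semiAction (V : SumProj R) [IsLocalRing (End V)] :
    Nonempty (SemiAction (MulAction.stabilizer G (K0.cls V)) V) := by
  obtain ⟨l, ⟨e⟩⟩ := exists_iso_cornerObj y hy hf hloc hspan V
  obtain ⟨v, h1, h2, h3⟩ := hact l (MulAction.stabilizer G (K0.cls V)) fun g hg n => by
    obtain ⟨i⟩ := nonempty_iso_of_mem_stabilizer V g hg
    exact exists_eq_of_iso_cornerObj g ((T g).mapIso e.symm ≪≫ i ≪≫ e) n
  exact ⟨SemiAction.ofIso e (cornerAction v h1 h2 h3)⟩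

theorem exists_equivariant_of_isLocalRing (V : SumProj R) [IsLocalRing (End V)] :
    ∃ F : EquivariantObject G (SumProj R),
      (K0.cls F.X = ∑ᶠ x ∈ MulAction.orbit G (K0.cls V), x) ∧
      ∃ b : Bicone fun q : G ⧸ MulAction.stabilizer G (K0.cls V) => (T q.out).obj V,
        Nonempty b.IsBilimit ∧
        ∃ e : b.pt ≅ F.X, ∀ (g : G) (q q'), q' ≠ g • q →
          (T g).map (b.ι q ≫ e.hom) ≫ (F.α g).hom ≫ e.inv ≫ b.π q' = 0 := by
  obtain ⟨a⟩ := nonempty_semiAction y hy hf hloc hspan hact V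
  exact exists_equivariant_of_semiAction V a

/-- Classes of equivariant objects are invariant through the isomorphisms `α g`. Conversely `G`
permutes the basis of `K₀`, so the orbit sums span the invariants, and each of them is the class of
an equivariant object. -/
theorem range_map_forget :
    (K0.map (EquivariantObject.forget G (SumProj R))).range =
      FixedPoints.addSubgroup G (K0 (SumProj R)) := by
  refine le_antisymm ?_ fun x hx => ?_
  · rintro _ ⟨x, rfl⟩ g
    induction x using K0.induction_on with
    | h0 => rw [map_zero, smul_zero]
    | hc A =>
      rw [K0.map_cls, K0.smul_cls]
      exact K0.cls_eq_of_iso (A.α g)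
    | hn x hx => rw [map_neg, smul_neg, hx]
    | ha x y hx hy => rw [map_add, smul_add, hx, hy]
  · refine mem_of_fixed_of_orbit_sum_mem (localBasis (SumProj R)) localBasis_apply ?_ _ ?_ x hx
    · rintro g _ ⟨V, hV, rfl⟩
      exact ⟨_, isLocalRing_end_twist g V, K0.smul_cls G g V⟩
    · rintro _ ⟨V, hV, rfl⟩
      obtain ⟨F, hF, -⟩ := exists_equivariant_of_isLocalRing y hy hf hloc hspan hact V
      exact ⟨K0.cls F, hF⟩

end

end SumProj

end KSInterpolation

namespace KSInterpolation

/-! ### Primitive idempotents of finite-dimensional algebras -/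

/-- The two-sided ideal generated by a set. -/
def twoSided {R : Type*} [Ring R] (S : Set R) : AddSubgroup R :=
  AddSubgroup.closure {x | ∃ s ∈ S, ∃ a b, x = a * s * b}

section TwoSided

variable {R : Type*} [Ring R] {S T : Set R}

theorem mul_mul_mem_twoSided {s : R} (hs : s ∈ S) (a b : R) : a * s * b ∈ twoSided S :=
  AddSubgroup.subset_closure ⟨s, hs, a, b, rfl⟩

theorem twoSided_mul_mem {x : R} (hx : x ∈ twoSided S) (a b : R) : a * x * b ∈ twoSided S := by
  have : twoSided S ≤
      (twoSided S).comap ((AddMonoidHom.mulRight b).comp (AddMonoidHom.mulLeft a)) := by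
    refine (AddSubgroup.closure_le _).2 ?_
    rintro _ ⟨s, hs, c, d, rfl⟩
    change a * (c * s * d) * b ∈ twoSided S
    rw [show a * (c * s * d) * b = a * c * s * (d * b) by simp only [mul_assoc]]
    exact mul_mul_mem_twoSided hs _ _
  exact this hx

theorem mem_twoSided {s : R} (hs : s ∈ S) : s ∈ twoSided S := by
  simpa using mul_mul_mem_twoSided hs 1 1

theorem twoSided_le (h : ∀ s ∈ S, s ∈ twoSided T) : twoSided S ≤ twoSided T := by
  refine (AddSubgroup.closure_le _).2 ?_
  rintro _ ⟨s, hs, a, b, rfl⟩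
  exact twoSided_mul_mem (h s hs) a b

/-- If every `s ∈ S` killed the submodule generated by `x`, so would the whole two-sided ideal,
which contains `1`. It serves to find a primitive idempotent acting nontrivially on a given module.
-/
theorem exists_mul_smul_ne_zero {M : Type*} [AddCommGroup M] [Module R M]
    (h : (1 : R) ∈ twoSided S) {x : M} (hx : x ≠ 0) : ∃ s ∈ S, ∃ a : R, s • a • x ≠ 0 := by
  by_contra! hno
  have : twoSided S ≤ ((smulAddHom R M).flip x).ker := by
    refine (AddSubgroup.closure_le _).2 ?_
    rintro _ ⟨s, hs, a, b, rfl⟩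
    change (a * s * b) • x = 0
    rw [mul_smul, mul_smul, hno s hs, smul_zero]
  exact hx ((one_smul R x).symm.trans (this h))

end TwoSided

/-- Primitive idempotents. -/
structure IsPrimitiveIdem {R : Type*} [Ring R] (f : R) : Prop where
  ne_zero : f ≠ 0
  idem : f * f = f
  eq_zero_or_eq : ∀ z, z * z = z → f * z = z → z * f = z → z = 0 ∨ z = f

/-- Idempotents `f` with `f R f = F f` modulo the radical. -/
structure IsSplitIdem (F : Type*) {R : Type*} [Field F] [Ring R] [Algebra F R] (f : R) : Prop where
  ne_zero : f ≠ 0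
  idem : f * f = f
  split : ∀ x, ∃ c : F, f * x * f - c • f ∈ Ring.jacobson R

theorem isUnit_one_add_of_mem_jacobson {R : Type*} [Ring R] [IsArtinianRing R] {x : R}
    (hx : x ∈ Ring.jacobson R) : IsUnit (1 + x) := by
  obtain ⟨N, hN⟩ := IsSemiprimaryRing.isNilpotent (R := R)
  have : IsNilpotent x := ⟨N, by
    have := Ideal.pow_mem_pow hx N
    rw [hN] at this
    exact this⟩
  exact this.isUnit_one_add

theorem eq_zero_of_idem_of_mem_jacobson {R : Type*} [Ring R] [IsArtinianRing R] {x : R}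
    (hx : x ∈ Ring.jacobson R) (hi : x * x = x) : x = 0 := by
  have h := isUnit_one_add_of_mem_jacobson ((Ring.jacobson R).neg_mem hx)
  refine h.mul_right_cancel ?_
  rw [mul_add, mul_one, mul_neg, hi, zero_mul, add_neg_cancel]

theorem mem_jacobson_of_isNilpotent {R : Type*} [Ring R] {y : R}
    (h : ∀ r, IsNilpotent (r * y)) : y ∈ Ring.jacobson R := by
  rw [← Ideal.jacobson_bot, Ideal.mem_jacobson_iff]
  intro r
  obtain ⟨z, hz⟩ := (h r).isUnit_one_add.exists_left_inv
  refine ⟨z, ?_⟩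
  rw [Ideal.mem_bot, ← hz]
  noncomm_ring

section

variable {F R : Type*} [Field F] [Ring R] [Algebra F R]

theorem IsSplitIdem.notMem [IsArtinianRing R] {f : R} (hf : IsSplitIdem F f) :
    f ∉ Ring.jacobson R :=
  fun h => hf.ne_zero (eq_zero_of_idem_of_mem_jacobson h hf.idem)

/-- An idempotent `z` below `f` is `c • f` modulo the radical with `c ^ 2 = c`, so `z` or `f - z` is
an idempotent in the nilpotent radical. Unlike primitivity, the split condition survives tensor
products and field extensions. -/
theorem IsSplitIdem.isPrimitiveIdem [IsArtinianRing R] {f : R} (hf : IsSplitIdem F f) :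
    IsPrimitiveIdem f := by
  refine ⟨hf.ne_zero, hf.idem, fun z hz h1 h2 => ?_⟩
  obtain ⟨c, hc⟩ := hf.split z
  rw [h1, h2] at hc
  have hcc : c * (c - 1) = 0 := by
    by_contra hne
    refine hf.notMem ?_
    have h3 : (c • f - (c * c) • f) ∈ Ring.jacobson R := by
      have e : c • f - (c * c) • f = (z - c • f) * z + (c • f) * (z - c • f) - (z - c • f) := by
        simp only [sub_mul, mul_sub, hz, smul_mul_assoc, mul_smul_comm, h1, hf.idem, mul_smul]
        abel
      rw [e]
      exact (Ring.jacobson R).sub_mem ((Ring.jacobson R).add_mem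
        (Ideal.IsTwoSided.mul_mem_of_left _ hc) ((Ring.jacobson R).mul_mem_left _ hc)) hc
    have h4 := (Ring.jacobson R).mul_mem_left (algebraMap F R (-(c * (c - 1))⁻¹)) h3
    rw [← Algebra.smul_def, ← sub_smul, smul_smul,
      show -(c * (c - 1))⁻¹ * (c - c * c) = (c * (c - 1))⁻¹ * (c * (c - 1)) by ring,
      inv_mul_cancel₀ hne, one_smul] at h4
    exact h4
  rcases mul_eq_zero.1 hcc with h0 | h0
  · left
    rw [h0, zero_smul, sub_zero] at hc
    exact eq_zero_of_idem_of_mem_jacobson hc hz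
  · right
    rw [sub_eq_zero.1 h0, one_smul, ← neg_mem_iff, neg_sub] at hc
    exact (sub_eq_zero.1 (eq_zero_of_idem_of_mem_jacobson hc (by
      simp only [sub_mul, mul_sub, hz, h1, h2, hf.idem]; abel))).symm

/-- If the scalar `c` of `f * x * f` is nonzero, then `f * x * f = c f (1 + j)` with `j` in the
radical, and `1 + j` is a unit. -/
theorem IsSplitIdem.mem_or_exists_inv [IsArtinianRing R] {f : R} (hf : IsSplitIdem F f) (x : R) :
    f * x * f ∈ Ring.jacobson R ∨ ∃ d, f * x * f * d = f := by
  obtain ⟨c, hc⟩ := hf.split x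
  rcases eq_or_ne c 0 with rfl | h0
  · left
    simpa using hc
  · right
    set j := f * x * f - c • f with hj
    have hfj : f * j = j := by
      rw [hj, mul_sub, mul_smul_comm, hf.idem, ← mul_assoc, ← mul_assoc, hf.idem]
    have h1 : c⁻¹ • j ∈ Ring.jacobson R := by
      rw [Algebra.smul_def]
      exact (Ring.jacobson R).mul_mem_left _ hc
    obtain ⟨w, hw⟩ := (isUnit_one_add_of_mem_jacobson h1).exists_right_inv
    refine ⟨c⁻¹ • w, ?_⟩
    have : f * x * f = c • (f * (1 + c⁻¹ • j)) := by
      rw [mul_add, mul_smul_comm, hfj, smul_add, smul_inv_smul₀ h0, hj]; simp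
    rw [this, smul_mul_smul_comm, mul_inv_cancel₀ h0, one_smul, mul_assoc, hw, mul_one]

theorem mul_mul_mem_of_mem_twoSided {R : Type*} [Ring R] {f g : R} (J : Ideal R)
    (h : ∀ a b, f * (a * g * b) * f ∈ J) {x : R} (hx : x ∈ twoSided {g}) : f * x * f ∈ J := by
  have : twoSided {g} ≤ J.toAddSubgroup.comap
      ((AddMonoidHom.mulRight f).comp (AddMonoidHom.mulLeft f)) := by
    refine (AddSubgroup.closure_le _).2 ?_
    rintro _ ⟨_, rfl, a, b, rfl⟩
    exact h a b
  exact this hx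

/-- Since `f` is not in the radical, some `f a g b f` is invertible in the corner of `f`. This gives
`p` and `q` with `p q = f`; then `q p` is a nonzero idempotent below the primitive `g`, so `g = q p
= q f p`. -/
theorem mem_twoSided_symm [IsArtinianRing R] {f g : R} (hf : IsSplitIdem F f)
    (hg : IsPrimitiveIdem g) (h : f ∈ twoSided {g}) : g ∈ twoSided {f} := by
  by_cases hall : ∀ a b, f * (a * g * b) * f ∈ Ring.jacobson R
  · have h1 := mul_mul_mem_of_mem_twoSided _ hall h
    rw [hf.idem, hf.idem] at h1
    exact absurd h1 hf.notMem
  · push Not at hall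
    obtain ⟨a, b, hab⟩ := hall
    obtain ⟨d, hd⟩ := (hf.mem_or_exists_inv _).resolve_left hab
    set p := f * a * g with hp
    set q := g * b * f * d with hq
    have hpq : p * q = f := by
      rw [← hd, hp, hq, ← mul_assoc, ← mul_assoc, ← mul_assoc, mul_assoc (f * a) g g, hg.idem]
      simp only [mul_assoc]
    have hfp : f * p = p := by rw [hp, ← mul_assoc, ← mul_assoc, hf.idem]
    have hpg : p * g = p := by rw [hp, mul_assoc, hg.idem]
    have hgq : g * q = q := by
      rw [hq, ← mul_assoc, ← mul_assoc, ← mul_assoc, hg.idem]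
    have hqp : q * p = g := by
      refine (hg.eq_zero_or_eq (q * p) ?_ ?_ ?_).resolve_left fun h0 => hf.ne_zero ?_
      · rw [mul_assoc, ← mul_assoc p, hpq, hfp]
      · rw [← mul_assoc, hgq]
      · rw [mul_assoc, hpg]
      · rw [← hf.idem, ← hpq, mul_assoc, ← mul_assoc q, h0, zero_mul, mul_zero]
    have hmem : q * f * p ∈ twoSided {f} := mul_mul_mem_twoSided (Set.mem_singleton f) q p
    rwa [mul_assoc, hfp, hqp] at hmem

variable [FiniteDimensional F R]

/-- Fitting's lemma for `R` as a right module over itself, whose endomorphism ring is `R`. -/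
theorem exists_isDrazin_of_finiteDimensional (F : Type*) {R : Type*} [Field F] [Ring R] [Algebra F R]
    [FiniteDimensional F R] (x : R) : ∃ d, IsDrazin x d := by
  have h1 : IsArtinian Rᵐᵒᵖ R := isArtinian_of_tower F inferInstance
  have h2 : IsNoetherian Rᵐᵒᵖ R := isNoetherian_of_tower F inferInstance
  obtain ⟨d, hd⟩ := exists_isDrazin_moduleEnd (RingEquiv.moduleEndSelfOp R x)
  have := hd.map (RingEquiv.moduleEndSelfOp R).symm
  rw [RingEquiv.symm_apply_apply] at this
  exact ⟨_, this⟩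

theorem IsPrimitiveIdem.isNilpotent_or_exists_inv (F : Type*) {R : Type*} [Field F] [Ring R] [Algebra F R]
    [FiniteDimensional F R] {f x : R} (hf : IsPrimitiveIdem f)
    (h1 : f * x = x) (h2 : x * f = x) : IsNilpotent x ∨ ∃ d, d * x = f := by
  obtain ⟨d, hd⟩ := exists_isDrazin_of_finiteDimensional F x
  rcases hf.eq_zero_or_eq (x * d) (by rw [mul_assoc, ← mul_assoc d, hd.idem])
    (by rw [← mul_assoc, h1]) (by rw [hd.comm, mul_assoc, h2]) with h | h
  · left
    obtain ⟨N, hN⟩ := hd.exists_pow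
    exact ⟨N, by rw [← hN, pow_succ, mul_assoc, h, mul_zero]⟩
  · right
    exact ⟨d, by rw [← hd.comm, h]⟩

/-- An idempotent `e` that is not primitive splits as `z + (e - z)`, and both right ideals are
strictly smaller than `e R`; the induction is on the dimension of `e R`. -/
theorem one_mem_twoSided_isPrimitiveIdem (F : Type*) {R : Type*} [Field F] [Ring R] [Algebra F R]
    [FiniteDimensional F R] : (1 : R) ∈ twoSided {f : R | IsPrimitiveIdem f} := by
  suffices ∀ (n : ℕ) (e : R), e * e = e →
      Module.finrank F (LinearMap.range (LinearMap.mulLeft F e)) = n →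
      e ∈ twoSided {f : R | IsPrimitiveIdem f} from this _ 1 (mul_one 1) rfl
  intro n
  induction n using Nat.strong_induction_on with
  | _ n ih =>
    intro e he hn
    by_cases h0 : e = 0
    · rw [h0]; exact zero_mem _
    by_cases hp : IsPrimitiveIdem e
    · exact mem_twoSided hp
    obtain ⟨z, hz, h1, h2, hz0, hze⟩ : ∃ z, z * z = z ∧ e * z = z ∧ z * e = z ∧ z ≠ 0 ∧ z ≠ e := by
      by_contra! hno
      exact hp ⟨h0, he, fun z a b c => or_iff_not_imp_left.2 fun d => hno z a b c d⟩
    have hlt : ∀ z, z * z = z → e * z = z → z * e = z → z ≠ e →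
        Module.finrank F (LinearMap.range (LinearMap.mulLeft F z)) < n := by
      intro z hz h1 h2 hze
      rw [← hn]
      refine Submodule.finrank_lt_finrank_of_lt (lt_of_le_of_ne ?_ fun heq => hze ?_)
      · rintro _ ⟨x, rfl⟩
        exact ⟨z * x, by simp [← mul_assoc, h1]⟩
      · have : e ∈ LinearMap.range (LinearMap.mulLeft F z) := by
          rw [heq]; exact ⟨e, he⟩
        obtain ⟨x, hx⟩ := this
        rw [LinearMap.mulLeft_apply] at hx
        rw [← h2, ← hx, ← mul_assoc, hz]
    have h3 : (e - z) * (e - z) = e - z := by rw [sub_mul, mul_sub, mul_sub, he, hz, h1, h2]; abel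
    have := add_mem (ih _ (hlt z hz h1 h2 hze) z hz rfl)
      (ih _ (hlt (e - z) h3 (by rw [mul_sub, he, h1]) (by rw [sub_mul, he, h2])
        fun h => hz0 (by simpa using h)) (e - z) h3 rfl)
    rwa [add_sub_cancel] at this

/-- A primitive idempotent that acts nontrivially on an absolutely simple module is split. -/
theorem IsPrimitiveIdem.isSplitIdem_of_simple {f : R} (hf : IsPrimitiveIdem f) (U : Type*)
    [AddCommGroup U] [Module R U] [Module F U] [IsScalarTower F R U] [IsSimpleModule R U]
    (hU : ∀ φ : Module.End R U, ∃ c : F, ∀ u, φ u = c • u) (u₀ : U) (hu₀ : f • u₀ ≠ 0) :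
    IsSplitIdem F f := by
  have hcomm : SMulCommClass F R U := ⟨fun c r u => by
    rw [← algebraMap_smul R c, ← algebraMap_smul R c, ← mul_smul, ← mul_smul,
      Algebra.commutes]⟩
  have hann : ∀ {x : R}, x * f = x → x • f • u₀ = 0 → f * x = x → IsNilpotent x := by
    intro x hx h0 h1
    refine (IsPrimitiveIdem.isNilpotent_or_exists_inv F hf h1 hx).resolve_right ?_
    rintro ⟨d, hd⟩
    refine hu₀ ?_
    rw [← hd, mul_smul, ← hx, mul_smul, h0, smul_zero]
  have hff : f • f • u₀ = f • u₀ := by rw [← mul_smul, hf.idem]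
  -- The space `f U` is a line. Otherwise, since `End U` consists of scalars, the density theorem
  -- gives `r` fixing `f u₀` and killing an independent vector of `f U`; then `f r f` is neither
  -- nilpotent nor invertible in the corner of the primitive idempotent `f`.
  have key : ∀ x : R, ∃ c : F, (f * x) • f • u₀ = c • f • u₀ := by
    intro x
    by_contra! hno
    have hli : LinearIndependent F ![f • u₀, (f * x) • f • u₀] := by
      rw [LinearIndependent.pair_iff' hu₀]
      exact fun c h => hno c h.symm
    obtain ⟨φ, hφ1, hφ2⟩ : ∃ φ : U →ₗ[F] U, φ (f • u₀) = f • u₀ ∧ φ ((f * x) • f • u₀) = 0 := by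
      let b := Module.Basis.span hli
      obtain ⟨q, hq⟩ := LinearMap.exists_extend (b.constr F ![f • u₀, (0 : U)])
      have hb : ∀ i, q (![f • u₀, (f * x) • f • u₀] i) = ![f • u₀, (0 : U)] i := by
        intro i
        have := LinearMap.congr_fun hq (b i)
        rw [Module.Basis.constr_basis] at this
        rw [← this]
        simp [b, Module.Basis.span_apply]
      exact ⟨q, hb 0, hb 1⟩
    let φ' : Module.End (Module.End R U) U :=
      { toFun := φ
        map_add' := map_add φ
        map_smul' := fun e u => by
          obtain ⟨c, hc⟩ := hU e
          change φ (e u) = e (φ u)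
          rw [hc, hc, map_smul] }
    classical
    obtain ⟨r, hr⟩ := jacobson_density φ' {f • u₀, (f * x) • f • u₀}
    have h1 : r • f • u₀ = f • u₀ := by rw [← hr _ (by simp)]; exact hφ1
    have h2 : r • (f * x) • f • u₀ = 0 := by rw [← hr _ (by simp)]; exact hφ2
    have hfv : f • (f * x) • f • u₀ = (f * x) • f • u₀ := by
      rw [← mul_smul f (f * x), ← mul_assoc, hf.idem]
    have hv : (f * x) • f • u₀ ≠ 0 := fun h => hno 0 (by rw [h, zero_smul])
    rcases IsPrimitiveIdem.isNilpotent_or_exists_inv F hf (x := f * r * f)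
      (by rw [← mul_assoc, ← mul_assoc, hf.idem]) (by rw [mul_assoc, hf.idem]) with ⟨N, hN⟩ | ⟨d, hd⟩
    · have h3 : ∀ N, (f * r * f) ^ N • f • u₀ = f • u₀ := by
        intro N
        induction N with
        | zero => rw [pow_zero, one_smul]
        | succ N ih => rw [pow_succ, mul_smul, mul_smul, mul_smul, hff, h1, hff, ih]
      have := h3 N
      rw [hN, zero_smul] at this
      exact hu₀ this.symm
    · refine hv ?_
      rw [← hfv]
      generalize (f * x) • f • u₀ = v at *
      rw [← hd, mul_smul, mul_smul, mul_smul, hfv, h2, smul_zero, smul_zero]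
  refine ⟨hf.ne_zero, hf.idem, fun x => ?_⟩
  obtain ⟨c, hc⟩ := key x
  refine ⟨c, mem_jacobson_of_isNilpotent fun r => ?_⟩
  set y := f * x * f - c • f with hy
  have hyf : y * f = y := by rw [hy, sub_mul, mul_assoc, hf.idem, smul_mul_assoc, hf.idem]
  have hyu : y • f • u₀ = 0 := by
    rw [hy, sub_smul, mul_smul, hff, hc, smul_assoc, hff, sub_self]
  obtain ⟨N, hN⟩ : IsNilpotent (f * r * y) :=
    hann (by rw [mul_assoc, hyf]) (by rw [mul_smul, hyu, smul_zero])
      (by rw [← mul_assoc, ← mul_assoc, hf.idem])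
  -- Since `y f = y`, the power `(r y)^(N+1)` equals `r y (f r y)^N`, so nilpotency of `f r y`,
  -- which kills `f u₀`, passes to `r y`.
  have hsc : SemiconjBy (r * y) (f * r * y) (r * y) := by
    change r * y * (f * r * y) = r * y * (r * y)
    rw [show r * y * (f * r * y) = r * (y * f) * (r * y) by simp only [mul_assoc], hyf]
  refine ⟨N + 1, ?_⟩
  rw [pow_succ, ← (hsc.pow_right N).eq, hN, mul_zero]

variable (F) in
/-- Representatives of the two-sided ideals generated by primitive idempotents. -/
theorem exists_labels (h : ∀ f : R, IsPrimitiveIdem f → IsSplitIdem F f) :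
    ∃ S : Set R, (∀ f ∈ S, IsSplitIdem F f) ∧ (∀ f ∈ S, ∀ g ∈ S, f ∈ twoSided {g} → f = g) ∧
      (1 : R) ∈ twoSided S := by
  have : IsArtinianRing R := isArtinian_of_tower F inferInstance
  let r : Setoid {f : R // IsPrimitiveIdem f} :=
    { r := fun f g => f.1 ∈ twoSided {g.1}
      iseqv :=
        { refl := fun f => mem_twoSided rfl
          symm := fun {f g} hfg => mem_twoSided_symm (h f f.2) g.2 hfg
          trans := fun {f g k} h1 h2 => twoSided_le (by rintro _ rfl; exact h2) h1 } }
  refine ⟨Set.range fun q : Quotient r => q.out.1, ?_, ?_, ?_⟩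
  · rintro _ ⟨q, rfl⟩
    exact h _ q.out.2
  · rintro _ ⟨q, rfl⟩ _ ⟨q', rfl⟩ hq
    have : q.out ≈ q'.out := hq
    rw [Quotient.out_equiv_out] at this
    rw [this]
  · refine twoSided_le (fun f hf => ?_) (one_mem_twoSided_isPrimitiveIdem F (R := R))
    have h1 : (⟨f, hf⟩ : {f : R // IsPrimitiveIdem f}) ≈ (Quotient.mk r ⟨f, hf⟩).out :=
      Setoid.symm (Quotient.mk_out (s := r) ⟨f, hf⟩)
    have h2 : f ∈ twoSided {(Quotient.mk r ⟨f, hf⟩).out.1} := h1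
    exact twoSided_le (by rintro _ rfl; exact mem_twoSided ⟨_, rfl⟩) h2

end

end KSInterpolation

namespace KSInterpolation

/-! ### Conjugate powers of permutations -/

/-- Choose a base point `r` in each cycle and let `τ` send `σ^j r` to `σ^(s j) r`; an inverse `t` of
`s` modulo the order gives the inverse of `τ`. Taking `a` as base point of its own cycle makes `τ`
fix `a`, which the branching argument requires. -/
theorem exists_perm_conj_eq_zpow {X : Type*} (σ : Equiv.Perm X) (s : ℤ)
    (hs : IsCoprime s (orderOf σ : ℤ)) (a : X) :
    ∃ τ : Equiv.Perm X, τ a = a ∧ τ * σ * τ⁻¹ = σ ^ s := by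
  classical
  obtain ⟨t, n, htn⟩ := hs
  let S : Setoid X := Equiv.Perm.SameCycle.setoid σ
  let rep : X → X := fun x => if σ.SameCycle a x then a else (Quotient.mk S x).out
  have hrep : ∀ x, σ.SameCycle (rep x) x := by
    intro x
    by_cases h : σ.SameCycle a x
    · simp only [rep, if_pos h, h]
    · simp only [rep, if_neg h]
      exact Quotient.mk_out (s := S) x
  have hrep' : ∀ x y, σ.SameCycle x y → rep x = rep y := by
    intro x y h
    have h1 : σ.SameCycle a x ↔ σ.SameCycle a y := ⟨fun h' => h'.trans h, fun h' => h'.trans h.symm⟩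
    have h2 : Quotient.mk S x = Quotient.mk S y := Quotient.sound h
    simp only [rep, h1, h2]
  choose i hi using hrep
  have hW : ∀ (c j j' : ℤ) (r : X), (σ ^ j) r = (σ ^ j') r → (σ ^ (c * j)) r = (σ ^ (c * j')) r := by
    intro c j j' r h
    have h1 : (σ ^ (j - j')) r = r := by
      have := congrArg (σ ^ (-j')) h
      rwa [← Equiv.Perm.mul_apply, ← Equiv.Perm.mul_apply, ← zpow_add, ← zpow_add, neg_add_cancel,
        zpow_zero, Equiv.Perm.one_apply, neg_add_eq_sub] at this
    have h2 : (σ ^ ((j - j') * c)) r = r := by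
      rw [zpow_mul]
      exact Equiv.Perm.zpow_apply_eq_self_of_apply_eq_self h1 c
    rw [show c * j = c * j' + (j - j') * c by ring, zpow_add, Equiv.Perm.mul_apply, h2]
  have hsc : ∀ (j : ℤ) x, σ.SameCycle x ((σ ^ j) x) := fun j x => ⟨j, rfl⟩
  have hone : ∀ (j : ℤ), σ ^ (t * s * j) = σ ^ j := by
    intro j
    have h1 : σ ^ ((orderOf σ : ℤ) * (n * j)) = 1 := by
      rw [zpow_mul, zpow_natCast, pow_orderOf_eq_one, one_zpow]
    have h2 : j = t * s * j + (orderOf σ : ℤ) * (n * j) := by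
      linear_combination (-j) * htn
    conv_rhs => rw [h2]
    rw [zpow_add, h1, mul_one]
  have hf : ∀ (c j : ℤ) x, (σ ^ (c * i ((σ ^ j) (rep x)))) (rep ((σ ^ j) (rep x))) =
      (σ ^ (c * j)) (rep x) := by
    intro c j x
    have hr : rep ((σ ^ j) (rep x)) = rep x :=
      (hrep' _ _ (hsc j (rep x))).symm.trans (hrep' _ _ ⟨i x, hi x⟩)
    rw [hr]
    refine hW c _ _ _ ?_
    have := hi ((σ ^ j) (rep x))
    rwa [hr] at this
  let τ : Equiv.Perm X :=
    { toFun := fun x => (σ ^ (s * i x)) (rep x)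
      invFun := fun x => (σ ^ (t * i x)) (rep x)
      left_inv := fun x => by
        change (σ ^ (t * i ((σ ^ (s * i x)) (rep x)))) (rep ((σ ^ (s * i x)) (rep x))) = x
        rw [hf, ← mul_assoc, hone, hi]
      right_inv := fun x => by
        change (σ ^ (s * i ((σ ^ (t * i x)) (rep x)))) (rep ((σ ^ (t * i x)) (rep x))) = x
        rw [hf, ← mul_assoc, mul_comm s t, hone, hi] }
  have hτ : ∀ (j : ℤ) x, τ ((σ ^ j) (rep x)) = (σ ^ (s * j)) (rep x) := fun j x => hf s j x
  refine ⟨τ, ?_, ?_⟩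
  · have hra : rep a = a := if_pos (Equiv.Perm.SameCycle.refl σ a)
    have := hτ 0 a
    rwa [zpow_zero, mul_zero, zpow_zero, Equiv.Perm.one_apply, hra] at this
  · rw [mul_inv_eq_iff_eq_mul]
    ext x
    change τ (σ x) = (σ ^ s) (τ x)
    have h1 : σ x = (σ ^ (1 + i x)) (rep x) := by rw [zpow_one_add, Equiv.Perm.mul_apply, hi]
    conv_rhs => rw [← hi x]
    rw [h1, hτ, hτ, ← Equiv.Perm.mul_apply, ← zpow_add]
    ring_nf

/-! ### Traces of representations -/

/-- The characteristic polynomial of `M ^ p` is that of `M` with Frobenius applied to its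
coefficients: after substituting `X ^ p`, both become `det (X - M) ^ p`, because `X ^ p - M ^ p = (X
- M) ^ p`. -/
theorem Matrix.trace_pow_char {E n : Type*} [Field E] [Fintype n] [DecidableEq n] (p : ℕ)
    [Fact p.Prime] [CharP E p] (M : Matrix n n E) : (M ^ p).trace = M.trace ^ p := by
  cases isEmpty_or_nonempty n
  · simp [Matrix.trace, (Fact.out : p.Prime).ne_zero]
  have key : (M ^ p).charpoly = M.charpoly.map (frobenius E p) := by
    have hp : 0 < p := (Fact.out : p.Prime).pos
    refine Polynomial.expand_injective hp ?_
    have h1 : expand E p (M.charpoly.map (frobenius E p)) = M.charpoly ^ p := by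
      rw [← Polynomial.map_expand, Polynomial.map_frobenius_expand]
    rw [h1]
    unfold Matrix.charpoly
    change (expand E p : E[X] →+* E[X]) _ = _
    rw [RingHom.map_det, ← Matrix.coe_detMonoidHom,
      ← (Matrix.detMonoidHom : Matrix n n E[X] →* E[X]).map_pow]
    refine congrArg _ (matPolyEquiv.injective ?_)
    rw [map_pow, Matrix.matPolyEquiv_charmatrix, sub_pow_char_of_commute, ← C_pow]
    · exact (matPolyEquiv_eq_X_pow_sub_C p M :)
    · exact (C M).commute_X
  rw [Matrix.trace_eq_neg_charpoly_coeff, Matrix.trace_eq_neg_charpoly_coeff, key,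
    Polynomial.coeff_map, frobenius_def, neg_pow]
  rcases (Fact.out : p.Prime).eq_two_or_odd' with rfl | h
  · rw [CharTwo.neg_eq]; simp
  · rw [h.neg_one_pow]; simp

/-- Groups in which every element is conjugate to its powers of the same order. -/
def HasConjPowers (G : Type*) [Group G] : Prop :=
  ∀ (σ : G) (s : ℕ), s.Coprime (orderOf σ) → ∃ τ, τ * σ * τ⁻¹ = σ ^ s

theorem hasConjPowers_perm (X : Type*) : HasConjPowers (Equiv.Perm X) := by
  intro σ s hs
  cases isEmpty_or_nonempty X
  · exact ⟨1, Subsingleton.elim _ _⟩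
  · obtain ⟨τ, -, h⟩ := exists_perm_conj_eq_zpow σ s (Nat.isCoprime_iff_coprime.2 hs)
      (Classical.arbitrary X)
    exact ⟨τ, by rw [h, zpow_natCast]⟩

section Trace

variable {E U G : Type*} [Field E] [AddCommGroup U] [Module E U] [FiniteDimensional E U] [Group G]
  (ρ : G →* Module.End E U)

omit [FiniteDimensional E U] in
theorem trace_conj_eq {σ τ σ' : G} (h : τ * σ * τ⁻¹ = σ') :
    LinearMap.trace E U (ρ σ') = LinearMap.trace E U (ρ σ) := by
  rw [← h, ρ.map_mul, ρ.map_mul, LinearMap.trace_mul_cycle, ← map_mul, inv_mul_cancel, map_one,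
    one_mul]

theorem trace_pow_char (p : ℕ) [Fact p.Prime] [CharP E p] (f : Module.End E U) :
    LinearMap.trace E U (f ^ p) = LinearMap.trace E U f ^ p := by
  classical
  let b := Module.Free.chooseBasis E U
  rw [LinearMap.trace_eq_matrix_trace E b, LinearMap.trace_eq_matrix_trace E b,
    ← Matrix.trace_pow_char, ← LinearMap.toMatrix_pow]

/-- If `p ^ k` is the `p`-part of the order of `σ`, then `σ ^ p ^ k` has order prime to `p`, so it
is conjugate to its `p`-th power. With `x` the trace of `σ` this reads `x ^ p ^ (k+1) = x ^ p ^ k`,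
and Frobenius is injective. -/
theorem trace_pow_eq_self [Finite G] (hG : HasConjPowers G) (p : ℕ) [Fact p.Prime] [CharP E p]
    (σ : G) : LinearMap.trace E U (ρ σ) ^ p = LinearMap.trace E U (ρ σ) := by
  have hp : p.Prime := Fact.out
  obtain ⟨k, r, hr, hk⟩ := Nat.exists_eq_pow_mul_and_not_dvd (orderOf_pos σ).ne' p hp.ne_one
  have h1 : ∀ k, LinearMap.trace E U (ρ (σ ^ p ^ k)) = LinearMap.trace E U (ρ σ) ^ p ^ k := by
    intro k
    induction k with
    | zero => simp
    | succ k ih => rw [pow_succ, pow_mul, map_pow, trace_pow_char, ih, pow_mul]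
  have h2 : orderOf (σ ^ p ^ k) = r := by
    rw [orderOf_pow_of_dvd (pow_pos hp.pos k).ne' ⟨r, hk⟩, hk,
      Nat.mul_div_cancel_left _ (pow_pos hp.pos k)]
  obtain ⟨τ, hτ⟩ := hG (σ ^ p ^ k) p (by rw [h2]; exact (hp.coprime_iff_not_dvd).2 hr)
  have h3 := trace_conj_eq ρ hτ
  rw [← pow_mul, ← pow_succ, h1, h1, pow_succ', pow_mul] at h3
  refine (frobenius_inj E p).iterate k ?_
  rwa [iterate_frobenius, iterate_frobenius]

/-- The average of the powers of `σ` is a projection, so the sum of the traces of `σ ^ s` for `s <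
N` is `N` times a rank. Exponents prime to `N` all contribute the trace of `σ`; the others give
elements of smaller order, rational by induction. No cyclotomic fields are needed. -/
theorem trace_mem_range_ratCast [Finite G] [CharZero E] (hG : HasConjPowers G) (σ : G) :
    ∃ c : ℚ, LinearMap.trace E U (ρ σ) = c := by
  induction hN : orderOf σ using Nat.strong_induction_on generalizing σ with
  | _ N ih =>
    have hN0 : 0 < N := hN ▸ orderOf_pos σ
    have hNE : (N : E) ≠ 0 := Nat.cast_ne_zero.2 hN0.ne'
    let S : Module.End E U := ∑ s ∈ Finset.range N, ρ σ ^ s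
    have hσS : ρ σ * S = S := by
      have h1 : (∑ s ∈ Finset.range N, ρ σ ^ s) * (ρ σ - 1) = ρ σ ^ N - 1 := geom_sum_mul _ _
      have h2 : ρ σ ^ N = 1 := by rw [← map_pow, ← hN, pow_orderOf_eq_one, map_one]
      have h3 : S * ρ σ = S := by
        rw [h2, sub_self, mul_sub, mul_one] at h1
        exact sub_eq_zero.1 h1
      rw [← (Commute.sum_left (Finset.range N) (fun s => ρ σ ^ s) (ρ σ)
        fun s _ => Commute.pow_self _ _).eq]
      exact h3
    have hpow : ∀ s, ρ σ ^ s * S = S := by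
      intro s
      induction s with
      | zero => rw [pow_zero, one_mul]
      | succ s ih => rw [pow_succ, mul_assoc, hσS, ih]
    have hSS : S * S = (N : E) • S := by
      conv_lhs => rw [show S * S = (∑ s ∈ Finset.range N, ρ σ ^ s) * S from rfl, Finset.sum_mul]
      rw [Finset.sum_congr rfl fun s _ => hpow s, Finset.sum_const, Finset.card_range,
        Nat.cast_smul_eq_nsmul]
    have hid : IsIdempotentElem ((N : E)⁻¹ • S) := by
      change ((N : E)⁻¹ • S) * ((N : E)⁻¹ • S) = _
      rw [smul_mul_smul_comm, hSS, smul_smul, mul_assoc, inv_mul_cancel₀ hNE, mul_one]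
    have htr := (LinearMap.IsIdempotentElem.isProj_range _ hid).trace
    rw [map_smul, smul_eq_mul, inv_mul_eq_iff_eq_mul₀ hNE, map_sum] at htr
    set d := Module.finrank E (LinearMap.range ((N : E)⁻¹ • S))
    have hcop : ∀ s ∈ (Finset.range N).filter (fun s => s.Coprime N),
        LinearMap.trace E U (ρ σ ^ s) = LinearMap.trace E U (ρ σ) := by
      intro s hs
      obtain ⟨τ, hτ⟩ := hG σ s (by rw [hN]; exact (Finset.mem_filter.1 hs).2)
      rw [← map_pow, trace_conj_eq ρ hτ]
    have hncop : ∀ s ∈ (Finset.range N).filter (fun s => ¬ s.Coprime N),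
        ∃ c : ℚ, LinearMap.trace E U (ρ σ ^ s) = c := by
      intro s hs
      rw [← map_pow]
      refine ih (orderOf (σ ^ s)) ?_ (σ ^ s) rfl
      have hg : N.gcd s ≠ 1 := fun h => (Finset.mem_filter.1 hs).2 (Nat.coprime_comm.1 h)
      rw [orderOf_pow, hN]
      exact Nat.div_lt_self hN0
        (lt_of_le_of_ne (Nat.gcd_pos_of_pos_left s hN0) (Ne.symm hg))
    choose! c hc using hncop
    rw [← Finset.sum_filter_add_sum_filter_not (Finset.range N) (fun s => s.Coprime N),
      Finset.sum_congr rfl hcop, Finset.sum_congr rfl hc, Finset.sum_const, nsmul_eq_mul] at htr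
    have hφ : (((Finset.range N).filter (fun s => s.Coprime N)).card : E) ≠ 0 := by
      rw [Nat.cast_ne_zero, ← Nat.pos_iff_ne_zero, Finset.card_pos]
      rcases Nat.lt_or_ge 1 N with h1 | h1
      · exact ⟨1, Finset.mem_filter.2 ⟨Finset.mem_range.2 h1, Nat.coprime_one_left N⟩⟩
      -- For `N = 1` the only exponent in the range is `0`, which is prime to `1`.
      · have : N = 1 := le_antisymm h1 hN0
        exact ⟨0, Finset.mem_filter.2 ⟨Finset.mem_range.2 hN0, by rw [this]; exact Nat.coprime_one_right 0⟩⟩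
    refine ⟨(N * d - ∑ s ∈ (Finset.range N).filter (fun s => ¬ s.Coprime N), c s) /
      ((Finset.range N).filter (fun s => s.Coprime N)).card, ?_⟩
    push_cast
    rw [eq_div_iff hφ, ← htr]
    ring

end Trace

/-- A field of endomorphisms with traces in the base field is the base field. -/
theorem mem_range_algebraMap_of_trace {F E U G : Type*} [Field F] [Field E] [Algebra F E]
    [AddCommGroup U] [Module E U] [FiniteDimensional E U] [Nontrivial U] [Group G]
    (r : MonoidAlgebra F G →+* Module.End E U) (hr : Function.Surjective r)
    (hF : ∀ (c : F) (x : MonoidAlgebra F G), r (c • x) = algebraMap F E c • r x)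
    (htr : ∀ g, LinearMap.trace E U (r (MonoidAlgebra.of F G g)) ∈ (algebraMap F E).range)
    (e : E) : ∃ c, e = algebraMap F E c := by
  have h1 : ∀ x, LinearMap.trace E U (r x) ∈ (algebraMap F E).range := by
    intro x
    induction x using MonoidAlgebra.induction_on with
    | of g => exact htr g
    | add x y hx hy => rw [map_add, map_add]; exact add_mem hx hy
    | smul c x hx =>
      rw [hF, map_smul, smul_eq_mul]
      exact mul_mem ⟨c, rfl⟩ hx
  obtain ⟨u, hu⟩ := exists_ne (0 : U)
  obtain ⟨f, hf⟩ := Module.Projective.exists_dual_eq_one E hu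
  -- The rank-one endomorphism `v ↦ f(v) e u` with `f(u) = 1` has trace `e`.
  obtain ⟨x, hx⟩ := hr (f.smulRight (e • u))
  obtain ⟨c, hc⟩ := h1 x
  refine ⟨c, ?_⟩
  rw [hc, hx, LinearMap.trace_smulRight, map_smul, hf, smul_eq_mul, mul_one]

end KSInterpolation

namespace KSInterpolation

/-! ### Splitting of the group algebras of symmetric groups over prime fields -/

/-- Traces of representations of `G` over extension fields of `F` lie in `F`. -/
def HasBaseTraces (F G : Type) [Field F] [Group G] : Prop :=
  ∀ (E U : Type) [Field E] [Algebra F E] [AddCommGroup U] [Module E U] [FiniteDimensional E U]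
    (ρ : G →* Module.End E U) (g : G), LinearMap.trace E U (ρ g) ∈ (algebraMap F E).range

theorem hasBaseTraces_rat {G : Type} [Group G] [Finite G] (hG : HasConjPowers G) :
    HasBaseTraces ℚ G := by
  intro E U _ _ _ _ _ ρ g
  have : CharZero E := algebraRat.charZero E
  obtain ⟨c, hc⟩ := trace_mem_range_ratCast ρ hG g
  exact ⟨c, by rw [hc]; simp⟩

theorem hasBaseTraces_zmod (p : ℕ) [Fact p.Prime] {G : Type} [Group G] [Finite G]
    (hG : HasConjPowers G) : HasBaseTraces (ZMod p) G := by
  intro E U _ _ _ _ _ ρ g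
  have : CharP E p := charP_of_injective_algebraMap (algebraMap (ZMod p) E).injective p
  have h := trace_pow_eq_self ρ hG p g
  rw [← Subfield.mem_bot_iff_pow_eq_self E p] at h
  have h2 : (⊥ : Subfield E) ≤ (algebraMap (ZMod p) E).fieldRange := bot_le
  exact h2 h

section

variable {F G : Type} [Field F] [Group G]

/-- Commutative endomorphism rings of simple modules consist of scalars. -/
theorem exists_eq_smul_of_commute (hT : HasBaseTraces F G) (U : Type) [AddCommGroup U]
    [Module (MonoidAlgebra F G) U] [Module F U] [IsScalarTower F (MonoidAlgebra F G) U]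
    [IsSimpleModule (MonoidAlgebra F G) U] [FiniteDimensional F U]
    (hcomm : ∀ φ ψ : Module.End (MonoidAlgebra F G) U, φ * ψ = ψ * φ)
    (φ : Module.End (MonoidAlgebra F G) U) : ∃ c : F, ∀ u, φ u = c • u := by
  classical
  have : SMulCommClass (MonoidAlgebra F G) F U := ⟨fun r c u => by
    rw [← algebraMap_smul (MonoidAlgebra F G) c, ← algebraMap_smul (MonoidAlgebra F G) c,
      ← mul_smul, ← mul_smul, Algebra.commutes]⟩
  -- By Schur's lemma `End U` is a division ring, so commutativity makes it a field `E`. The group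
  -- algebra maps onto `End_E U`, and the traces of group elements lie in `F`, so `E` reduces to
  -- `F`.
  let _ : Field (Module.End (MonoidAlgebra F G) U) :=
    { (inferInstance : DivisionRing (Module.End (MonoidAlgebra F G) U)) with mul_comm := hcomm }
  have : IsScalarTower F (Module.End (MonoidAlgebra F G) U) U := ⟨fun c ψ u => rfl⟩
  have : FiniteDimensional (Module.End (MonoidAlgebra F G) U) U :=
    Module.Finite.of_restrictScalars_finite F _ _
  have : Nontrivial U := IsSimpleModule.nontrivial (MonoidAlgebra F G) U
  obtain ⟨c, hc⟩ := mem_range_algebraMap_of_trace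
    (Module.toModuleEnd (Module.End (MonoidAlgebra F G) U) (S := MonoidAlgebra F G) U)
    Module.Finite.toModuleEnd_moduleEnd_surjective
    (fun c x => LinearMap.ext fun u => smul_assoc c x u)
    (fun g => hT (Module.End (MonoidAlgebra F G) U) U
      ((Module.toModuleEnd (Module.End (MonoidAlgebra F G) U) (S := MonoidAlgebra F G)
        U).toMonoidHom.comp (MonoidAlgebra.of F G)) g) φ
  refine ⟨c, fun u => ?_⟩
  rw [hc]
  rfl

/-- A maximal left ideal containing `1 - f` cannot contain `f`, so `f` acts nontrivially on the
simple quotient, whose endomorphisms are scalars; `isSplitIdem_of_simple` then applies. -/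
theorem isSplitIdem_of_commute [Finite G] (hT : HasBaseTraces F G)
    (hcomm : ∀ (U : Type) [AddCommGroup U] [Module (MonoidAlgebra F G) U]
      [Module F U] [IsScalarTower F (MonoidAlgebra F G) U] [FiniteDimensional F U]
      [IsSimpleModule (MonoidAlgebra F G) U],
      ∀ φ ψ : Module.End (MonoidAlgebra F G) U, φ * ψ = ψ * φ)
    {f : MonoidAlgebra F G} (hf : IsPrimitiveIdem f) : IsSplitIdem F f := by
  have hne : Ideal.span {1 - f} ≠ ⊤ := by
    intro h
    obtain ⟨a, ha⟩ := Ideal.mem_span_singleton'.1 ((Ideal.eq_top_iff_one _).1 h)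
    refine hf.ne_zero ?_
    rw [← one_mul f, ← ha, mul_assoc, sub_mul, one_mul, hf.idem, sub_self, mul_zero]
  obtain ⟨M, hM, hle⟩ := Ideal.exists_le_maximal _ hne
  have : IsSimpleModule (MonoidAlgebra F G) (MonoidAlgebra F G ⧸ M) :=
    isSimpleModule_iff_isCoatom.2 hM.out
  have : FiniteDimensional F (MonoidAlgebra F G ⧸ M) :=
    Module.Finite.of_surjective (M.mkQ.restrictScalars F) M.mkQ_surjective
  refine hf.isSplitIdem_of_simple (MonoidAlgebra F G ⧸ M)
    (exists_eq_smul_of_commute hT _ (hcomm _)) (Submodule.Quotient.mk 1) fun h0 => hM.ne_top ?_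
  rw [← Submodule.Quotient.mk_smul, smul_eq_mul, mul_one, Submodule.Quotient.mk_eq_zero] at h0
  rw [Ideal.eq_top_iff_one, ← sub_add_cancel 1 f]
  exact add_mem (hle (Ideal.mem_span_singleton_self _)) h0

end

/-- Endomorphism rings of finite simple modules are finite division rings, commutative by
Wedderburn's theorem. -/
theorem isSplitIdem_zmod (p : ℕ) [Fact p.Prime] {G : Type} [Group G] [Finite G]
    (hG : HasConjPowers G) {f : MonoidAlgebra (ZMod p) G} (hf : IsPrimitiveIdem f) :
    IsSplitIdem (ZMod p) f := by
  refine isSplitIdem_of_commute (hasBaseTraces_zmod p hG) ?_ hf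
  intro U _ _ _ _ _ _ φ ψ
  classical
  have : Finite U := Module.finite_of_finite (ZMod p)
  have : Finite (Module.End (MonoidAlgebra (ZMod p) G) U) :=
    Finite.of_injective (fun φ => (φ : U → U)) DFunLike.coe_injective
  exact (littleWedderburn (Module.End (MonoidAlgebra (ZMod p) G) U)).mul_comm φ ψ

section Branching

variable {G H : Type} [Group G] [Group H] [Fintype G] [Fintype H]

/-- The coefficient at `1` of a nonzero idempotent does not vanish in characteristic zero. -/
theorem coeff_one_ne_zero_of_idem {e : MonoidAlgebra ℚ H} (he : e * e = e) (h0 : e ≠ 0) :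
    e.coeff 1 ≠ 0 := by
  classical
  intro h1
  let b := MonoidAlgebra.basis H ℚ
  -- Left multiplication by `e` is a nonzero projection, so its trace is not zero; in the basis of
  -- group elements every diagonal entry is `e.coeff 1`.
  have htr : LinearMap.trace ℚ _ (LinearMap.mulLeft ℚ e) = Fintype.card H * e.coeff 1 := by
    rw [LinearMap.trace_eq_matrix_trace ℚ b, Matrix.trace]
    rw [Finset.sum_congr rfl (g := fun _ => e.coeff 1), Finset.sum_const, nsmul_eq_mul]
    · rfl
    · intro h _
      rw [Matrix.diag_apply, LinearMap.toMatrix_apply]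
      change (e * b h).coeff h = _
      rw [show b h = MonoidAlgebra.single h 1 by simp [b], MonoidAlgebra.coeff_mul_single_apply,
        mul_one, mul_inv_cancel]
  have hid : IsIdempotentElem (LinearMap.mulLeft ℚ e) := LinearMap.ext fun x => by
    change e * (e * x) = e * x
    rw [← mul_assoc, he]
  rw [h1, mul_zero, LinearMap.IsIdempotentElem.trace_eq_zero_iff hid] at htr
  refine h0 ?_
  have := LinearMap.congr_fun htr 1
  simpa using this

variable (ι : H →* G)

/-- Sum of the conjugates by the elements of a subgroup. -/
noncomputable def conjSum : MonoidAlgebra ℚ G →ₗ[ℚ] MonoidAlgebra ℚ G :=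
  ∑ h : H, LinearMap.mulLeft ℚ (MonoidAlgebra.of ℚ G (ι h)) ∘ₗ
    LinearMap.mulRight ℚ (MonoidAlgebra.of ℚ G (ι h⁻¹))

omit [Fintype G] in
theorem conjSum_apply (x : MonoidAlgebra ℚ G) :
    conjSum ι x = ∑ h : H, MonoidAlgebra.of ℚ G (ι h) * x * MonoidAlgebra.of ℚ G (ι h⁻¹) := by
  rw [conjSum, LinearMap.sum_apply]
  exact Finset.sum_congr rfl fun h _ => (mul_assoc _ _ _).symm

omit [Fintype G] in
theorem conjSum_conj (h : H) (x : MonoidAlgebra ℚ G) :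
    conjSum ι (MonoidAlgebra.of ℚ G (ι h) * x * MonoidAlgebra.of ℚ G (ι h⁻¹)) = conjSum ι x := by
  rw [conjSum_apply, conjSum_apply]
  refine Fintype.sum_equiv (Equiv.mulRight h) _ _ fun k => ?_
  rw [Equiv.coe_mulRight, map_mul, mul_inv_rev, map_mul, map_mul, map_mul]
  simp only [mul_assoc]

omit [Fintype G] in
theorem of_mul_conjSum (h : H) (x : MonoidAlgebra ℚ G) :
    MonoidAlgebra.of ℚ G (ι h) * conjSum ι x = conjSum ι x * MonoidAlgebra.of ℚ G (ι h) := by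
  rw [conjSum_apply, Finset.mul_sum, Finset.sum_mul]
  refine Fintype.sum_equiv (Equiv.mulLeft h) _ _ fun k => ?_
  rw [Equiv.coe_mulLeft, mul_assoc _ (MonoidAlgebra.of ℚ G (ι (h * k)⁻¹)), ← map_mul, ← map_mul,
    mul_inv_rev, inv_mul_cancel_right, map_mul ι, map_mul (MonoidAlgebra.of ℚ G)]
  simp only [mul_assoc]

omit [Fintype G] in
theorem commute_conjSum (r : MonoidAlgebra ℚ H) (x : MonoidAlgebra ℚ G) :
    MonoidAlgebra.mapDomainAlgHom ℚ ℚ ι r * conjSum ι x =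
      conjSum ι x * MonoidAlgebra.mapDomainAlgHom ℚ ℚ ι r := by
  induction r using MonoidAlgebra.induction_on with
  | of h =>
    rw [show MonoidAlgebra.mapDomainAlgHom ℚ ℚ ι (MonoidAlgebra.of ℚ H h) =
      MonoidAlgebra.of ℚ G (ι h) by simp, of_mul_conjSum]
  | add a b ha hb => rw [map_add, add_mul, mul_add, ha, hb]
  | smul c a ha => rw [map_smul, smul_mul_assoc, mul_smul_comm, ha]

omit [Fintype G] in
theorem conjSum_of_commute {z : MonoidAlgebra ℚ G}
    (hz : ∀ h, MonoidAlgebra.of ℚ G (ι h) * z = z * MonoidAlgebra.of ℚ G (ι h)) :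
    conjSum ι z = (Fintype.card H : ℚ) • z := by
  rw [conjSum_apply, Finset.sum_congr rfl (g := fun _ => z), Finset.sum_const, Finset.card_univ,
    Nat.cast_smul_eq_nsmul]
  intro h _
  rw [hz, mul_assoc, ← map_mul, ← map_mul, mul_inv_cancel, map_one, map_one, mul_one]

variable (G) in
/-- The inversion anti-automorphism of the group algebra. -/
noncomputable def invAlgHom : MonoidAlgebra ℚ G →ₐ[ℚ] (MonoidAlgebra ℚ G)ᵐᵒᵖ :=
  MonoidAlgebra.lift ℚ _ G
    { toFun := fun g => MulOpposite.op (MonoidAlgebra.of ℚ G g⁻¹)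
      map_one' := by rw [inv_one, map_one]; rfl
      map_mul' := fun g h => by rw [mul_inv_rev, map_mul]; rfl }

omit [Fintype G] in
theorem invAlgHom_of (g : G) :
    invAlgHom G (MonoidAlgebra.of ℚ G g) = MulOpposite.op (MonoidAlgebra.of ℚ G g⁻¹) :=
  MonoidAlgebra.lift_of _ _

variable (hι : ∀ σ : G, ∃ h : H, ι h * σ * ι h⁻¹ = σ⁻¹)

-- Inversion commutes with summing over `H`-conjugates, and that sum does not distinguish `σ` from
-- the `H`-conjugate element `σ⁻¹`.
include hι in
omit [Fintype G] in
theorem invAlgHom_conjSum (x : MonoidAlgebra ℚ G) :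
    invAlgHom G (conjSum ι x) = MulOpposite.op (conjSum ι x) := by
  have h1 : ∀ x, (invAlgHom G (conjSum ι x)).unop = conjSum ι (invAlgHom G x).unop := by
    intro x
    rw [conjSum_apply, conjSum_apply, map_sum, Finset.unop_sum]
    refine Finset.sum_congr rfl fun h _ => ?_
    rw [map_mul, map_mul, invAlgHom_of, invAlgHom_of, ← map_inv, ← map_inv, inv_inv]
    simp only [MulOpposite.unop_mul, MulOpposite.unop_op, mul_assoc]
  have h2 : ∀ x, conjSum ι (invAlgHom G x).unop = conjSum ι x := by
    intro x
    induction x using MonoidAlgebra.induction_on with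
    | of g =>
      obtain ⟨h, hh⟩ := hι g
      rw [invAlgHom_of, MulOpposite.unop_op, ← hh, (MonoidAlgebra.of ℚ G).map_mul,
        (MonoidAlgebra.of ℚ G).map_mul, conjSum_conj]
    | add a b ha hb => rw [map_add, MulOpposite.unop_add, map_add, map_add, ha, hb]
    | smul c a ha => rw [map_smul, MulOpposite.unop_smul, map_smul, map_smul, ha]
  rw [← h2 x, ← h1 x, MulOpposite.op_unop, h1, h2]

-- Gelfand's trick: a product of elements centralizing `H` centralizes `H`, hence is itself a
-- multiple of a sum of conjugates and is fixed by inversion. An anti-automorphism fixing both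
-- factors and their product makes them commute.
include hι in
omit [Fintype G] in
theorem conjSum_mul_comm (x y : MonoidAlgebra ℚ G) :
    conjSum ι x * conjSum ι y = conjSum ι y * conjSum ι x := by
  have hH : (Fintype.card H : ℚ) ≠ 0 := Nat.cast_ne_zero.2 Fintype.card_ne_zero
  have h1 : conjSum ι x * conjSum ι y =
      conjSum ι ((Fintype.card H : ℚ)⁻¹ • (conjSum ι x * conjSum ι y)) := by
    have hz : ∀ h, MonoidAlgebra.of ℚ G (ι h) * (conjSum ι x * conjSum ι y) =
        conjSum ι x * conjSum ι y * MonoidAlgebra.of ℚ G (ι h) := fun h => by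
      rw [← mul_assoc, of_mul_conjSum, mul_assoc, of_mul_conjSum, mul_assoc]
    rw [map_smul, conjSum_of_commute ι hz, inv_smul_smul₀ hH]
  have h2 : invAlgHom G (conjSum ι x * conjSum ι y) =
      MulOpposite.op (conjSum ι x * conjSum ι y) := by
    rw [h1, invAlgHom_conjSum ι hι]
  rw [map_mul, invAlgHom_conjSum ι hι, invAlgHom_conjSum ι hι] at h2
  exact (MulOpposite.op_injective h2).symm

theorem jacobson_rat_eq_bot : Ring.jacobson (MonoidAlgebra ℚ H) = ⊥ :=
  IsSemisimpleRing.jacobson_eq_bot _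

/-- The scalar relating an element of a corner to the sum of its conjugates does not vanish. -/
theorem sum_mul_ne_zero {e : MonoidAlgebra ℚ H} (he : e * e = e) (h0 : e ≠ 0) (χ : H → ℚ)
    (hχ : ∀ h, e * MonoidAlgebra.of ℚ H h * e = χ h • e) : ∑ h, χ h * χ h⁻¹ ≠ 0 := by
  intro hC
  -- `z` is central and `e z e = (∑ χ(h) χ(h⁻¹)) e`. If the sum vanished, then `z e = 0` and `z ^ 2
  -- = 0`, so the central element `z` would lie in the radical, which is zero. But its coefficient
  -- at `1` is the order of `H` times that of `e`.
  set z := conjSum (MonoidHom.id H) e with hz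
  have hcomm : ∀ r, r * z = z * r := fun r => by
    have := commute_conjSum (MonoidHom.id H) r e
    rwa [MonoidAlgebra.mapDomainAlgHom_id] at this
  have hze : z * e = 0 := by
    have h1 : e * z * e = (∑ h, χ h * χ h⁻¹) • e := by
      rw [hz, conjSum_apply, Finset.mul_sum, Finset.sum_mul, Finset.sum_smul]
      refine Finset.sum_congr rfl fun h _ => ?_
      have h2 : e * (MonoidAlgebra.of ℚ H h * e * MonoidAlgebra.of ℚ H h⁻¹) * e =
          (e * MonoidAlgebra.of ℚ H h * e) * (e * MonoidAlgebra.of ℚ H h⁻¹ * e) := by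
        conv_lhs => rw [← he]
        simp only [mul_assoc]
        simp only [← mul_assoc e e, he]
      refine h2.trans ?_
      rw [hχ, hχ, smul_mul_smul_comm, he]
    rw [hC, zero_smul, hcomm, mul_assoc, he] at h1
    exact h1
  have hzz : z * z = 0 := by
    conv_lhs => enter [1]; rw [hz, conjSum_apply]
    rw [Finset.sum_mul]
    refine Finset.sum_eq_zero fun h _ => ?_
    rw [mul_assoc, hcomm, ← mul_assoc, mul_assoc _ e z, hcomm, hze, mul_zero, zero_mul]
  have hz0 : z = 0 := by
    have : z ∈ Ring.jacobson (MonoidAlgebra ℚ H) := mem_jacobson_of_isNilpotent fun r =>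
      ⟨2, by rw [pow_two, ← mul_assoc, mul_assoc r z r, ← hcomm, ← mul_assoc, mul_assoc _ z z, hzz,
        mul_zero]⟩
    rwa [jacobson_rat_eq_bot] at this
  have hco := congrArg (fun x : MonoidAlgebra ℚ H => x.coeff 1) hz0
  rw [hz, conjSum_apply] at hco
  simp only [MonoidAlgebra.coeff_sum, Finsupp.finsetSum_apply] at hco
  rw [Finset.sum_congr rfl (g := fun _ => e.coeff 1), Finset.sum_const, nsmul_eq_mul] at hco
  · exact mul_ne_zero (Nat.cast_ne_zero.2 Fintype.card_ne_zero) (coeff_one_ne_zero_of_idem he h0) hco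
  · intro h _
    rw [MonoidAlgebra.of_apply, MonoidAlgebra.of_apply, MonoidAlgebra.coeff_mul_single_apply,
      MonoidAlgebra.coeff_single_mul_apply]
    simp

include hι in
omit [Fintype G] in
/-- Branching: corners for split idempotents of a subgroup algebra are commutative. -/
theorem corner_mul_comm {e : MonoidAlgebra ℚ H} (he : IsSplitIdem ℚ e) (x y : MonoidAlgebra ℚ G) :
    let j := MonoidAlgebra.mapDomainAlgHom ℚ ℚ ι e
    (j * x * j) * (j * y * j) = (j * y * j) * (j * x * j) := by
  intro j
  have hjj : j * j = j := by rw [← map_mul, he.idem]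
  have hχ : ∀ x, ∃ c : ℚ, e * x * e = c • e := fun x => by
    obtain ⟨c, hc⟩ := he.split x
    rw [jacobson_rat_eq_bot] at hc
    exact ⟨c, sub_eq_zero.1 hc⟩
  choose χ hχ using fun h : H => hχ (MonoidAlgebra.of ℚ H h)
  set C := ∑ h, χ h * χ h⁻¹ with hC
  have hC0 : C ≠ 0 := sum_mul_ne_zero he.idem he.ne_zero χ hχ
  have hχj : ∀ h, j * MonoidAlgebra.of ℚ G (ι h) * j = χ h • j := fun h => by
    have := congrArg (MonoidAlgebra.mapDomainAlgHom ℚ ℚ ι) (hχ h)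
    rw [map_mul, map_mul, map_smul] at this
    simpa [j] using this
  -- The relations `j h j = χ(h) j` recover `C` times an element of the corner from the sum of its
  -- conjugates. So the corner lies in `j` times the span of the elements `conjSum`, which commute
  -- with each other and with `j`.
  have key : ∀ x, j * x * j = C⁻¹ • (conjSum ι (j * x * j) * j) := by
    intro x
    rw [eq_inv_smul_iff₀ hC0]
    have h1 : conjSum ι (j * x * j) * j = j * conjSum ι (j * x * j) * j := by
      rw [commute_conjSum, mul_assoc (conjSum ι _)]
      exact congrArg _ hjj.symm
    rw [h1, conjSum_apply, Finset.mul_sum, Finset.sum_mul, hC, Finset.sum_smul]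
    refine Finset.sum_congr rfl fun h _ => ?_
    have h2 : j * (MonoidAlgebra.of ℚ G (ι h) * (j * x * j) * MonoidAlgebra.of ℚ G (ι h⁻¹)) * j =
        (j * MonoidAlgebra.of ℚ G (ι h) * j) * x * (j * MonoidAlgebra.of ℚ G (ι h⁻¹) * j) := by
      simp only [mul_assoc]
    rw [h2, hχj, hχj, smul_mul_assoc, smul_mul_smul_comm]
  rw [key x, key y]
  generalize j * x * j = x
  generalize j * y * j = y
  rw [smul_mul_smul_comm, smul_mul_smul_comm]
  have h3 : ∀ x y, conjSum ι x * j * (conjSum ι y * j) = conjSum ι x * conjSum ι y * j := by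
    intro x y
    rw [mul_assoc, ← mul_assoc j, commute_conjSum, mul_assoc, hjj, mul_assoc]
  rw [h3, h3, conjSum_mul_comm ι hι]

-- Some split idempotent `j` from the subgroup fixes a nonzero `u` in the simple module `U`. An
-- endomorphism is determined by the image of `u`, which has the form `j r j u`, so commutativity of
-- the corner makes endomorphisms commute.
include hι in
theorem isSplitIdem_rat_of_branching (hG : HasConjPowers G)
    (hH : ∀ e : MonoidAlgebra ℚ H, IsPrimitiveIdem e → IsSplitIdem ℚ e)
    {f : MonoidAlgebra ℚ G} (hf : IsPrimitiveIdem f) : IsSplitIdem ℚ f := by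
  refine isSplitIdem_of_commute (hasBaseTraces_rat hG) ?_ hf
  intro U _ _ _ _ _ _ φ ψ
  have : Nontrivial U := IsSimpleModule.nontrivial (MonoidAlgebra ℚ G) U
  obtain ⟨u₀, hu₀⟩ := exists_ne (0 : U)
  obtain ⟨e, he', u, ha, hju⟩ : ∃ e : MonoidAlgebra ℚ H, IsSplitIdem ℚ e ∧ ∃ u : U, u ≠ 0 ∧
      MonoidAlgebra.mapDomainAlgHom ℚ ℚ ι e • u = u := by
    let _ : Module (MonoidAlgebra ℚ H) U :=
      Module.compHom U (MonoidAlgebra.mapDomainAlgHom ℚ ℚ ι).toRingHom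
    obtain ⟨e, he, a, ha⟩ := exists_mul_smul_ne_zero
      (one_mem_twoSided_isPrimitiveIdem ℚ (R := MonoidAlgebra ℚ H)) hu₀
    refine ⟨e, hH e he, e • a • u₀, ha, ?_⟩
    change e • e • a • u₀ = e • a • u₀
    rw [← mul_smul, (hH e he).idem]
  set j := MonoidAlgebra.mapDomainAlgHom ℚ ℚ ι e with hj
  have hgen := IsSimpleModule.toSpanSingleton_surjective (MonoidAlgebra ℚ G) ha
  have hφ : ∀ φ : Module.End (MonoidAlgebra ℚ G) U, ∃ r, φ u = (j * r * j) • u := by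
    intro φ
    obtain ⟨r, hr⟩ := hgen (φ u)
    refine ⟨r, ?_⟩
    conv_lhs => rw [← hju, map_smul, ← hr]
    rw [LinearMap.toSpanSingleton_apply, mul_smul, mul_smul, hju]
  obtain ⟨r, hr⟩ := hφ φ
  obtain ⟨s, hs⟩ := hφ ψ
  have hu : (φ * ψ) u = (ψ * φ) u := by
    rw [Module.End.mul_apply, Module.End.mul_apply, hr, hs, map_smul, map_smul, hr, hs, ← mul_smul,
      ← mul_smul, corner_mul_comm ι hι he']
  refine LinearMap.ext fun v => ?_
  obtain ⟨t, rfl⟩ := hgen v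
  rw [LinearMap.toSpanSingleton_apply, map_smul, map_smul, hu]

end Branching

theorem isSplitIdem_rat_of_subsingleton {G : Type} [Group G] [Finite G] [Subsingleton G]
    {f : MonoidAlgebra ℚ G} (hf : IsPrimitiveIdem f) : IsSplitIdem ℚ f := by
  have hc : ∀ x : MonoidAlgebra ℚ G, ∃ c, x = algebraMap ℚ _ c := by
    intro x
    induction x using MonoidAlgebra.induction_on with
    | of g => exact ⟨1, by rw [Subsingleton.elim g 1, map_one, map_one]⟩
    | add a b ha hb =>
      obtain ⟨c, rfl⟩ := ha
      obtain ⟨d, rfl⟩ := hb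
      exact ⟨c + d, (map_add _ _ _).symm⟩
    | smul r a ha =>
      obtain ⟨c, rfl⟩ := ha
      exact ⟨r * c, by rw [map_mul, Algebra.smul_def]⟩
  refine ⟨hf.ne_zero, hf.idem, fun x => ?_⟩
  obtain ⟨c, rfl⟩ := hc x
  refine ⟨c, ?_⟩
  rw [← Algebra.commutes, mul_assoc, hf.idem, Algebra.smul_def, sub_self]
  exact zero_mem _

/-- Induction along `S_m ⊂ S_{m+1}` as the stabilizer of the last point: each permutation is
conjugate to its inverse by one fixing that point, which is the case `s = -1` of
`exists_perm_conj_eq_zpow`. -/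
theorem isSplitIdem_rat_perm (m : ℕ) {f : MonoidAlgebra ℚ (Equiv.Perm (Fin m))}
    (hf : IsPrimitiveIdem f) : IsSplitIdem ℚ f := by
  induction m with
  | zero => exact isSplitIdem_rat_of_subsingleton hf
  | succ m ih =>
    let e : Fin m ≃ {x : Fin (m + 1) // x ≠ Fin.last m} := finSuccAboveEquiv (Fin.last m)
    refine isSplitIdem_rat_of_branching (Equiv.Perm.extendDomainHom e) ?_ (hasConjPowers_perm _)
      (fun f hf => ih hf) hf
    intro σ
    obtain ⟨τ, hτ, h⟩ := exists_perm_conj_eq_zpow σ (-1) isCoprime_one_left.neg_left (Fin.last m)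
    have hτ' : ∀ x, x ≠ Fin.last m ↔ τ x ≠ Fin.last m := fun x => by
      conv_rhs => rw [← hτ]
      exact τ.injective.ne_iff.symm
    let π : Equiv.Perm (Fin m) := e.trans ((τ.subtypeEquiv hτ').trans e.symm)
    have hπ : Equiv.Perm.extendDomainHom e π = τ := by
      ext1 x
      by_cases hx : x = Fin.last m
      · rw [hx, hτ]
        exact Equiv.Perm.extendDomain_apply_not_subtype π e (not_not.2 rfl)
      · refine (Equiv.Perm.extendDomain_apply_subtype π e hx).trans ?_
        simp [π]
    refine ⟨π, ?_⟩
    rw [map_inv, hπ, h, zpow_neg_one]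

end KSInterpolation

namespace KSInterpolation

/-! ### Tensor products of elements of group algebras -/

instance isArtinianRing_monoidAlgebra {F G : Type*} [Field F] [Group G] [Finite G] :
    IsArtinianRing (MonoidAlgebra F G) :=
  isArtinian_of_tower F inferInstance

theorem coeff_mul_eq_sum {F G : Type*} [Semiring F] [Group G] [Fintype G] (x y : MonoidAlgebra F G)
    (g : G) : (x * y).coeff g = ∑ h, x.coeff h * y.coeff (h⁻¹ * g) := by
  classical
  rw [MonoidAlgebra.coeff_mul, Finsupp.sum_fintype _ _ (by simp)]
  refine Finset.sum_congr rfl fun h _ => ?_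
  rw [Finsupp.sum_fintype _ _ (by simp), Finset.sum_eq_single (h⁻¹ * g)]
  · simp
  · intro k _ hk
    rw [if_neg]
    rintro rfl
    simp at hk
  · simp

section Pure

variable {F K I : Type*} [Field F] [Field K] [Algebra F K] [Fintype I] {G : I → Type*}
  [∀ j, Group (G j)] [∀ j, Fintype (G j)]

variable (K) in
/-- The tensor product of elements of group algebras, over an extension field. -/
noncomputable def pureTensor (r : ∀ j, MonoidAlgebra F (G j)) : MonoidAlgebra K (∀ j, G j) :=
  MonoidAlgebra.ofCoeff (Finsupp.equivFunOnFinite.symm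
    fun s => ∏ j, algebraMap F K ((r j).coeff (s j)))

omit [∀ j, Group (G j)] in
theorem coeff_pureTensor (r : ∀ j, MonoidAlgebra F (G j)) (s : ∀ j, G j) :
    (pureTensor K r).coeff s = ∏ j, algebraMap F K ((r j).coeff (s j)) := rfl

theorem pureTensor_mul (r r' : ∀ j, MonoidAlgebra F (G j)) :
    pureTensor K (fun j => r j * r' j) = pureTensor K r * pureTensor K r' := by
  classical
  ext s
  rw [coeff_mul_eq_sum, coeff_pureTensor]
  simp only [coeff_pureTensor, coeff_mul_eq_sum, map_sum, map_mul, Finset.prod_univ_sum,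
    ← Finset.prod_mul_distrib, Fintype.piFinset_univ]
  rfl

theorem pureTensor_single (s : ∀ j, G j) :
    pureTensor K (fun j => MonoidAlgebra.of F (G j) (s j)) = MonoidAlgebra.of K _ s := by
  classical
  ext t
  rw [coeff_pureTensor, MonoidAlgebra.of_apply, MonoidAlgebra.coeff_single, Finsupp.single_apply]
  simp only [MonoidAlgebra.of_apply, MonoidAlgebra.coeff_single, Finsupp.single_apply]
  by_cases h : s = t
  · subst h; simp
  · rw [if_neg h]
    obtain ⟨j, hj⟩ := Function.ne_iff.1 h
    exact Finset.prod_eq_zero (Finset.mem_univ j) (by rw [if_neg hj, map_zero])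

theorem pureTensor_one : pureTensor K (fun j => (1 : MonoidAlgebra F (G j))) = 1 := by
  rw [← map_one (MonoidAlgebra.of K (∀ j, G j)), ← pureTensor_single (F := F)]
  simp only [Pi.one_apply, map_one]

variable [DecidableEq I]

theorem pureTensor_update_add (r : ∀ j, MonoidAlgebra F (G j)) (j : I) (a b : MonoidAlgebra F (G j)) :
    pureTensor K (Function.update r j (a + b)) =
      pureTensor K (Function.update r j a) + pureTensor K (Function.update r j b) := by
  ext s
  rw [MonoidAlgebra.coeff_add, Finsupp.add_apply, coeff_pureTensor, coeff_pureTensor, coeff_pureTensor,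
    ← Finset.mul_prod_erase _ _ (Finset.mem_univ j), ← Finset.mul_prod_erase _ _ (Finset.mem_univ j),
    ← Finset.mul_prod_erase _ _ (Finset.mem_univ j)]
  simp only [Function.update_self, MonoidAlgebra.coeff_add, Finsupp.add_apply, map_add, add_mul]
  congr 2 <;>
  · refine Finset.prod_congr rfl fun k hk => ?_
    rw [Function.update_of_ne (Finset.ne_of_mem_erase hk),
      Function.update_of_ne (Finset.ne_of_mem_erase hk)]

/-- The tensor product as an additive map in one variable. -/
noncomputable def pureTensorHom (r : ∀ j, MonoidAlgebra F (G j)) (j : I) :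
    MonoidAlgebra F (G j) →+ MonoidAlgebra K (∀ j, G j) :=
  AddMonoidHom.mk' (fun a => pureTensor K (Function.update r j a)) (pureTensor_update_add r j)

theorem pureTensorHom_apply (r : ∀ j, MonoidAlgebra F (G j)) (j : I) (a : MonoidAlgebra F (G j)) :
    pureTensorHom (K := K) r j a = pureTensor K (Function.update r j a) := rfl

theorem pureTensor_eq_zero (r : ∀ j, MonoidAlgebra F (G j)) (j : I) (h : r j = 0) : pureTensor K r = 0 := by
  rw [← Function.update_eq_self j r, h, ← pureTensorHom_apply, map_zero]

omit [DecidableEq I] in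
theorem mul_mem_span_pureTensor {J : I → Prop} {D : ∀ j, Ideal (MonoidAlgebra F (G j))}
    (x z : MonoidAlgebra K (∀ j, G j))
    (hz : z ∈ Submodule.span K {z | ∃ r : ∀ j, MonoidAlgebra F (G j), (∀ j, J j → r j ∈ D j) ∧
      z = pureTensor K r}) :
    x * z ∈ Submodule.span K {z | ∃ r : ∀ j, MonoidAlgebra F (G j), (∀ j, J j → r j ∈ D j) ∧
      z = pureTensor K r} := by
  induction hz using Submodule.span_induction with
  | zero => rw [mul_zero]; exact zero_mem _
  | add a b _ _ ha hb => rw [mul_add]; exact add_mem ha hb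
  | smul c a _ ha => rw [mul_smul_comm]; exact Submodule.smul_mem _ c ha
  | mem z hz =>
    obtain ⟨r, hr, rfl⟩ := hz
    induction x using MonoidAlgebra.induction_on with
    | of s =>
      rw [← pureTensor_single (F := F), ← pureTensor_mul]
      exact Submodule.subset_span ⟨_, fun j hj => (D j).mul_mem_left _ (hr j hj), rfl⟩
    | add x y hx hy => rw [add_mul]; exact add_mem hx hy
    | smul c x hx => rw [smul_mul_assoc]; exact Submodule.smul_mem _ c hx

/-- The `k`-th power of `x * pureTensor K r` is a combination of pure tensors whose `j₀`-factor lies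
in the `k`-th power of the radical, and the radical is nilpotent. -/
theorem pureTensor_mem_jacobson (r : ∀ j, MonoidAlgebra F (G j)) (j₀ : I)
    (h : r j₀ ∈ Ring.jacobson (MonoidAlgebra F (G j₀))) :
    pureTensor K r ∈ Ring.jacobson (MonoidAlgebra K (∀ j, G j)) := by
  refine mem_jacobson_of_isNilpotent fun x => ?_
  let N (k : ℕ) := Submodule.span K {z : MonoidAlgebra K (∀ j, G j) |
    ∃ r : ∀ j, MonoidAlgebra F (G j),
      (∀ j, j = j₀ → r j ∈ Ring.jacobson (MonoidAlgebra F (G j)) ^ k) ∧ z = pureTensor K r}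
  have hN : ∀ k, (x * pureTensor K r) ^ k ∈ N k := by
    intro k
    induction k with
    | zero =>
      rw [pow_zero]
      refine Submodule.subset_span ⟨fun _ => 1, fun j _ => ?_, pureTensor_one.symm⟩
      rw [Submodule.pow_zero, Ideal.one_eq_top]; trivial
    | succ k ih =>
      rw [pow_succ', mul_assoc]
      refine mul_mem_span_pureTensor _ _ ?_
      generalize (x * pureTensor K r) ^ k = y at ih
      induction ih using Submodule.span_induction with
      | zero => rw [mul_zero]; exact zero_mem _
      | add a b _ _ ha hb => rw [mul_add]; exact add_mem ha hb
      | smul c a _ ha => rw [mul_smul_comm]; exact Submodule.smul_mem _ c ha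
      | mem z hz =>
        obtain ⟨r', hr', rfl⟩ := hz
        rw [← pureTensor_mul]
        refine Submodule.subset_span ⟨_, fun j hj => ?_, rfl⟩
        subst hj
        rw [Ideal.IsTwoSided.pow_succ]
        exact Ideal.mul_mem_mul h (hr' _ rfl)
  obtain ⟨k, hk⟩ := IsSemiprimaryRing.isNilpotent (R := MonoidAlgebra F (G j₀))
  refine ⟨k, ?_⟩
  have h1 : N k ≤ ⊥ := by
    refine Submodule.span_le.2 ?_
    rintro _ ⟨r', hr', rfl⟩
    refine pureTensor_eq_zero r' j₀ ?_
    have := hr' _ rfl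
    rw [hk] at this
    exact this
  exact h1 (hN k)

theorem pureTensor_sub_pure_mem_jacobson (a b : ∀ j, MonoidAlgebra F (G j))
    (h : ∀ j, a j - b j ∈ Ring.jacobson (MonoidAlgebra F (G j))) :
    pureTensor K a - pureTensor K b ∈ Ring.jacobson (MonoidAlgebra K (∀ j, G j)) := by
  suffices ∀ T : Finset I, pureTensor K (T.piecewise a b) - pureTensor K b ∈
      Ring.jacobson (MonoidAlgebra K (∀ j, G j)) by
    simpa using this Finset.univ
  intro T
  induction T using Finset.induction_on with
  | empty => rw [Finset.piecewise_empty, sub_self]; exact zero_mem _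
  | insert j T hj ih =>
    have h1 : pureTensor K (T.piecewise a b) = pureTensorHom (T.piecewise a b) j (b j) := by
      rw [pureTensorHom_apply]
      congr 1
      conv_lhs => rw [← Function.update_eq_self j (T.piecewise a b)]
      rw [Finset.piecewise_eq_of_notMem _ _ _ hj]
    rw [← sub_add_sub_cancel _ (pureTensor K (T.piecewise a b))]
    refine add_mem ?_ ih
    rw [Finset.piecewise_insert, ← pureTensorHom_apply, h1, ← map_sub, pureTensorHom_apply]
    refine pureTensor_mem_jacobson _ j ?_
    rw [Function.update_self]
    exact h j

omit [DecidableEq I] in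
theorem pureTensor_smul (c : I → F) (r : ∀ j, MonoidAlgebra F (G j)) :
    pureTensor K (fun j => c j • r j) = algebraMap F K (∏ j, c j) • pureTensor K r := by
  ext s
  simp [coeff_pureTensor, Finset.prod_mul_distrib]

/-- On group elements the scalar of the tensor product is the product of the scalars; replacing the
factors one at a time changes it only by elements of the radical. This is where splitting over the
prime field yields primitivity over `K`. -/
theorem isSplitIdem_pureTensor {f : ∀ j, MonoidAlgebra F (G j)} (hf : ∀ j, IsSplitIdem F (f j)) :
    IsSplitIdem K (pureTensor K f) := by
  refine ⟨fun h0 => ?_, ?_, fun x => ?_⟩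
  · have h1 : ∀ j, ∃ s, (f j).coeff s ≠ 0 := fun j => by
      by_contra! hno
      exact (hf j).ne_zero (by ext s; exact hno s)
    choose s hs using h1
    have := congrArg (fun x : MonoidAlgebra K (∀ j, G j) => x.coeff s) h0
    change (pureTensor K f).coeff s = 0 at this
    rw [coeff_pureTensor] at this
    exact Finset.prod_ne_zero_iff.2 (fun j _ => (_root_.map_ne_zero _).2 (hs j)) this
  · rw [← pureTensor_mul]
    congr 1
    funext j
    exact (hf j).idem
  · induction x using MonoidAlgebra.induction_on with
    | of s =>
      rw [← pureTensor_single (F := F), ← pureTensor_mul, ← pureTensor_mul]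
      choose c hc using fun j => (hf j).split (MonoidAlgebra.of F (G j) (s j))
      refine ⟨algebraMap F K (∏ j, c j), ?_⟩
      rw [← pureTensor_smul]
      exact pureTensor_sub_pure_mem_jacobson _ _ hc
    | add x y hx hy =>
      obtain ⟨c, hc⟩ := hx
      obtain ⟨d, hd⟩ := hy
      refine ⟨c + d, ?_⟩
      rw [mul_add, add_mul, add_smul, add_sub_add_comm]
      exact add_mem hc hd
    | smul a x hx =>
      obtain ⟨c, hc⟩ := hx
      refine ⟨a * c, ?_⟩
      rw [mul_smul_comm, smul_mul_assoc, mul_smul, ← smul_sub, Algebra.smul_def]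
      exact Ideal.mul_mem_left _ _ hc

/-- If the conclusion failed at `j₀`, every `f x f' y f` in that factor would lie in the radical,
hence so would the corresponding products of tensors, and then `pureTensor K f` itself. -/
theorem mem_twoSided_of_pureTensor {f f' : ∀ j, MonoidAlgebra F (G j)} (hf : ∀ j, IsSplitIdem F (f j))
    (h : pureTensor K f ∈ twoSided {pureTensor K f'}) (j₀ : I) : f j₀ ∈ twoSided {f' j₀} := by
  by_contra hno
  have hpf : IsSplitIdem K (pureTensor K f) := isSplitIdem_pureTensor hf
  have h1 : ∀ x y, f j₀ * (x * f' j₀ * y) * f j₀ ∈ Ring.jacobson _ := by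
    intro x y
    refine ((hf j₀).mem_or_exists_inv _).resolve_right ?_
    rintro ⟨d, hd⟩
    refine hno ?_
    rw [← hd, mul_assoc _ (f j₀) d]
    exact twoSided_mul_mem (mul_mul_mem_twoSided (Set.mem_singleton _) x y) _ _
  have h2 : ∀ x y, pureTensor K f * (x * pureTensor K f' * y) * pureTensor K f ∈ Ring.jacobson _ := by
    intro x y
    induction x using MonoidAlgebra.induction_on with
    | add a b ha hb => rw [add_mul, add_mul, mul_add, add_mul]; exact add_mem ha hb
    | smul c a ha =>
      rw [smul_mul_assoc, smul_mul_assoc, mul_smul_comm, smul_mul_assoc, Algebra.smul_def]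
      exact Ideal.mul_mem_left _ _ ha
    | of s =>
      induction y using MonoidAlgebra.induction_on with
      | add a b ha hb => rw [mul_add, mul_add, add_mul]; exact add_mem ha hb
      | smul c a ha =>
        rw [mul_smul_comm, mul_smul_comm, smul_mul_assoc, Algebra.smul_def]
        exact Ideal.mul_mem_left _ _ ha
      | of t =>
        rw [← pureTensor_single (F := F), ← pureTensor_single (F := F), ← pureTensor_mul, ← pureTensor_mul, ← pureTensor_mul,
          ← pureTensor_mul]
        exact pureTensor_mem_jacobson _ j₀ (h1 _ _)
  have h4 := mul_mul_mem_of_mem_twoSided _ h2 h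
  rw [hpf.idem, hpf.idem] at h4
  exact hpf.notMem h4

theorem pureTensor_mem_twoSided {S : ∀ j, Set (MonoidAlgebra F (G j))}
    (hS : ∀ j, (1 : MonoidAlgebra F (G j)) ∈ twoSided (S j)) (r : ∀ j, MonoidAlgebra F (G j)) :
    pureTensor K r ∈ twoSided {x | ∃ f : ∀ j, MonoidAlgebra F (G j), (∀ j, f j ∈ S j) ∧ x = pureTensor K f} := by
  -- `T` is the set of factors not yet expanded through the generators; with `T` empty the tensor is
  -- a single product.
  suffices ∀ (T : Finset I) (r : ∀ j, MonoidAlgebra F (G j)),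
      (∀ j, j ∉ T → ∃ s ∈ S j, ∃ a b, r j = a * s * b) → pureTensor K r ∈
        twoSided {x | ∃ f : ∀ j, MonoidAlgebra F (G j), (∀ j, f j ∈ S j) ∧ x = pureTensor K f} from
    this Finset.univ r fun j hj => absurd (Finset.mem_univ j) hj
  intro T
  induction T using Finset.induction_on with
  | empty =>
    intro r hr
    choose s hs a b hab using fun j => hr j (Finset.notMem_empty j)
    rw [funext hab, pureTensor_mul, pureTensor_mul]
    exact mul_mul_mem_twoSided (S := {x | ∃ f : ∀ j, MonoidAlgebra F (G j),
      (∀ j, f j ∈ S j) ∧ x = pureTensor K f}) ⟨s, hs, rfl⟩ _ _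
  | insert j T hj ih =>
    intro r hr
    have h1 : twoSided (S j) ≤ (twoSided {x | ∃ f : ∀ j, MonoidAlgebra F (G j),
        (∀ j, f j ∈ S j) ∧ x = pureTensor K f}).comap (pureTensorHom r j) := by
      refine (AddSubgroup.closure_le _).2 ?_
      rintro _ ⟨s, hs, a, b, rfl⟩
      refine ih _ fun k hk => ?_
      by_cases h : k = j
      · subst h
        rw [Function.update_self]
        exact ⟨s, hs, a, b, rfl⟩
      · rw [Function.update_of_ne h]
        exact hr k (by simp [h, hk])
    have h2 : r j ∈ twoSided (S j) := by
      simpa using twoSided_mul_mem (hS j) (r j) 1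
    have h3 := h1 h2
    rwa [AddSubgroup.mem_comap, pureTensorHom_apply, Function.update_eq_self] at h3

end Pure

end KSInterpolation

namespace KSInterpolation

/-! ### Crossed products over rings with a finite family of points -/

/-- A commutative ring with commuting actions of `Perm (Fin n)` and of `G`, whose reduction is
covered by points `θ i` indexed by functions `i : Fin n → I`, together with idempotents `e i`
separating the points. -/
structure PointSystem (K : Type*) [Field K] (G : Type*) [Group G] [MulSemiringAction G K]
    (I : Type*) [MulAction G I] (n : ℕ) (P : Type*) [CommRing P]
    [MulSemiringAction (Equiv.Perm (Fin n)) P] [MulSemiringAction G P] where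
  φ : K →+* K
  c : K →+* P
  gal_smul_c : ∀ (g : G) a, g • c a = c (g • a)
  perm_smul_c : ∀ (σ : Equiv.Perm (Fin n)) a, σ • c a = c a
  θ : (Fin n → I) → P →+* K
  θ_c : ∀ i a, θ i (c a) = φ a
  θ_perm_smul : ∀ i (σ : Equiv.Perm (Fin n)) y, θ i (σ • y) = θ (i ∘ σ) y
  θ_gal_smul : ∀ i (g : G) y, θ (g • i) (g • y) = g • θ i y
  isNilpotent : ∀ y, (∀ i, θ i y = 0) → IsNilpotent y
  e : (Fin n → I) → P
  e_idem : ∀ i, e i * e i = e i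
  θ_e_self : ∀ i, θ i (e i) = 1
  θ_e_of_ne : ∀ i i', i ≠ i' → θ i (e i') = 0

namespace PointSystem

open SkewMonoidAlgebra (single)

section Idempotents

variable {K : Type*} [Field K] {G : Type*} [Group G] [MulSemiringAction G K]
    {I : Type*} [MulAction G I] {n : ℕ} {P : Type*} [CommRing P]
    [MulSemiringAction (Equiv.Perm (Fin n)) P] [MulSemiringAction G P]
    (D : PointSystem K G I n P)

include D in
-- In a commutative ring idempotents are determined modulo nilpotents, so identities between them
-- can be tested at the points.
theorem eq_of_θ {z z' : P} (hz : z * z = z) (hz' : z' * z' = z') (h : ∀ i, D.θ i z = D.θ i z') :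
    z = z' :=
  eq_of_isNilpotent_sub_of_isIdempotentElem hz hz' (D.isNilpotent _ fun i => by
    rw [map_sub, h, sub_self])

theorem e_mul_e_of_ne {i i' : Fin n → I} (h : i ≠ i') : D.e i * D.e i' = 0 := by
  refine D.eq_of_θ (by rw [mul_mul_mul_comm, e_idem, e_idem]) (mul_zero _) fun j => ?_
  rw [map_mul, map_zero]
  rcases eq_or_ne j i with rfl | hj
  · rw [D.θ_e_of_ne _ _ h, mul_zero]
  · rw [D.θ_e_of_ne _ _ hj, zero_mul]

theorem sum_e [Fintype I] : ∑ i, D.e i = 1 := by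
  classical
  have h : OrthogonalIdempotents D.e := ⟨D.e_idem, fun i j hij => D.e_mul_e_of_ne hij⟩
  refine D.eq_of_θ h.isIdempotentElem_sum (mul_one _) fun i => ?_
  rw [map_sum, Finset.sum_eq_single i (fun j _ hj => D.θ_e_of_ne _ _ hj.symm) (by simp), θ_e_self,
    map_one]

theorem perm_smul_e (σ : Equiv.Perm (Fin n)) (i : Fin n → I) : σ • D.e i = D.e (i ∘ ⇑σ⁻¹) := by
  refine D.eq_of_θ (by rw [← smul_mul', e_idem]) (e_idem _ _) fun j => ?_
  rw [θ_perm_smul]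
  by_cases h : j ∘ σ = i
  · subst h
    have : (j ∘ σ) ∘ ⇑σ⁻¹ = j := by funext a; simp
    rw [θ_e_self, this, θ_e_self]
  · rw [D.θ_e_of_ne _ _ h, D.θ_e_of_ne]
    rintro rfl
    exact h (by funext a; simp)

theorem gal_smul_e (g : G) (i : Fin n → I) : g • D.e i = D.e (g • i) := by
  refine D.eq_of_θ (by rw [← smul_mul', e_idem]) (e_idem _ _) fun j => ?_
  obtain ⟨j, rfl⟩ : ∃ j', j = g • j' := ⟨g⁻¹ • j, by simp⟩
  rw [θ_gal_smul]
  by_cases h : j = i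
  · subst h
    rw [θ_e_self, θ_e_self, smul_one]
  · rw [D.θ_e_of_ne _ _ h, D.θ_e_of_ne, smul_zero]
    exact fun h' => h (smul_left_cancel g h')

variable {σ τ : Equiv.Perm (Fin n)} {i : Fin n → I}

theorem single_mul_single_e (σ : Equiv.Perm (Fin n)) (i : Fin n → I) :
    single σ (1 : P) * single 1 (D.e i) = single 1 (D.e (i ∘ ⇑σ⁻¹)) * single σ 1 := by
  rw [SkewMonoidAlgebra.single_mul_single, SkewMonoidAlgebra.single_mul_single, perm_smul_e]
  simp

theorem single_e_mul_single_e (i : Fin n → I) :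
    single (1 : Equiv.Perm (Fin n)) (D.e i) * single 1 (D.e i) = single 1 (D.e i) := by
  rw [SkewMonoidAlgebra.single_mul_single, one_smul, e_idem, one_mul]

omit [MulSemiringAction G P] in
theorem coeff_skew_mul (x y : SkewMonoidAlgebra P (Equiv.Perm (Fin n))) (τ : Equiv.Perm (Fin n)) :
    (x * y).coeff τ = ∑ σ, x.coeff σ * σ • y.coeff (σ⁻¹ * τ) := by
  rw [SkewMonoidAlgebra.coeff_mul_left, SkewMonoidAlgebra.sum_def,
    Finsupp.sum_fintype _ _ (by simp)]

/-- The nilradical is stable under permutations and nilpotent, so the coefficients of `x ^ k` lie in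
its `k`-th power. -/
theorem isNilpotent_of_coeff [IsNoetherianRing P] {x : SkewMonoidAlgebra P (Equiv.Perm (Fin n))}
    (h : ∀ σ, IsNilpotent (x.coeff σ)) : IsNilpotent x := by
  obtain ⟨N, hN⟩ := IsNoetherianRing.isNilpotent_nilradical P
  have hle : ∀ (k : ℕ) (σ : Equiv.Perm (Fin n)) (y : P), y ∈ nilradical P ^ k → σ • y ∈ nilradical P ^ k := by
    intro k σ
    have h1 : nilradical P ≤ (nilradical P).comap (MulSemiringAction.toRingHom _ P σ) := by
      intro y hy
      rw [Ideal.mem_comap, mem_nilradical]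
      exact (mem_nilradical.1 hy).map (MulSemiringAction.toRingHom _ P σ)
    exact fun y hy => (Ideal.pow_right_mono h1 k).trans (Ideal.le_comap_pow _ k) hy
  have hx : ∀ k σ, (x ^ k).coeff σ ∈ nilradical P ^ k := by
    intro k
    induction k with
    | zero => intro σ; rw [pow_zero, Ideal.one_eq_top]; trivial
    | succ k ih =>
      intro σ
      rw [pow_succ', pow_succ', coeff_skew_mul]
      exact sum_mem fun τ _ => Ideal.mul_mem_mul (mem_nilradical.2 (h τ)) (hle k τ _ (ih _))
  refine ⟨N, SkewMonoidAlgebra.ext fun σ => ?_⟩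
  have := hx N σ
  rw [hN] at this
  simpa using this

theorem coeff_eq (i : Fin n → I) {x : SkewMonoidAlgebra P (Equiv.Perm (Fin n))}
    (h1 : single 1 (D.e i) * x = x) (h2 : x * single 1 (D.e i) = x) (τ : Equiv.Perm (Fin n)) :
    x.coeff τ = D.e i * x.coeff τ * D.e (i ∘ ⇑τ⁻¹) := by
  conv_lhs => rw [← h2, ← h1, SkewMonoidAlgebra.coeff_mul_single_one,
    SkewMonoidAlgebra.coeff_single_one_mul, perm_smul_e]

end Idempotents

section Stabilizer

variable {K : Type*} [Field K] {G : Type*} [Group G] [MulSemiringAction G K]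
    {I : Type*} [MulAction G I] {n : ℕ} {P : Type*} [CommRing P]
    [MulSemiringAction (Equiv.Perm (Fin n)) P] [MulSemiringAction G P]
    (D : PointSystem K G I n P) (i : Fin n → I) {H : Type*} [Group H] [Fintype H]
    (emb : H →* Equiv.Perm (Fin n))

/-- The embedding of the group algebra of a group of permutations in the crossed product. -/
noncomputable def ι : MonoidAlgebra K H →+* SkewMonoidAlgebra P (Equiv.Perm (Fin n)) :=
  MonoidAlgebra.liftNCRingHom (SkewMonoidAlgebra.singleOneRingHom.comp D.c)
    ((SkewMonoidAlgebra.of P (Equiv.Perm (Fin n))).comp emb) (fun a s => by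
      simp [SkewMonoidAlgebra.singleOneRingHom, SkewMonoidAlgebra.of, Commute, SemiconjBy,
        SkewMonoidAlgebra.single_mul_single, perm_smul_c])

omit [Fintype H] in
theorem ι_single (s : H) (a : K) : D.ι emb (MonoidAlgebra.single s a) = single (emb s) (D.c a) := by
  simp [ι, MonoidAlgebra.liftNCRingHom, SkewMonoidAlgebra.singleOneRingHom,
    SkewMonoidAlgebra.single_mul_single, SkewMonoidAlgebra.of]

theorem ι_eq_sum (x : MonoidAlgebra K H) :
    D.ι emb x = ∑ s, single (emb s) (D.c (x.coeff s)) := by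
  conv_lhs => rw [← MonoidAlgebra.sum_coeff_single x, Finsupp.sum_fintype _ _ (by simp), map_sum]
  simp only [ι_single]

/-- Evaluation of coefficients at a point. -/
noncomputable def ψ : SkewMonoidAlgebra P (Equiv.Perm (Fin n)) →+ MonoidAlgebra K H :=
  AddMonoidHom.mk' (fun x => MonoidAlgebra.ofCoeff (Finsupp.equivFunOnFinite.symm
    fun s => D.θ i (x.coeff (emb s)))) (fun x y => by
      ext s
      change D.θ i ((x + y).coeff (emb s)) = D.θ i (x.coeff (emb s)) + D.θ i (y.coeff (emb s))
      rw [SkewMonoidAlgebra.coeff_add, Finsupp.add_apply, map_add])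

theorem coeff_ψ (x : SkewMonoidAlgebra P (Equiv.Perm (Fin n))) (s : H) :
    (D.ψ i emb x).coeff s = D.θ i (x.coeff (emb s)) := rfl

variable {i emb} (hinj : Function.Injective emb) (hi : ∀ σ : Equiv.Perm (Fin n), i ∘ ⇑σ = i ↔ ∃ s, σ = emb s)

include hi

omit [Fintype H] in
theorem single_e_commute_ι (x : MonoidAlgebra K H) :
    single 1 (D.e i) * D.ι emb x = D.ι emb x * single 1 (D.e i) := by
  have hs : ∀ s, i ∘ ⇑(emb s)⁻¹ = i := fun s => (hi _).2 ⟨s⁻¹, (map_inv _ _).symm⟩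
  induction x using MonoidAlgebra.induction_linear with
  | zero => rw [map_zero, mul_zero, zero_mul]
  | add x y hx hy => rw [map_add, mul_add, add_mul, hx, hy]
  | single s a =>
    rw [ι_single, SkewMonoidAlgebra.single_mul_single, SkewMonoidAlgebra.single_mul_single,
      perm_smul_e, hs, one_smul, one_mul, mul_one, mul_comm]

include hinj

/-- At the point `i`, the coefficients of `y` twisted by `σ` are evaluated at `i ∘ σ`. They vanish
there unless `σ` stabilizes `i`, because `y` is a left multiple of `e_i`; what remains is the
product in the group algebra of the stabilizer. -/
theorem ψ_mul (x : SkewMonoidAlgebra P (Equiv.Perm (Fin n)))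
    {y : SkewMonoidAlgebra P (Equiv.Perm (Fin n))} (hy : single 1 (D.e i) * y = y) :
    D.ψ i emb (x * y) = D.ψ i emb x * D.ψ i emb y := by
  classical
  ext t
  rw [coeff_mul_eq_sum, coeff_ψ, coeff_skew_mul, map_sum]
  simp only [coeff_ψ, map_mul, θ_perm_smul, map_inv]
  have h0 : ∀ σ : Equiv.Perm (Fin n), i ∘ ⇑σ ≠ i → ∀ τ, D.θ (i ∘ σ) (y.coeff τ) = 0 := by
    intro σ hσ τ
    rw [← hy, SkewMonoidAlgebra.coeff_single_one_mul, map_mul, D.θ_e_of_ne _ _ hσ, zero_mul]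
  symm
  rw [← Finset.sum_image (s := Finset.univ) (g := emb)
    (f := fun σ => D.θ i (x.coeff σ) * D.θ i (y.coeff (σ⁻¹ * emb t)))]
  · refine Finset.sum_subset_zero_on_sdiff (Finset.subset_univ _) (fun σ hσ => ?_) fun σ hσ => ?_
    · rw [h0, mul_zero]
      intro h
      obtain ⟨s, rfl⟩ := (hi σ).1 h
      simp at hσ
    · obtain ⟨s, -, rfl⟩ := Finset.mem_image.1 hσ
      rw [(hi _).2 ⟨s, rfl⟩]
  · exact fun a _ b _ h => hinj h

-- Constants are evaluated through `φ`, a power of Frobenius in the application, so the coefficients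
-- must be fixed by `φ`; those from the prime field are.
omit hi in
theorem ψ_single_e_mul_ι {x : MonoidAlgebra K H} (hx : ∀ s, D.φ (x.coeff s) = x.coeff s) :
    D.ψ i emb (single 1 (D.e i) * D.ι emb x) = x := by
  classical
  ext s
  rw [coeff_ψ, SkewMonoidAlgebra.coeff_single_one_mul, map_mul, θ_e_self, one_mul, ι_eq_sum]
  have : ∀ (T : Finset H) (f : H → SkewMonoidAlgebra P (Equiv.Perm (Fin n))) (σ),
      (∑ t ∈ T, f t).coeff σ = ∑ t ∈ T, (f t).coeff σ := fun T f σ =>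
    map_sum ((Finsupp.applyAddHom σ).comp SkewMonoidAlgebra.coeffAddEquiv.toAddMonoidHom) f T
  rw [this, Finset.sum_eq_single s]
  · rw [SkewMonoidAlgebra.coeff_single, Finsupp.single_eq_same, θ_c, hx]
  · intro t _ ht
    rw [SkewMonoidAlgebra.coeff_single, Finsupp.single_eq_of_ne]
    exact fun h => ht (hinj h.symm)
  · simp

-- In the corner of `e_i`, coefficients vanish at all points except `i`, and at `i` unless the
-- permutation stabilizes `i`. So evaluation at `i` detects everything modulo nilpotents.
omit [Fintype H] hinj in
theorem isNilpotent_of_ψ [Fintype H] [IsNoetherianRing P]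
    {x : SkewMonoidAlgebra P (Equiv.Perm (Fin n))}
    (h1 : single 1 (D.e i) * x = x) (h2 : x * single 1 (D.e i) = x) (h : D.ψ i emb x = 0) :
    IsNilpotent x := by
  refine isNilpotent_of_coeff fun τ => D.isNilpotent _ fun j => ?_
  rw [D.coeff_eq i h1 h2, map_mul, map_mul]
  by_cases hj : j = i
  · subst hj
    by_cases hτ : j = j ∘ ⇑τ⁻¹
    · obtain ⟨s, hs⟩ := (hi _).1 hτ.symm
      have := congrArg (fun x => MonoidAlgebra.coeff x s⁻¹) h
      change D.θ j (x.coeff (emb s⁻¹)) = 0 at this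
      rw [map_inv, ← hs, inv_inv] at this
      rw [this, mul_zero, zero_mul]
    · rw [D.θ_e_of_ne _ _ hτ, mul_zero]
  · rw [D.θ_e_of_ne _ _ hj, zero_mul, zero_mul]

end Stabilizer

end PointSystem

end KSInterpolation

namespace KSInterpolation

/-! ### Young subgroups -/

section Young

variable {I : Type*} [Fintype I] (m : I → ℕ)

/-- A partition of `Fin (∑ j, m j)` into blocks of sizes `m j`. -/
noncomputable def blockEquiv : Fin (∑ j, m j) ≃ Σ j, Fin (m j) :=
  Fintype.equivOfCardEq (by simp)

/-- The index of the block of an element. -/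
noncomputable def block (a : Fin (∑ j, m j)) : I := (blockEquiv m a).1

/-- The product of the symmetric groups of the blocks as a group of permutations. -/
noncomputable def youngHom :
    (∀ j, Equiv.Perm (Fin (m j))) →* Equiv.Perm (Fin (∑ j, m j)) :=
  MonoidHom.mk' (fun s => (blockEquiv m).symm.permCongr (Equiv.sigmaCongrRight s))
    (fun s t => by ext a; simp)

theorem youngHom_apply (s : ∀ j, Equiv.Perm (Fin (m j))) (a : Fin (∑ j, m j)) :
    youngHom m s a = (blockEquiv m).symm ⟨(blockEquiv m a).1, s _ (blockEquiv m a).2⟩ := rfl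

theorem youngHom_injective : Function.Injective (youngHom m) := by
  intro s t h
  funext j
  ext1 a
  have := DFunLike.congr_fun h ((blockEquiv m).symm ⟨j, a⟩)
  rw [youngHom_apply, youngHom_apply, Equiv.apply_eq_iff_eq, Equiv.apply_symm_apply] at this
  exact eq_of_heq (Sigma.mk.inj_iff.1 this).2

theorem block_comp_eq_iff (σ : Equiv.Perm (Fin (∑ j, m j))) :
    block m ∘ ⇑σ = block m ↔ ∃ s, σ = youngHom m s := by
  constructor
  · intro h
    have h1 : ∀ j a, ∃ b, blockEquiv m (σ ((blockEquiv m).symm ⟨j, a⟩)) = ⟨j, b⟩ := by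
      intro j a
      have h2 := congrFun h ((blockEquiv m).symm ⟨j, a⟩)
      simp only [Function.comp_apply, block, Equiv.apply_symm_apply] at h2
      generalize blockEquiv m (σ ((blockEquiv m).symm ⟨j, a⟩)) = x at h2
      obtain ⟨j', b⟩ := x
      subst h2
      exact ⟨b, rfl⟩
    choose s hs using h1
    have hinj : ∀ j, Function.Injective (s j) := by
      intro j a b hab
      have := (hs j a).trans ((congrArg (Sigma.mk j) hab).trans (hs j b).symm)
      simpa using this
    refine ⟨fun j => Equiv.ofBijective (s j) (Finite.injective_iff_bijective.1 (hinj j)), ?_⟩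
    ext1 a
    rw [youngHom_apply, Equiv.eq_symm_apply]
    have := hs (blockEquiv m a).1 (blockEquiv m a).2
    simpa using this
  · rintro ⟨s, rfl⟩
    funext a
    simp [block, youngHom_apply]

variable {m} in
theorem exists_comp_perm {i : Fin (∑ j, m j) → I} [DecidableEq I]
    (h : ∀ j, Fintype.card {a // i a = j} = m j) :
    ∃ σ : Equiv.Perm (Fin (∑ j, m j)), i = block m ∘ ⇑σ := by
  let e : Fin (∑ j, m j) ≃ Σ j, Fin (m j) := (Equiv.sigmaFiberEquiv i).symm.trans
    (Equiv.sigmaCongrRight fun j => Fintype.equivFinOfCardEq (h j))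
  refine ⟨e.trans (blockEquiv m).symm, ?_⟩
  funext a
  simp [block, e, Equiv.sigmaFiberEquiv]

theorem card_block [DecidableEq I] (j : I) : Fintype.card {a // block m a = j} = m j := by
  rw [← Fintype.card_fin (m j)]
  refine Fintype.card_congr (((blockEquiv m).subtypeEquiv fun a => Iff.rfl).trans
    (Equiv.sigmaSubtype j))

variable {m} {G : Type*} [Group G] [MulAction G I]

/-- The action of a group on the index set, as a permutation of the union of the blocks. -/
noncomputable def blockPerm (g : G) (h : ∀ j, m (g • j) = m j) : Equiv.Perm (Fin (∑ j, m j)) :=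
  (blockEquiv m).symm.permCongr
    (Equiv.sigmaCongr (MulAction.toPerm g) fun j => finCongr (h j).symm)

theorem blockPerm_apply (g : G) (h : ∀ j, m (g • j) = m j) (a : Fin (∑ j, m j)) :
    blockPerm g h a = (blockEquiv m).symm
      ⟨g • (blockEquiv m a).1, Fin.cast (h _).symm (blockEquiv m a).2⟩ := rfl

theorem block_blockPerm (g : G) (h : ∀ j, m (g • j) = m j) :
    block m ∘ ⇑(blockPerm g h) = g • block m := by
  funext a
  simp [block, blockPerm_apply]

omit [Fintype I] in
theorem sigma_fin_ext {x y : Σ j, Fin (m j)} (h : x.1 = y.1) (h' : (x.2 : ℕ) = y.2) : x = y := by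
  obtain ⟨j, a⟩ := x
  obtain ⟨j', a'⟩ := y
  obtain rfl : j = j' := h
  exact congrArg _ (Fin.ext h')

theorem blockPerm_one (h : ∀ j, m ((1 : G) • j) = m j) : blockPerm (1 : G) h = 1 := by
  ext1 a
  rw [blockPerm_apply, Equiv.symm_apply_eq]
  exact sigma_fin_ext (one_smul _ _) rfl

/-- Blocks are moved without changing positions inside them, so the permutations compose strictly.
This is why the cocycle in `exists_cocycle_labelFamily` has no defect. -/
theorem blockPerm_mul (g g' : G) (h : ∀ j, m (g • j) = m j) (h' : ∀ j, m (g' • j) = m j)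
    (h'' : ∀ j, m ((g * g') • j) = m j) :
    blockPerm (g * g') h'' = blockPerm g h * blockPerm g' h' := by
  ext1 a
  rw [Equiv.Perm.mul_apply, blockPerm_apply, blockPerm_apply, blockPerm_apply,
    Equiv.apply_symm_apply]
  exact congrArg _ (sigma_fin_ext (mul_smul _ _ _) rfl)

/-- The conjugation by `blockPerm g h` on products of permutations of the blocks. -/
def blockConj (g : G) (h : ∀ j, m (g • j) = m j) :
    (∀ j, Equiv.Perm (Fin (m j))) ≃ ∀ j, Equiv.Perm (Fin (m j)) :=
  (MulAction.toPerm g).piCongr fun j => (finCongr (h j).symm).permCongr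

omit [Fintype I] in
theorem blockConj_apply (g : G) (h : ∀ j, m (g • j) = m j) (s : ∀ j, Equiv.Perm (Fin (m j)))
    (j : I) : blockConj g h s (g • j) = (finCongr (h j).symm).permCongr (s j) :=
  Equiv.piCongr_apply_apply _ _ _ _

theorem blockPerm_mul_youngHom (g : G) (h : ∀ j, m (g • j) = m j)
    (s : ∀ j, Equiv.Perm (Fin (m j))) :
    blockPerm g h * youngHom m s = youngHom m (blockConj g h s) * blockPerm g h := by
  ext1 a
  rw [Equiv.Perm.mul_apply, Equiv.Perm.mul_apply, blockPerm_apply, youngHom_apply, youngHom_apply,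
    blockPerm_apply, Equiv.apply_symm_apply, Equiv.apply_symm_apply, blockConj_apply]
  rfl

/-- Transport of a group algebra along an equality. -/
def castPermAlgebra {F : Type*} [Semiring F] {a b : ℕ} (h : a = b) :
    MonoidAlgebra F (Equiv.Perm (Fin a)) ≃ MonoidAlgebra F (Equiv.Perm (Fin b)) :=
  Equiv.cast (by rw [h])

theorem coeff_castPermAlgebra {F : Type*} [Semiring F] {a b : ℕ} (h : a = b)
    (x : MonoidAlgebra F (Equiv.Perm (Fin a))) (s : Equiv.Perm (Fin a)) :
    (castPermAlgebra h x).coeff ((finCongr h).permCongr s) = x.coeff s := by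
  subst h; rfl

theorem castPermAlgebra_mem {F : Type*} [Semiring F] {a b : ℕ} (h : a = b)
    {S : ∀ k, Set (MonoidAlgebra F (Equiv.Perm (Fin k)))}
    {x : MonoidAlgebra F (Equiv.Perm (Fin a))} (hx : x ∈ S a) : castPermAlgebra h x ∈ S b := by
  subst h; exact hx

/-- The action of a group on the index set, on families of elements of group algebras. -/
def blockTransport {F : Type*} [Semiring F] (g : G) (h : ∀ j, m (g • j) = m j) :
    (∀ j, MonoidAlgebra F (Equiv.Perm (Fin (m j)))) ≃
      ∀ j, MonoidAlgebra F (Equiv.Perm (Fin (m j))) :=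
  (MulAction.toPerm g).piCongr fun j => castPermAlgebra (h j).symm

omit [Fintype I] in
theorem blockTransport_apply {F : Type*} [Semiring F] (g : G) (h : ∀ j, m (g • j) = m j)
    (f : ∀ j, MonoidAlgebra F (Equiv.Perm (Fin (m j)))) (j : I) :
    blockTransport g h f (g • j) = castPermAlgebra (h j).symm (f j) :=
  Equiv.piCongr_apply_apply _ _ _ _

omit [Fintype I] in
theorem blockTransport_mem {F : Type*} [Semiring F] (g : G) (h : ∀ j, m (g • j) = m j)
    {S : ∀ k, Set (MonoidAlgebra F (Equiv.Perm (Fin k)))}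
    {f : ∀ j, MonoidAlgebra F (Equiv.Perm (Fin (m j)))} (hf : ∀ j, f j ∈ S (m j)) (j : I) :
    blockTransport g h f j ∈ S (m j) := by
  obtain ⟨j, rfl⟩ := MulAction.surjective g j
  rw [blockTransport_apply]
  exact castPermAlgebra_mem _ (hf j)

theorem coeff_pureTensor_blockTransport {F K : Type*} [Field F] [Field K] [Algebra F K] (g : G)
    (h : ∀ j, m (g • j) = m j) (f : ∀ j, MonoidAlgebra F (Equiv.Perm (Fin (m j))))
    (s : ∀ j, Equiv.Perm (Fin (m j))) :
    (pureTensor K (blockTransport g h f)).coeff (blockConj g h s) = (pureTensor K f).coeff s := by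
  rw [coeff_pureTensor, coeff_pureTensor, ← Equiv.prod_comp (MulAction.toPerm g)]
  refine Finset.prod_congr rfl fun j _ => ?_
  rw [MulAction.toPerm_apply, blockTransport_apply, blockConj_apply, coeff_castPermAlgebra]

end Young

end KSInterpolation

namespace KSInterpolation

namespace PointSystem

open SkewMonoidAlgebra (single)

/-! ### Primitive idempotents of the crossed products -/

section Label

variable {F K : Type*} [Field F] [Field K] [Algebra F K] {G : Type*} [Group G]
  [MulSemiringAction G K] {I : Type*} [Fintype I] [DecidableEq I] [MulAction G I] {m : I → ℕ}
  {P : Type*} [CommRing P] [MulSemiringAction (Equiv.Perm (Fin (∑ j, m j))) P]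
  [MulSemiringAction G P] (D : PointSystem K G I (∑ j, m j) P)

/-- The idempotent attached to idempotents of the group algebras of the symmetric groups of
the blocks. -/
noncomputable def labelIdem (f : ∀ j, MonoidAlgebra F (Equiv.Perm (Fin (m j)))) :
    SkewMonoidAlgebra P (Equiv.Perm (Fin (∑ j, m j))) :=
  single 1 (D.e (block m)) * D.ι (youngHom m) (pureTensor K f)

variable {f : ∀ j, MonoidAlgebra F (Equiv.Perm (Fin (m j)))}

omit [DecidableEq I] in
theorem single_e_mul_labelIdem (f : ∀ j, MonoidAlgebra F (Equiv.Perm (Fin (m j)))) :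
    single 1 (D.e (block m)) * D.labelIdem f = D.labelIdem f := by
  rw [labelIdem, ← mul_assoc, single_e_mul_single_e]

omit [DecidableEq I] in
theorem labelIdem_mul_single_e (f : ∀ j, MonoidAlgebra F (Equiv.Perm (Fin (m j)))) :
    D.labelIdem f * single 1 (D.e (block m)) = D.labelIdem f := by
  rw [labelIdem, mul_assoc, ← D.single_e_commute_ι (block_comp_eq_iff m), ← mul_assoc,
    single_e_mul_single_e]

omit [DecidableEq I] in
theorem labelIdem_idem (hf : ∀ j, f j * f j = f j) :
    D.labelIdem f * D.labelIdem f = D.labelIdem f := by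
  conv_lhs => rw [labelIdem, mul_assoc, ← mul_assoc (D.ι _ _),
    ← D.single_e_commute_ι (block_comp_eq_iff m), mul_assoc, ← mul_assoc, single_e_mul_single_e,
    ← map_mul, ← pureTensor_mul]
  simp only [hf]
  rfl

variable (hF : ∀ g : K →+* K, g.comp (algebraMap F K) = algebraMap F K)

include hF

omit [DecidableEq I] in
theorem map_coeff_pureTensor (g : K →+* K) (s : ∀ j, Equiv.Perm (Fin (m j))) :
    g ((pureTensor K f).coeff s) = (pureTensor K f).coeff s := by
  rw [coeff_pureTensor, map_prod]
  exact Finset.prod_congr rfl fun j _ => DFunLike.congr_fun (hF g) _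

theorem ψ_labelIdem (f : ∀ j, MonoidAlgebra F (Equiv.Perm (Fin (m j)))) :
    D.ψ (block m) (youngHom m) (D.labelIdem f) = pureTensor K f :=
  D.ψ_single_e_mul_ι (youngHom_injective m) fun s => map_coeff_pureTensor hF D.φ s

theorem labelIdem_ne_zero (hf : ∀ j, IsSplitIdem F (f j)) : D.labelIdem f ≠ 0 := by
  intro h
  have h1 := D.ψ_labelIdem hF f
  rw [h, map_zero] at h1
  exact (isSplitIdem_pureTensor (K := K) hf).ne_zero h1.symm

/-- On the corner, `ψ` is multiplicative with nil kernel and sends the idempotent to a primitive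
one. So `ψ z` is `0` or that image, and `z` or its complement is a nilpotent idempotent. -/
theorem labelIdem_primitive [IsNoetherianRing P] (hf : ∀ j, IsSplitIdem F (f j))
    {z : SkewMonoidAlgebra P (Equiv.Perm (Fin (∑ j, m j)))} (hz : z * z = z)
    (h1 : D.labelIdem f * z = z) (h2 : z * D.labelIdem f = z) : z = 0 ∨ z = D.labelIdem f := by
  have hE1 : single 1 (D.e (block m)) * z = z := by
    rw [← h1, ← mul_assoc, single_e_mul_labelIdem]
  have hE2 : z * single 1 (D.e (block m)) = z := by
    rw [← h2, mul_assoc, labelIdem_mul_single_e]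
  have hmul := D.ψ_mul (youngHom_injective m) (block_comp_eq_iff m)
  have hprim := (isSplitIdem_pureTensor (K := K) hf).isPrimitiveIdem
  have hnil : ∀ x : SkewMonoidAlgebra P (Equiv.Perm (Fin (∑ j, m j))), x * x = x →
      IsNilpotent x → x = 0 := by
    rintro x hx ⟨N, hN⟩
    rcases N.eq_zero_or_pos with rfl | hpos
    · rw [pow_zero] at hN
      rw [← mul_one x, hN, mul_zero]
    · have hxx : IsIdempotentElem x := hx
      rw [← hN, hxx.pow_eq hpos.ne']
  have hψ := hprim.eq_zero_or_eq (D.ψ (block m) (youngHom m) z) (by rw [← hmul _ hE1, hz])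
    (by rw [← D.ψ_labelIdem hF f, ← hmul _ hE1, h1])
    (by rw [← D.ψ_labelIdem hF f, ← hmul _ (D.single_e_mul_labelIdem f), h2])
  rcases hψ with h0 | h0
  · exact Or.inl (hnil z hz (D.isNilpotent_of_ψ (block_comp_eq_iff m) hE1 hE2 h0))
  · right
    symm
    rw [← sub_eq_zero]
    have hyy := D.labelIdem_idem fun j => (hf j).idem
    refine hnil _ ?_ (D.isNilpotent_of_ψ (block_comp_eq_iff m) ?_ ?_ ?_)
    · rw [sub_mul, mul_sub, mul_sub, h1, h2, hz, hyy, sub_self, sub_zero]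
    · rw [mul_sub, hE1, single_e_mul_labelIdem]
    · rw [sub_mul, hE2, labelIdem_mul_single_e]
    · rw [map_sub, D.ψ_labelIdem hF f, h0, sub_self]

omit hF in
theorem single_e_mem_twoSided {S : ∀ k, Set (MonoidAlgebra F (Equiv.Perm (Fin k)))}
    (hS : ∀ k, (1 : MonoidAlgebra F (Equiv.Perm (Fin k))) ∈ twoSided (S k)) :
    single 1 (D.e (block m)) ∈ twoSided {x | ∃ f : ∀ j, MonoidAlgebra F (Equiv.Perm (Fin (m j))),
      (∀ j, f j ∈ S (m j)) ∧ x = D.labelIdem f} := by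
  have h1 := pureTensor_mem_twoSided (K := K) (fun j => hS (m j)) fun _ => 1
  rw [pureTensor_one] at h1
  have h2 : twoSided {x | ∃ f : ∀ j, MonoidAlgebra F (Equiv.Perm (Fin (m j))),
      (∀ j, f j ∈ S (m j)) ∧ x = pureTensor K f} ≤
      (twoSided {x | ∃ f : ∀ j, MonoidAlgebra F (Equiv.Perm (Fin (m j))),
        (∀ j, f j ∈ S (m j)) ∧ x = D.labelIdem f}).comap
        ((AddMonoidHom.mulLeft (single 1 (D.e (block m)))).comp
          (D.ι (youngHom m)).toAddMonoidHom) := by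
    refine (AddSubgroup.closure_le _).2 ?_
    rintro _ ⟨_, ⟨f, hf, rfl⟩, a, b, rfl⟩
    change single 1 (D.e (block m)) * D.ι (youngHom m) (a * pureTensor K f * b) ∈ twoSided _
    rw [map_mul, map_mul, ← mul_assoc, ← mul_assoc, D.single_e_commute_ι (block_comp_eq_iff m),
      mul_assoc _ (single _ _)]
    have hm : D.labelIdem f ∈ {x | ∃ f : ∀ j, MonoidAlgebra F (Equiv.Perm (Fin (m j))),
        (∀ j, f j ∈ S (m j)) ∧ x = D.labelIdem f} := ⟨f, hf, rfl⟩
    exact mul_mul_mem_twoSided hm _ _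
  have h3 := h2 h1
  rw [AddSubgroup.mem_comap] at h3
  change single 1 (D.e (block m)) * D.ι (youngHom m) 1 ∈ twoSided _ at h3
  rwa [map_one, mul_one] at h3

omit hF in
theorem single_blockPerm_mul_ι (g : G) (h : ∀ j, m (g • j) = m j) :
    single (blockPerm g h) (1 : P) * D.ι (youngHom m) (pureTensor K f) =
      D.ι (youngHom m) (pureTensor K (blockTransport g h f)) * single (blockPerm g h) 1 := by
  rw [ι_eq_sum, ι_eq_sum, Finset.mul_sum, Finset.sum_mul]
  refine Fintype.sum_equiv (blockConj g h) _ _ fun s => ?_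
  rw [SkewMonoidAlgebra.single_mul_single, SkewMonoidAlgebra.single_mul_single,
    coeff_pureTensor_blockTransport, blockPerm_mul_youngHom, perm_smul_c]
  simp

variable {g : G} {r : SkewMonoidAlgebra P (Equiv.Perm (Fin (∑ j, m j))) →+*
    SkewMonoidAlgebra P (Equiv.Perm (Fin (∑ j, m j)))}
  (hr : ∀ σ a, r (single σ a) = single σ (g • a))

include hr

theorem map_labelIdem (f : ∀ j, MonoidAlgebra F (Equiv.Perm (Fin (m j)))) :
    r (D.labelIdem f) = single 1 (D.e (g • block m)) * D.ι (youngHom m) (pureTensor K f) := by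
  rw [labelIdem, map_mul, hr, gal_smul_e, ι_eq_sum, map_sum]
  congr 1
  refine Finset.sum_congr rfl fun s _ => ?_
  rw [hr, gal_smul_c]
  congr 2
  exact map_coeff_pureTensor hF (MulSemiringAction.toRingHom G K g) s

/-- The coefficients of the `f j` lie in the prime field, so `g` moves only the point `block m`. The
block permutation moves it back, at the price of permuting the family `f`. -/
theorem single_blockPerm_mul_map_labelIdem (h : ∀ j, m (g • j) = m j)
    (f : ∀ j, MonoidAlgebra F (Equiv.Perm (Fin (m j)))) :
    single (blockPerm g h) (1 : P) * r (D.labelIdem f) =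
      D.labelIdem (blockTransport g h f) * single (blockPerm g h) 1 := by
  have hb : (g • block m) ∘ ⇑(blockPerm g h)⁻¹ = block m := by
    rw [← block_blockPerm g h]
    funext a
    simp
  rw [D.map_labelIdem hF hr, ← mul_assoc, single_mul_single_e, hb, mul_assoc,
    single_blockPerm_mul_ι, ← mul_assoc, labelIdem]

/-- The relation makes `e_i a g(e_i)` nonzero, so some permutation carries `g • i` to `i`; then `g`
preserves the sizes of the fibres. -/
theorem apply_smul_of_labelIdem_eq (hf : ∀ j, IsSplitIdem F (f j))
    {a b : SkewMonoidAlgebra P (Equiv.Perm (Fin (∑ j, m j)))}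
    (hab : D.labelIdem f = a * r (D.labelIdem f) * b) (j : I) : m (g • j) = m j := by
  have hne : single 1 (D.e (block m)) * a * single 1 (D.e (g • block m)) ≠ 0 := by
    intro h0
    refine D.labelIdem_ne_zero hF hf ?_
    rw [← single_e_mul_labelIdem, hab, D.map_labelIdem hF hr, ← mul_assoc, ← mul_assoc,
      ← mul_assoc, h0, zero_mul, zero_mul]
  obtain ⟨σ, hσ⟩ : ∃ σ, (single 1 (D.e (block m)) * a *
      single 1 (D.e (g • block m))).coeff σ ≠ 0 := by
    by_contra! hno
    exact hne (SkewMonoidAlgebra.ext hno)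
  rw [SkewMonoidAlgebra.coeff_mul_single_one, SkewMonoidAlgebra.coeff_single_one_mul,
    perm_smul_e, mul_right_comm] at hσ
  have h1 : block m = (g • block m) ∘ ⇑σ⁻¹ := by
    by_contra hno
    exact hσ (by rw [D.e_mul_e_of_ne hno, zero_mul])
  rw [← card_block m j, ← card_block m (g • j)]
  refine Fintype.card_congr (σ⁻¹.subtypeEquiv fun a => ?_)
  conv_lhs => rw [h1]
  simp

/-- Moving the block permutation through the relation and applying `ψ` puts the tensor of the `f j`
in the ideal of the transported tensor. This descends to each factor, and distinct members of `S`
are not related in this way. -/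
theorem blockTransport_eq_of_labelIdem_eq {S : ∀ k, Set (MonoidAlgebra F (Equiv.Perm (Fin k)))}
    (hS : ∀ k, ∀ x ∈ S k, IsSplitIdem F x)
    (hS' : ∀ k, ∀ x ∈ S k, ∀ y ∈ S k, x ∈ twoSided {y} → x = y)
    (hf : ∀ j, f j ∈ S (m j)) {a b : SkewMonoidAlgebra P (Equiv.Perm (Fin (∑ j, m j)))}
    (hab : D.labelIdem f = a * r (D.labelIdem f) * b) (h : ∀ j, m (g • j) = m j) :
    blockTransport g h f = f := by
  have hmul := D.ψ_mul (youngHom_injective m) (block_comp_eq_iff m)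
  set t := single (blockPerm g h) (1 : P) with ht
  set t' := single (blockPerm g h)⁻¹ (1 : P) with ht'
  have htt : t' * t = 1 := by
    rw [ht, ht', SkewMonoidAlgebra.single_mul_single, smul_one, inv_mul_cancel, mul_one]; rfl
  set E := single (1 : Equiv.Perm (Fin (∑ j, m j))) (D.e (block m)) with hE
  have hfE := D.labelIdem_mul_single_e f
  have hEf := D.single_e_mul_labelIdem f
  set f' := blockTransport g h f with hf'
  have key : D.labelIdem f = (a * t') * (D.labelIdem f' * (E * (t * b * E))) := by
    calc D.labelIdem f = a * ((t' * t) * r (D.labelIdem f)) * b * E := by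
          rw [htt, one_mul, ← hab, hfE]
      _ = (a * t') * (D.labelIdem f' * (t * b * E)) := by
          rw [mul_assoc t', D.single_blockPerm_mul_map_labelIdem hF hr h f]
          simp only [mul_assoc]; rfl
      _ = _ := by rw [← mul_assoc _ E, D.labelIdem_mul_single_e]
  have h1 := congrArg (D.ψ (block m) (youngHom m)) key
  have hE2 : E * (E * (t * b * E)) = E * (t * b * E) := by
    rw [← mul_assoc, hE, single_e_mul_single_e]
  rw [D.ψ_labelIdem hF, hmul _ (by rw [← mul_assoc, D.single_e_mul_labelIdem]), hmul _ hE2,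
    D.ψ_labelIdem hF, ← mul_assoc] at h1
  funext j
  refine (hS' _ _ (hf j) _ (blockTransport_mem g h hf j) ?_).symm
  refine mem_twoSided_of_pureTensor (K := K) (fun j => hS _ _ (hf j)) ?_ j
  rw [h1]
  exact mul_mul_mem_twoSided (Set.mem_singleton _) _ _

end Label

end PointSystem

end KSInterpolation

namespace KSInterpolation

namespace PointSystem

open SkewMonoidAlgebra (single)
open KSInterpolation.RingActions (ρ)
open KSInterpolation.StrictAction (T)

/-! ### Projective modules over crossed products -/

/-- Choices of elements of given sets in the group algebras of symmetric groups of blocks. -/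
structure Label {F : Type*} [Field F] (I : Type*) (S : ∀ k, Set (MonoidAlgebra F (Equiv.Perm (Fin k)))) where
  m : I → ℕ
  f : ∀ j, MonoidAlgebra F (Equiv.Perm (Fin (m j)))
  mem : ∀ j, f j ∈ S (m j)

section Family

variable {F K : Type*} [Field F] [Field K] [Algebra F K] {G : Type v} [Group G]
  [MulSemiringAction G K] {I : Type*} [Fintype I] [DecidableEq I] [MulAction G I]
  {P : ℕ → Type v} [∀ n, CommRing (P n)] [∀ n, MulSemiringAction (Equiv.Perm (Fin n)) (P n)]
  [∀ n, MulSemiringAction G (P n)] (D : ∀ n, PointSystem K G I n (P n))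
  {S : ∀ k, Set (MonoidAlgebra F (Equiv.Perm (Fin k)))}

/-- The family of idempotents attached to a label. -/
noncomputable def labelFamily (l : Label I S) (n : ℕ) :
    SkewMonoidAlgebra (P n) (Equiv.Perm (Fin n)) :=
  Pi.single (M := fun n => SkewMonoidAlgebra (P n) (Equiv.Perm (Fin n))) (∑ j, l.m j)
    ((D _).labelIdem l.f) n

omit [DecidableEq I] in
theorem labelFamily_self (l : Label I S) :
    labelFamily D l (∑ j, l.m j) = (D _).labelIdem l.f :=
  Pi.single_eq_same _ _

omit [DecidableEq I] in
theorem labelFamily_of_ne (l : Label I S) {n : ℕ} (h : n ≠ ∑ j, l.m j) :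
    labelFamily D l n = 0 :=
  Pi.single_eq_of_ne h _

omit [DecidableEq I] in
theorem finite_labelFamily (l : Label I S) : {n | labelFamily D l n ≠ 0}.Finite :=
  (Set.finite_singleton (∑ j, l.m j)).subset fun n hn => by
    by_contra h
    exact hn (labelFamily_of_ne D l h)

variable (hS : ∀ k, ∀ x ∈ S k, IsSplitIdem F x)

include hS

omit [DecidableEq I] in
theorem isIdempotentElem_labelFamily (l : Label I S) : IsIdempotentElem (labelFamily D l) := by
  funext n
  change labelFamily D l n * labelFamily D l n = labelFamily D l n
  by_cases h : n = ∑ j, l.m j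
  · subst h
    rw [labelFamily_self]
    exact (D _).labelIdem_idem fun j => (hS _ _ (l.mem j)).idem
  · rw [labelFamily_of_ne D l h, mul_zero]

variable (hF : ∀ g : K →+* K, g.comp (algebraMap F K) = algebraMap F K)

include hF

theorem isLocalRing_end_labelFamily [∀ n, IsNoetherianRing (P n)]
    [∀ n, IsArtinianRing (SkewMonoidAlgebra (P n) (Equiv.Perm (Fin n)))ᵐᵒᵖ] (l : Label I S) :
    IsLocalRing (End (SumProj.cornerObj (labelFamily D l) (isIdempotentElem_labelFamily D hS l)
      (finite_labelFamily D l))) := by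
  have hl := fun j => hS _ _ (l.mem j)
  refine SumProj.isLocalRing_end_cornerObj (fun h0 => ?_) fun z hz h1 h2 => ?_
  · refine (D _).labelIdem_ne_zero hF hl ?_
    rw [← labelFamily_self, h0]; rfl
  · have h1' : ∀ n, labelFamily D l n * z n = z n := fun n => congrFun h1 n
    have h2' : ∀ n, z n * labelFamily D l n = z n := fun n => congrFun h2 n
    have h0 : ∀ n, n ≠ ∑ j, l.m j → z n = 0 := fun n hn => by
      rw [← h1', labelFamily_of_ne D l hn, zero_mul]
    have hp := (D (∑ j, l.m j)).labelIdem_primitive hF hl (z := z _) (congrFun hz _)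
      (by rw [← labelFamily_self, h1']) (by rw [← labelFamily_self, h2'])
    refine hp.imp (fun h => ?_) fun h => ?_
    · funext n
      by_cases hn : n = ∑ j, l.m j
      · subst hn; exact h
      · exact h0 n hn
    · funext n
      by_cases hn : n = ∑ j, l.m j
      · subst hn; rw [h, labelFamily_self]
      · rw [h0 n hn, labelFamily_of_ne D l hn]

omit hS hF

/-- `1` is the sum of the `e_i`. Each `i` is a rearrangement of the standard block function with the
same fibre sizes, so `e_i` is conjugate to `e (block m)`, which lies in the ideal of the label
idempotents. -/
theorem one_mem_closure_labelFamily
    (hS1 : ∀ k, (1 : MonoidAlgebra F (Equiv.Perm (Fin k))) ∈ twoSided (S k)) (n : ℕ) :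
    (1 : SkewMonoidAlgebra (P n) (Equiv.Perm (Fin n))) ∈
      AddSubgroup.closure {x | ∃ (l : Label I S) (a b : SkewMonoidAlgebra (P n) (Equiv.Perm (Fin n))),
        x = a * labelFamily D l n * b} := by
  have hone : (1 : SkewMonoidAlgebra (P n) (Equiv.Perm (Fin n))) = ∑ i, single 1 ((D n).e i) := by
    rw [SkewMonoidAlgebra.one_def, ← (D n).sum_e]
    exact map_sum (SkewMonoidAlgebra.singleAddHom 1) _ _
  rw [hone]
  refine sum_mem fun i _ => ?_
  obtain ⟨m, hm⟩ : ∃ m : I → ℕ, ∀ j, Fintype.card {a // i a = j} = m j := ⟨_, fun j => rfl⟩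
  obtain rfl : n = ∑ j, m j := by
    have := Fintype.card_congr (Equiv.sigmaFiberEquiv i)
    rw [Fintype.card_sigma, Fintype.card_fin] at this
    rw [← this]
    exact Finset.sum_congr rfl fun j _ => hm j
  obtain ⟨σ, rfl⟩ := exists_comp_perm hm
  have h1 : single 1 ((D (∑ j, m j)).e (block m ∘ σ)) =
      single σ⁻¹ 1 * single 1 ((D (∑ j, m j)).e (block m)) * single σ 1 := by
    rw [single_mul_single_e, inv_inv, mul_assoc, SkewMonoidAlgebra.single_mul_single, smul_one,
      inv_mul_cancel, mul_one, SkewMonoidAlgebra.single_mul_single]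
    simp
  rw [h1]
  have h2 := twoSided_mul_mem ((D (∑ j, m j)).single_e_mem_twoSided hS1) (single σ⁻¹ 1) (single σ 1)
  refine AddSubgroup.closure_mono ?_ h2
  rintro _ ⟨_, ⟨f, hf, rfl⟩, a, b, rfl⟩
  exact ⟨⟨m, f, hf⟩, a, b, by rw [← labelFamily_self D ⟨m, f, hf⟩]⟩

variable [RingActions G fun n => SkewMonoidAlgebra (P n) (Equiv.Perm (Fin n))]
  (hρ : ∀ n (g : G) σ a, ρ (R := fun n => SkewMonoidAlgebra (P n) (Equiv.Perm (Fin n))) n g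
    (single σ a) = single σ (g • a))
  (hS' : ∀ k, ∀ x ∈ S k, ∀ y ∈ S k, x ∈ twoSided {y} → x = y)

include hρ hS hS' hF

theorem exists_cocycle_labelFamily (l : Label I S) (H : Subgroup G)
    (h : ∀ g ∈ H, ∀ n, ∃ a b, labelFamily D l n =
      a * ρ (R := fun n => SkewMonoidAlgebra (P n) (Equiv.Perm (Fin n))) n g
        (labelFamily D l n) * b) :
    ∃ v : H → ∀ n, SkewMonoidAlgebra (P n) (Equiv.Perm (Fin n)),
      (∀ h n, v h n * ρ (R := fun n => SkewMonoidAlgebra (P n) (Equiv.Perm (Fin n))) n (h : G)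
        (labelFamily D l n) = labelFamily D l n * v h n) ∧
      (∀ n, v 1 n = 1) ∧
      ∀ h h' n, v (h * h') n = v h n *
        ρ (R := fun n => SkewMonoidAlgebra (P n) (Equiv.Perm (Fin n))) n (h : G) (v h' n) := by
  have hl := fun j => hS _ _ (l.mem j)
  have hm : ∀ g : H, ∀ j, l.m ((g : G) • j) = l.m j := fun g j => by
    obtain ⟨a, b, hab⟩ := h g g.2 (∑ j, l.m j)
    rw [labelFamily_self] at hab
    exact (D _).apply_smul_of_labelIdem_eq hF (hρ _ (g : G)) hl hab j
  have hf : ∀ g : H, blockTransport (g : G) (hm g) l.f = l.f := fun g => by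
    obtain ⟨a, b, hab⟩ := h g g.2 (∑ j, l.m j)
    rw [labelFamily_self] at hab
    exact (D _).blockTransport_eq_of_labelIdem_eq hF (hρ _ (g : G)) hS hS' l.mem hab (hm g)
  -- The cocycle is the block permutation in the one degree where the idempotent lives, and `1`
  -- elsewhere. Its coefficients are `1`, so `G` fixes it and the cocycle identity is
  -- multiplicativity of `blockPerm`.
  let v : H → ∀ n, SkewMonoidAlgebra (P n) (Equiv.Perm (Fin n)) := fun g =>
    Pi.mulSingle (∑ j, l.m j) (single (blockPerm (g : G) (hm g)) 1)
  have hv : ∀ g, v g (∑ j, l.m j) = single (blockPerm (g : G) (hm g)) 1 := fun g =>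
    Pi.mulSingle_eq_same _ _
  have hv' : ∀ g n, n ≠ ∑ j, l.m j → v g n = 1 := fun g n hn => Pi.mulSingle_eq_of_ne hn _
  refine ⟨v, fun g n => ?_, fun n => ?_, fun g g' n => ?_⟩
  · by_cases hn : n = ∑ j, l.m j
    · subst hn
      rw [hv, labelFamily_self, (D _).single_blockPerm_mul_map_labelIdem hF (hρ _ (g : G)) (hm g),
        hf]
    · rw [hv' _ _ hn, labelFamily_of_ne D l hn, map_zero, mul_zero, zero_mul]
  · by_cases hn : n = ∑ j, l.m j
    · subst hn
      rw [hv, SkewMonoidAlgebra.one_def]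
      congr 1
      exact blockPerm_one _
    · exact hv' _ _ hn
  · by_cases hn : n = ∑ j, l.m j
    · subst hn
      rw [hv, hv, hv, hρ, SkewMonoidAlgebra.single_mul_single, smul_one, smul_one, mul_one]
      congr 1
      exact blockPerm_mul _ _ _ _ _
    · rw [hv' _ _ hn, hv' _ _ hn, hv' _ _ hn, map_one, mul_one]

end Family

end PointSystem

end KSInterpolation

namespace KSInterpolation

namespace RationalSeries

/-! ### Points of the algebras `P_n` -/

section Points

variable {k : Type u} {K : Type v} [Field k] [Field K] [Algebra k K] (α : RationalSeries k)

theorem u_ne_zero : α.u ≠ 0 := by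
  intro h
  have h1 : α.u.coeff α.k = 1 := by
    rw [u, coeff_reflect, revAt_le le_rfl, Nat.sub_self, α.q_zero]
  rw [h, coeff_zero] at h1
  exact zero_ne_one h1

variable (K) (p e : ℕ) [ExpChar K p]

/-- The polynomial whose roots are the `p ^ e`-th powers of the roots of `u`. -/
noncomputable def frobU : K[X] := (α.baseChange K).u.map (iterateFrobenius K p e)

theorem frobU_ne_zero : α.frobU K p e ≠ 0 :=
  (Polynomial.map_ne_zero_iff (iterateFrobenius K p e).injective).2 (u_ne_zero _)

/-- The roots of `frobU`, with the Galois action. -/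
noncomputable def rootPoints : SubMulAction (K ≃ₐ[k] K) K where
  carrier := {r | (α.frobU K p e).IsRoot r}
  smul_mem' g r hr := by
    -- The coefficients are `p ^ e`-th powers of elements of `k`, hence fixed by the Galois group.
    have h : (α.frobU K p e).map (g : K →+* K) = α.frobU K p e := by
      rw [frobU, baseChange_u, Polynomial.map_map, Polynomial.map_map]
      ext a
      simp [iterateFrobenius_def]
    have h1 := hr.map (f := (g : K →+* K))
    rwa [h] at h1

theorem mem_rootPoints {r : K} : r ∈ α.rootPoints K p e ↔ (α.frobU K p e).IsRoot r := Iff.rfl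

theorem finite_rootPoints : Finite (α.rootPoints K p e) := by
  classical
  refine ((α.frobU K p e).roots.toFinset.finite_toSet.subset fun r hr => ?_).to_subtype
  rw [Finset.mem_coe, Multiset.mem_toFinset, mem_roots (α.frobU_ne_zero K p e)]
  exact hr

variable {K} (n : ℕ)

/-- Evaluation at a point, composed with a power of the Frobenius. -/
noncomputable def pointEval (i : Fin n → α.rootPoints K p e) : (α.baseChange K).P n →+* K :=
  Ideal.Quotient.lift ((α.baseChange K).ideal n)
    (MvPolynomial.eval₂Hom (iterateFrobenius K p e) fun a => (i a : K)) (by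
      suffices (α.baseChange K).ideal n ≤
          RingHom.ker (MvPolynomial.eval₂Hom (iterateFrobenius K p e) fun a => (i a : K)) from
        fun a ha => this ha
      rw [ideal, Ideal.span_le]
      rintro _ ⟨a, rfl⟩
      rw [SetLike.mem_coe, RingHom.mem_ker]
      beta_reduce
      rw [aeval_def, hom_eval₂, MvPolynomial.eval₂Hom_X']
      have h := (i a).2
      rw [mem_rootPoints, IsRoot, frobU, Polynomial.eval_map] at h
      have hc : (MvPolynomial.eval₂Hom (iterateFrobenius K p e) fun a => (i a : K)).comp
          (algebraMap K (MvPolynomial (Fin n) K)) = iterateFrobenius K p e :=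
        RingHom.ext fun b => MvPolynomial.eval₂Hom_C _ _ b
      rwa [hc])

theorem pointEval_mk (i : Fin n → α.rootPoints K p e) (f : MvPolynomial (Fin n) K) :
    α.pointEval p e n i (P.mk _ n f) =
      MvPolynomial.eval₂Hom (iterateFrobenius K p e) (fun a => (i a : K)) f := rfl

variable (K) in
/-- The structure map of `P_n`. -/
noncomputable def constP : K →+* (α.baseChange K).P n :=
  (P.mk _ n).comp MvPolynomial.C

/-- Modulo a prime, the `p ^ e`-th powers of the variables are roots of the split polynomial
`frobU`, hence constants from `K`. So `y ^ p ^ e` is the value of `y` at a point, and if this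
vanishes, `y` lies in the prime. -/
theorem isNilpotent_of_pointEval (hs : (α.frobU K p e).Splits) (y : (α.baseChange K).P n)
    (hy : ∀ i, α.pointEval p e n i y = 0) : IsNilpotent y := by
  rw [nilpotent_iff_mem_prime]
  intro J hJ
  let π := Ideal.Quotient.mk J
  let c : K →+* (α.baseChange K).P n ⧸ J := π.comp (α.constP K n)
  have : ExpChar ((α.baseChange K).P n ⧸ J) p := expChar_of_injective_ringHom c.injective p
  let fr := iterateFrobenius ((α.baseChange K).P n ⧸ J) p e
  have hc : c.comp (iterateFrobenius K p e) = fr.comp c := RingHom.iterateFrobenius_comm c p e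
  let x : Fin n → (α.baseChange K).P n ⧸ J := fun a => π (P.mk _ n (MvPolynomial.X a))
  have hx : ∀ a, eval₂ c (x a) (α.baseChange K).u = 0 := by
    intro a
    have h0 : P.mk (α.baseChange K) n
        (aeval (MvPolynomial.X a : MvPolynomial (Fin n) K) (α.baseChange K).u) = 0 :=
      Ideal.Quotient.eq_zero_iff_mem.2 (Ideal.subset_span ⟨a, rfl⟩)
    have h1 := congrArg π h0
    rw [map_zero, aeval_def, hom_eval₂, hom_eval₂] at h1
    exact h1
  have hroot : ∀ a, ∃ r : α.rootPoints K p e, fr (x a) = c r := by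
    intro a
    have h1 : eval₂ c (fr (x a)) (α.frobU K p e) = 0 := by
      rw [frobU, eval₂_map, hc, ← hom_eval₂, hx, map_zero]
    rw [hs.eq_prod_roots, eval₂_mul, eval₂_C, mul_eq_zero] at h1
    have h2 := h1.resolve_left fun h => by
      rw [map_eq_zero_iff _ c.injective, leadingCoeff_eq_zero] at h
      exact α.frobU_ne_zero K p e h
    rw [← coe_eval₂RingHom, map_multiset_prod, Multiset.prod_eq_zero_iff, Multiset.map_map,
      Multiset.mem_map] at h2
    obtain ⟨r, hr, h3⟩ := h2
    refine ⟨⟨r, (mem_roots'.1 hr).2⟩, ?_⟩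
    simpa [sub_eq_zero] using h3
  choose i hi using hroot
  obtain ⟨f, rfl⟩ := P.mk_surjective _ _ y
  have h4 : fr (π (P.mk _ n f)) = c (α.pointEval p e n i (P.mk _ n f)) := by
    rw [pointEval_mk, MvPolynomial.map_eval₂Hom, hc]
    have h5 : (fr.comp π).comp (P.mk _ n) =
        MvPolynomial.eval₂Hom (fr.comp c) fun a => c (i a) := by
      ext a
      · simp [c, constP]
      · simpa using hi a
    exact DFunLike.congr_fun h5 f
  rw [hy, map_zero, map_eq_zero_iff _ (iterateFrobenius_inj _ p e)] at h4
  exact Ideal.Quotient.eq_zero_iff_mem.1 h4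

/-- Lagrange interpolation in each variable. Evaluation applies Frobenius to constants, so `x_a ^ p
^ e - r` takes the value `(j_a - r) ^ p ^ e` at the point `j`. -/
theorem exists_pointEval_eq [DecidableEq (Fin n → α.rootPoints K p e)]
    (i : Fin n → α.rootPoints K p e) :
    ∃ y, ∀ j, α.pointEval p e n j y = if j = i then 1 else 0 := by
  classical
  have := α.finite_rootPoints K p e
  have := Fintype.ofFinite (α.rootPoints K p e)
  let y : (α.baseChange K).P n := ∏ a, ∏ r ∈ Finset.univ.erase (i a),
    (P.mk _ n (MvPolynomial.X a) ^ p ^ e - α.constP K n r) * α.constP K n ((i a : K) - r)⁻¹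
  have hy : ∀ j, α.pointEval p e n j y = ∏ a, ∏ r ∈ Finset.univ.erase (i a),
      (((j a : K) - r) * ((i a : K) - r)⁻¹) ^ p ^ e := by
    intro j
    simp only [y, map_prod, map_mul, map_sub, map_pow, constP, RingHom.comp_apply, pointEval_mk,
      MvPolynomial.eval₂Hom_X', MvPolynomial.eval₂Hom_C, iterateFrobenius_def, mul_pow,
      sub_pow_expChar_pow]
  refine ⟨y, fun j => ?_⟩
  rw [hy]
  split_ifs with h
  · subst h
    refine Finset.prod_eq_one fun a _ => Finset.prod_eq_one fun r hr => ?_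
    rw [mul_inv_cancel₀, one_pow]
    rw [sub_ne_zero]
    exact fun h => Finset.ne_of_mem_erase hr (Subtype.ext h.symm)
  · obtain ⟨a, ha⟩ := Function.ne_iff.1 h
    refine Finset.prod_eq_zero (Finset.mem_univ a)
      (Finset.prod_eq_zero (Finset.mem_erase.2 ⟨ha, Finset.mem_univ _⟩) ?_)
    rw [sub_self, zero_mul, zero_pow (expChar_pow_pos K p e).ne']

theorem exists_idem_pointEval_eq [DecidableEq (Fin n → α.rootPoints K p e)]
    (hs : (α.frobU K p e).Splits) (i : Fin n → α.rootPoints K p e) :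
    ∃ y, y * y = y ∧ ∀ j, α.pointEval p e n j y = if j = i then 1 else 0 := by
  let f : (α.baseChange K).P n →+* ((Fin n → α.rootPoints K p e) → K) :=
    RingHom.pi fun j => α.pointEval p e n j
  obtain ⟨y, hy⟩ := α.exists_pointEval_eq p e n i
  obtain ⟨z, hz, hzy⟩ := exists_isIdempotentElem_eq_of_ker_isNilpotent f
    (fun x hx => α.isNilpotent_of_pointEval p e n hs x fun j => congrFun hx j) (f y) ⟨y, rfl⟩ (by
      funext j
      change α.pointEval p e n j y * α.pointEval p e n j y = α.pointEval p e n j y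
      rw [hy]
      split_ifs <;> simp)
  exact ⟨z, hz, fun j => (congrFun hzy j).trans (hy j)⟩

open Classical in
/-- The points of `P_n`. -/
noncomputable def pointSystem (hs : (α.frobU K p e).Splits) :
    PointSystem K (K ≃ₐ[k] K) (α.rootPoints K p e) n ((α.baseChange K).P n) where
  φ := iterateFrobenius K p e
  c := α.constP K n
  gal_smul_c g a := by
    rw [constP, RingHom.comp_apply, gal_smul_mk, MvPolynomial.map_C]; rfl
  perm_smul_c σ a := by
    rw [constP, RingHom.comp_apply, perm_smul_mk, MvPolynomial.rename_C]
  θ := α.pointEval p e n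
  θ_c i a := by
    rw [constP, RingHom.comp_apply, pointEval_mk, MvPolynomial.eval₂Hom_C]
  θ_perm_smul i σ y := by
    obtain ⟨f, rfl⟩ := P.mk_surjective _ _ y
    rw [perm_smul_mk, pointEval_mk, pointEval_mk, MvPolynomial.coe_eval₂Hom,
      MvPolynomial.eval₂_rename]
    rfl
  θ_gal_smul i g y := by
    obtain ⟨f, rfl⟩ := P.mk_surjective _ _ y
    rw [gal_smul_mk, pointEval_mk, pointEval_mk, MvPolynomial.eval₂Hom_map_hom]
    change _ = (g : K →+* K) _
    rw [MvPolynomial.map_eval₂Hom, ← RingHom.iterateFrobenius_comm]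
    rfl
  isNilpotent := α.isNilpotent_of_pointEval p e n hs
  e i := (α.exists_idem_pointEval_eq p e n hs i).choose
  e_idem i := (α.exists_idem_pointEval_eq p e n hs i).choose_spec.1
  θ_e_self i := ((α.exists_idem_pointEval_eq p e n hs i).choose_spec.2 i).trans (if_pos rfl)
  θ_e_of_ne i i' h := ((α.exists_idem_pointEval_eq p e n hs i').choose_spec.2 i).trans (if_neg h)

end Points

/-- Each of the finitely many roots of `u` in `K'` has some `p ^ N`-th power in `K`; the largest
such `N` serves all of them. -/
theorem exists_splits_frobU {k : Type u} {K : Type v} {K' : Type w} [Field k] [Field K] [Field K']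
    [Algebra k K] [Algebra k K'] [Algebra K K'] [IsScalarTower k K K'] (α : RationalSeries k)
    (hK' : (α.u.map (algebraMap k K')).Splits) [IsPurelyInseparable K K'] (p : ℕ) [ExpChar K p] :
    ∃ e, (α.frobU K p e).Splits := by
  classical
  have hpow := fun x : K' => IsPurelyInseparable.pow_mem K p x
  choose N hN using hpow
  have := expChar_of_injective_algebraMap (algebraMap K K').injective p
  set U := α.u.map (algebraMap k K') with hU
  let e := U.roots.toFinset.sup N
  refine ⟨e, ?_⟩
  have h1 : (α.frobU K p e).map (algebraMap K K') = U.map (iterateFrobenius K' p e) := by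
    rw [frobU, Polynomial.map_map, RingHom.iterateFrobenius_comm, ← Polynomial.map_map,
      baseChange_u, Polynomial.map_map (algebraMap k K), ← IsScalarTower.algebraMap_eq]
  refine Splits.of_splits_map (algebraMap K K') (by rw [h1]; exact hK'.map _) fun a ha => ?_
  rw [h1, hK'.roots_map, Multiset.mem_map] at ha
  obtain ⟨r, hr, rfl⟩ := ha
  obtain ⟨s, hs⟩ := hN r
  have hle : N r ≤ e := Finset.le_sup (f := N) (Multiset.mem_toFinset.2 hr)
  refine ⟨s ^ p ^ (e - N r), ?_⟩
  rw [map_pow, hs, iterateFrobenius_def, ← pow_mul, ← pow_add, Nat.add_sub_cancel' hle]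

end RationalSeries

end KSInterpolation

namespace KSInterpolation

namespace RationalSeries

open SkewMonoidAlgebra (single)

/-! ### Finiteness of the crossed products -/

section Artinian

variable {F : Type u} [Field F] (α : RationalSeries F) (n : ℕ)

noncomputable instance algebraP : Algebra F (α.P n) :=
  inferInstanceAs (Algebra F (MvPolynomial (Fin n) F ⧸ α.ideal n))

theorem algebraMap_P (a : F) : algebraMap F (α.P n) a = P.mk α n (MvPolynomial.C a) := rfl

theorem monic_u : α.u.Monic := by
  refine monic_of_natDegree_le_of_coeff_eq_one α.k ?_ ?_
  · refine natDegree_le_iff_coeff_eq_zero.2 fun N hN => ?_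
    rw [u, coeff_reflect, revAt_eq_self_of_lt hN]
    exact coeff_eq_zero_of_natDegree_lt ((le_max_right _ _).trans_lt hN)
  · rw [u, coeff_reflect, revAt_le le_rfl, Nat.sub_self, α.q_zero]

instance finite_P : Module.Finite F (α.P n) := by
  refine Algebra.finite_iff_isIntegral_and_finiteType.2 ⟨⟨fun y => ?_⟩,
    inferInstanceAs (Algebra.FiniteType F (MvPolynomial (Fin n) F ⧸ α.ideal n))⟩
  obtain ⟨f, rfl⟩ := P.mk_surjective _ _ y
  induction f using MvPolynomial.induction_on with
  | C a => exact isIntegral_algebraMap (x := a)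
  | add f g hf hg => rw [map_add]; exact hf.add hg
  | mul_X f a hf =>
    rw [map_mul]
    refine hf.mul ⟨α.u, α.monic_u, ?_⟩
    have h0 : P.mk α n (aeval (MvPolynomial.X a : MvPolynomial (Fin n) F) α.u) = 0 :=
      Ideal.Quotient.eq_zero_iff_mem.2 (Ideal.subset_span ⟨a, rfl⟩)
    rwa [aeval_def, hom_eval₂] at h0

instance isArtinianRing_P : IsArtinianRing (α.P n) := isArtinian_of_tower F inferInstance

instance finite_crossed : Module.Finite F (α.Crossed n) :=
  Module.Finite.equiv
    (SkewMonoidAlgebra.coeffLinearEquiv (k := α.P n) (G := Equiv.Perm (Fin n)) (S := F)).symm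

theorem smul_crossed (a : F) (x : α.Crossed n) :
    a • x = single 1 (algebraMap F (α.P n) a) * x := by
  refine SkewMonoidAlgebra.ext fun σ => ?_
  rw [SkewMonoidAlgebra.coeff_single_one_mul, SkewMonoidAlgebra.coeff_smul, Finsupp.smul_apply,
    Algebra.smul_def]

theorem single_algebraMap_mul_comm (a : F) (x : α.Crossed n) :
    single 1 (algebraMap F (α.P n) a) * x = x * single 1 (algebraMap F (α.P n) a) := by
  refine SkewMonoidAlgebra.ext fun σ => ?_
  rw [SkewMonoidAlgebra.coeff_single_one_mul, SkewMonoidAlgebra.coeff_mul_single_one,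
    algebraMap_P, perm_smul_mk, MvPolynomial.rename_C, mul_comm]

instance isArtinianRing_crossed : IsArtinianRing (α.Crossed n)ᵐᵒᵖ := by
  have : IsScalarTower F (α.Crossed n)ᵐᵒᵖ (α.Crossed n)ᵐᵒᵖ := ⟨fun a x y => by
    refine MulOpposite.unop_injective ?_
    change y.unop * (a • x.unop) = a • (y.unop * x.unop)
    rw [smul_crossed, smul_crossed, ← mul_assoc, ← mul_assoc, single_algebraMap_mul_comm]⟩
  have : Module.Finite F (α.Crossed n)ᵐᵒᵖ :=
    Module.Finite.equiv (MulOpposite.opLinearEquiv F (M := α.Crossed n))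
  exact isArtinian_of_tower F inferInstance

end Artinian

/-! ### Trace-dual bases -/

/-- For trace-dual bases, the matrices with entries `g (b i)` and `g (c j)` have product `1`. They
are square because the Galois group has order `[K:k]`, so the product in the other order is also
`1`; its row at the identity is the second relation. -/
theorem exists_dual_bases (k : Type u) (K : Type v) [Field k] [Field K] [Algebra k K]
    [FiniteDimensional k K] [IsGalois k K] [DecidableEq (K ≃ₐ[k] K)] :
    ∃ b c : Fin (Module.finrank k K) → K,
      (∀ i j, ∑ g : K ≃ₐ[k] K, g (b i * c j) = if i = j then 1 else 0) ∧
      ∀ g : K ≃ₐ[k] K, ∑ j, c j * g (b j) = if g = 1 then 1 else 0 := by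
  let b := Module.finBasis k K
  let c := (Algebra.traceForm k K).dualBasis (traceForm_nondegenerate k K) b
  have h1 : ∀ i j, ∑ g : K ≃ₐ[k] K, g (b i * c j) = if i = j then 1 else 0 := by
    intro i j
    have := LinearMap.BilinForm.apply_dualBasis_left (B := Algebra.traceForm k K)
      (traceForm_nondegenerate k K) b j i
    rw [Algebra.traceForm_apply] at this
    have h2 := trace_eq_sum_automorphisms (K := k) (b i * c j)
    rw [mul_comm (b i), this, mul_comm] at h2
    rw [← h2]
    split_ifs <;> simp
  refine ⟨b, c, h1, ?_⟩
  let B : Matrix (Fin (Module.finrank k K)) (K ≃ₐ[k] K) K := .of fun i g => g (b i)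
  let C : Matrix (K ≃ₐ[k] K) (Fin (Module.finrank k K)) K := .of fun g j => g (c j)
  have hBC : B * C = 1 := by
    ext i j
    rw [Matrix.mul_apply, Matrix.one_apply, ← h1]
    simp [B, C]
  have hcard : Fintype.card (Fin (Module.finrank k K)) = Fintype.card (K ≃ₐ[k] K) := by
    rw [Fintype.card_fin, ← IsGalois.card_aut_eq_finrank, Nat.card_eq_fintype_card]
  have hCB := (Matrix.mul_eq_one_comm_of_card_eq _ _ _ hcard).1 hBC
  intro g
  have h2 := congrFun (congrFun hCB 1) g
  rw [Matrix.mul_apply, Matrix.one_apply] at h2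
  simp only [eq_comm (a := g)]
  exact h2

end RationalSeries

section Main

open SkewMonoidAlgebra (single)
open KSInterpolation.RingActions (ρ)

variable {k : Type u} {K : Type v} [Field k] [Field K] [Algebra k K] (α : RationalSeries k)

noncomputable instance crossedRingActions :
    RingActions (K ≃ₐ[k] K) fun n => (α.baseChange K).Crossed n where
  ρ := fun n => α.crossedHom K n

theorem ρ_crossed_single (n : ℕ) (g : K ≃ₐ[k] K) (σ : Equiv.Perm (Fin n))
    (a : (α.baseChange K).P n) :
    ρ (R := fun n => (α.baseChange K).Crossed n) n g (single σ a) = single σ (g • a) :=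
  α.crossedMap_single K n g σ a

/-- Constants from `K` are central in the crossed product and `G` acts on them as on `K`, so the
trace-dual bases supply the elements required by `SumProj.injective_map_forget`. -/
theorem injective_map_forget_crossed [FiniteDimensional k K] [IsGalois k K] :
    Function.Injective (K0.map (EquivariantObject.forget (K ≃ₐ[k] K)
      (SumProj fun n => (α.baseChange K).Crossed n))) := by
  classical
  obtain ⟨b, c, h1, h2⟩ := RationalSeries.exists_dual_bases k K
  have : Nonempty (Fin (Module.finrank k K)) := ⟨⟨0, Module.finrank_pos⟩⟩
  let ζ : ∀ n, K →+* (α.baseChange K).Crossed n := fun n =>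
    SkewMonoidAlgebra.singleOneRingHom.comp (algebraMap K ((α.baseChange K).P n))
  have hζ : ∀ n (g : K ≃ₐ[k] K) a,
      ρ (R := fun n => (α.baseChange K).Crossed n) n g (ζ n a) = ζ n (g a) := by
    intro n g a
    refine (ρ_crossed_single α n g 1 _).trans ?_
    rw [RationalSeries.algebraMap_P, RationalSeries.gal_smul_mk, MvPolynomial.map_C]
    rfl
  have hcomm : ∀ n a (r : (α.baseChange K).Crossed n), ζ n a * r = r * ζ n a := fun n a r =>
    (α.baseChange K).single_algebraMap_mul_comm n a r
  refine SumProj.injective_map_forget (fun j n => ζ n (b j)) (fun j n => ζ n (c j))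
    (fun i j n => ?_) (fun g n => ?_) (fun j n r => hcomm n _ r) fun j n r => hcomm n _ r
  · simp only [← map_mul (ζ n), hζ]
    rw [← map_sum, h1]
    split_ifs <;> simp
  · simp only [hζ, ← map_mul (ζ n)]
    rw [← map_sum, h2]
    split_ifs <;> simp

theorem range_and_exists_of_prime_field {F : Type*} [Field F] [Algebra F K]
    (hF : ∀ g : K →+* K, g.comp (algebraMap F K) = algebraMap F K)
    (hsplit : ∀ m (f : MonoidAlgebra F (Equiv.Perm (Fin m))), IsPrimitiveIdem f → IsSplitIdem F f)
    [FiniteDimensional k K] {p e : ℕ} [ExpChar K p] (hs : (α.frobU K p e).Splits) :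
    (K0.map (EquivariantObject.forget (K ≃ₐ[k] K)
      (SumProj fun n => (α.baseChange K).Crossed n))).range =
        FixedPoints.addSubgroup (K ≃ₐ[k] K) (K0 (SumProj fun n => (α.baseChange K).Crossed n)) ∧
    ∀ V : SumProj fun n => (α.baseChange K).Crossed n, Indecomposable V →
      ∃ F : EquivariantObject (K ≃ₐ[k] K) (SumProj fun n => (α.baseChange K).Crossed n),
        (K0.cls F.X = ∑ᶠ x ∈ MulAction.orbit (K ≃ₐ[k] K) (K0.cls V), x) ∧
        ∃ b : Bicone fun q : (K ≃ₐ[k] K) ⧸ MulAction.stabilizer (K ≃ₐ[k] K) (K0.cls V) =>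
            (StrictAction.T q.out).obj V,
          Nonempty b.IsBilimit ∧
          ∃ e : b.pt ≅ F.X, ∀ (g : K ≃ₐ[k] K) (q q'), q' ≠ g • q →
            (StrictAction.T g).map (b.ι q ≫ e.hom) ≫ (F.α g).hom ≫ e.inv ≫ b.π q' = 0 := by
  classical
  have := α.finite_rootPoints K p e
  have := Fintype.ofFinite (α.rootPoints K p e)
  choose S hS hS' hS1 using fun m => exists_labels F (hsplit m)
  let D := fun n => α.pointSystem p e n hs
  have hfin := fun l : PointSystem.Label (α.rootPoints K p e) S =>
    PointSystem.finite_labelFamily D l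
  have hloc := PointSystem.isLocalRing_end_labelFamily D hS hF
  have hspan := PointSystem.one_mem_closure_labelFamily D hS1
  have hact := PointSystem.exists_cocycle_labelFamily D hS hF (ρ_crossed_single α) hS'
  refine ⟨SumProj.range_map_forget _ _ hfin hloc hspan hact, fun V hV => ?_⟩
  have := isLocalRing_end_of_indecomposable hV
  exact SumProj.exists_equivariant_of_isLocalRing _ _ hfin hloc hspan hact V

end Main

end KSInterpolation

/-- Setup: `K'` is a splitting field of `u_α ∈ k[t]`, and `k ⊆ K ⊆ K'` with `K/k` Galois and `K'/K`
purely inseparable, i.e. `K` is the separable closure of `k` in `K'`; `G = Gal(K/k)`. -/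
theorem mainTheorem10 {k : Type u} {K : Type v} {K' : Type w} [Field k] [Field K] [Field K']
    [Algebra k K] [Algebra k K'] [Algebra K K'] [IsScalarTower k K K']
    (α : RationalSeries k) (hK' : α.u.IsSplittingField k K')
    [IsGalois k K] [IsPurelyInseparable K K'] :
    -- `K₀(Forg) : K₀((𝒮_{α^K})^G) → K₀(𝒮_{α^K})` is injective with image `K₀(𝒮_{α^K})^G`
    Function.Injective
        (K0.map (EquivariantObject.forget (K ≃ₐ[k] K) (SCat (α.baseChange K)))) ∧
    (K0.map (EquivariantObject.forget (K ≃ₐ[k] K) (SCat (α.baseChange K)))).range =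
        FixedPoints.addSubgroup (K ≃ₐ[k] K) (K0 (SCat (α.baseChange K))) ∧
    -- every orbit sum is the class of an equivariant object `F`: for an indecomposable `V`, with
    -- `g_q` representing the cosets `q` of the stabilizer of `[V]`, one has `F ≅ ⨁_q T_{g_q} V`,
    -- and `F.α g : T_g F → F` maps the summand of index `q` to the summand of index `g q`
    ∀ V : SCat (α.baseChange K), Indecomposable V →
      ∃ F : EquivariantObject (K ≃ₐ[k] K) (SCat (α.baseChange K)),
        (K0.cls F.X = ∑ᶠ x ∈ MulAction.orbit (K ≃ₐ[k] K) (K0.cls V), x) ∧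
        ∃ b : Bicone fun q : (K ≃ₐ[k] K) ⧸ MulAction.stabilizer (K ≃ₐ[k] K) (K0.cls V) =>
            (StrictAction.T q.out).obj V,
          Nonempty b.IsBilimit ∧
          ∃ e : b.pt ≅ F.X, ∀ (g : K ≃ₐ[k] K) (q q'), q' ≠ g • q →
            (StrictAction.T g).map (b.ι q ≫ e.hom) ≫ (F.α g).hom ≫ e.inv ≫ b.π q' = 0 := by
  have := hK'.finiteDimensional
  have : FiniteDimensional k K :=
    Module.Finite.of_injective (IsScalarTower.toAlgHom k K K').toLinearMap
      (algebraMap K K').injective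
  obtain ⟨p, hp⟩ := ExpChar.exists K
  obtain ⟨e, he⟩ := α.exists_splits_frobU hK'.splits (K := K) p
  refine ⟨injective_map_forget_crossed α, ?_⟩
  -- In characteristic zero the exponential characteristic is `1`, Frobenius is the identity and the
  -- prime field is `ℚ`; otherwise it is `ZMod p`.
  rcases hp with _ | hprime
  · exact range_and_exists_of_prime_field (F := ℚ) α (fun g => Subsingleton.elim _ _)
      (fun m f => isSplitIdem_rat_perm m) he
  · have : Fact p.Prime := ⟨hprime⟩
    let := ZMod.algebra K p
    exact range_and_exists_of_prime_field (F := ZMod p) α (fun g => Subsingleton.elim _ _)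
      (fun m f => isSplitIdem_zmod p (hasConjPowers_perm _)) he
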